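/- Let $N\ge 2$ be an integer, let $\Omega\subset\mathbb R^N$ be a bounded domain, let $1<q<p<N$ and $\nu\ge 0$, and put $p^*=Np/(N-p)$. Let $W^{1,p}_0(\Omega)$ be the usual Sobolev space with norm $\|u\|=\big(\int_\Omega|\nabla u|^p\,dx\big)^{1/p}$. Let $f:\Omega\times\mathbb R\to\mathbb R$ be a Carathéodory function such that, for some constants $a_1,a_2>0$ and $r\in(p,p^*)$, $$|f(x,t)|\le a_1|t|^{r-1}+a_2\qquad\text{for a.a. }x\in\Omega\text{ and all }t\in\mathbb R,$$ and let $F(x,t)=\int_0^t f(x,\tau)\,d\tau$. Consider the $C^1$-functional $$E_\nu(u)=\int_\Omega\Big(\frac1p|\nabla u|^p+\frac{\nu}{q}|\nabla u|^q-F(x,u)-\frac1{p^*}|u|^{p^*}\Big)dx,\qquad u\in W^{1,p}_0(\Omega),$$ and let $$c^*=\frac1N S^{N/p},\qquad S=\inf_{u\in W^{1,p}_0(\Omega)\setminus\{0\}}\frac{\int_\Omega|\nabla u|^p\,dx}{\big(\int_\Omega|u|^{p^*}dx\big)^{p/p^*}}.$$ If $0<c<c^*$, then every sequence $(u_j)$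 in $W^{1,p}_0(\Omega)$ with $E_\nu(u_j)\to c$ and $E_\nu'(u_j)\to 0$ in the dual space of $W^{1,p}_0(\Omega)$ has a subsequence that converges weakly in $W^{1,p}_0(\Omega)$ to a nontrivial (that is, nonzero) critical point of $E_\nu$. -/

import Mathlib

open Set Filter Topology MeasureTheory
open scoped ENNReal ContDiff

noncomputable section

namespace CriticalPQ

/-- Test functions `C_c^∞(Ω)`. -/
structure IsTestFunction {N : ℕ} (Ω : Set (EuclideanSpace ℝ (Fin N)))
    (φ : EuclideanSpace ℝ (Fin N) → ℝ) : Prop where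
  smooth : ContDiff ℝ ∞ φ
  compact : HasCompactSupport φ
  supp : tsupport φ ⊆ Ω

/-- The space `L^p(Ω) × L^p(Ω; ℝ^N)`, in which `W^{1,p}(Ω)` is realised through
`u ↦ (u, ∇u)`. -/
abbrev LpPair {N : ℕ} (Ω : Set (EuclideanSpace ℝ (Fin N))) (p : ℝ) : Type :=
  Lp ℝ (ENNReal.ofReal p) (volume.restrict Ω) ×
    Lp (EuclideanSpace ℝ (Fin N)) (ENNReal.ofReal p) (volume.restrict Ω)

/-- The pairs `(φ, ∇φ)` with `φ ∈ C_c^∞(Ω)`. -/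
def testPairs {N : ℕ} (Ω : Set (EuclideanSpace ℝ (Fin N))) (p : ℝ)
    [Fact (1 ≤ ENNReal.ofReal p)] : Submodule ℝ (LpPair Ω p) where
  carrier := {w | ∃ φ : EuclideanSpace ℝ (Fin N) → ℝ, IsTestFunction Ω φ ∧
    w.1 =ᵐ[volume.restrict Ω] φ ∧ w.2 =ᵐ[volume.restrict Ω] gradient φ}
  zero_mem' := by
    refine ⟨fun _ => 0, ⟨contDiff_const, HasCompactSupport.zero, by simp [tsupport]⟩, ?_, ?_⟩
    · exact Lp.coeFn_zero _ _ _
    · filter_upwards [Lp.coeFn_zero (EuclideanSpace ℝ (Fin N)) (ENNReal.ofReal p)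
        (volume.restrict Ω)] with x hx
      rw [gradient_fun_const]
      exact hx
  add_mem' := by
    rintro a b ⟨φ, hφ, h1, h2⟩ ⟨ψ, hψ, h3, h4⟩
    refine ⟨φ + ψ, ⟨hφ.smooth.add hψ.smooth, hφ.compact.add hψ.compact,
      (tsupport_add φ ψ).trans (union_subset hφ.supp hψ.supp)⟩, ?_, ?_⟩
    · filter_upwards [Lp.coeFn_add a.1 b.1, h1, h3] with x hx hx1 hx3
      simp only [Prod.fst_add, hx, Pi.add_apply, hx1, hx3]
    · filter_upwards [Lp.coeFn_add a.2 b.2, h2, h4] with x hx hx2 hx4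
      have d1 : DifferentiableAt ℝ φ x := hφ.smooth.differentiable (by simp) x
      have d2 : DifferentiableAt ℝ ψ x := hψ.smooth.differentiable (by simp) x
      simp only [Prod.snd_add, hx, Pi.add_apply, hx2, hx4, gradient, fderiv_add d1 d2, map_add]
  smul_mem' := by
    rintro c a ⟨φ, hφ, h1, h2⟩
    refine ⟨c • φ, ⟨hφ.smooth.const_smul c, hφ.compact.smul_left (f := fun _ => c),
      (closure_mono (Function.support_const_smul_subset c φ)).trans hφ.supp⟩, ?_, ?_⟩
    · filter_upwards [Lp.coeFn_smul c a.1, h1] with x hx hx1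
      simp only [Prod.smul_fst, hx, Pi.smul_apply, hx1]
    · filter_upwards [Lp.coeFn_smul c a.2, h2] with x hx hx2
      have d1 : DifferentiableAt ℝ φ x := hφ.smooth.differentiable (by simp) x
      simp only [Prod.smul_snd, hx, Pi.smul_apply, hx2, gradient, fderiv_const_smul d1, map_smul]

/-- The Sobolev space `W_0^{1,p}(Ω)`: the closure of `C_c^∞(Ω)` in the norm of `W^{1,p}(Ω)`.
An element is the pair `(u, ∇u)` of (classes of) a function and its weak gradient; the norm
inherited from the product is `max ‖u‖_p ‖∇u‖_p`, which for bounded `Ω` is equivalent to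
`‖∇u‖_p` by Poincaré's inequality, so that derivatives, the convergence of derivatives in the
dual space, and weak convergence are the same for both norms. -/
abbrev W0 {N : ℕ} (Ω : Set (EuclideanSpace ℝ (Fin N))) (p : ℝ)
    [Fact (1 ≤ ENNReal.ofReal p)] : Type :=
  (testPairs Ω p).topologicalClosure

variable {N : ℕ} {Ω : Set (EuclideanSpace ℝ (Fin N))} {p : ℝ} [Fact (1 ≤ ENNReal.ofReal p)]

/-- The function underlying an element of `W_0^{1,p}(Ω)`. -/
def W0.fn (u : W0 Ω p) : EuclideanSpace ℝ (Fin N) → ℝ := u.1.1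

/-- The weak gradient of an element of `W_0^{1,p}(Ω)`. -/
def W0.grad (u : W0 Ω p) : EuclideanSpace ℝ (Fin N) → EuclideanSpace ℝ (Fin N) := u.1.2

/-- The critical Sobolev exponent `p^* = N p / (N - p)`. -/
def pStar (N : ℕ) (p : ℝ) : ℝ := N * p / (N - p)

/-- Carathéodory functions on `Ω × ℝ`. -/
structure IsCaratheodory {N : ℕ} (Ω : Set (EuclideanSpace ℝ (Fin N)))
    (f : EuclideanSpace ℝ (Fin N) → ℝ → ℝ) : Prop where
  measurable : ∀ t : ℝ, AEMeasurable (fun x => f x t) (volume.restrict Ω)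
  continuous : ∀ᵐ x ∂(volume.restrict Ω), Continuous (f x)

/-- The subcritical growth condition: `|f(x,t)| ≤ a₁ |t|^{r-1} + a₂` for a.a. `x ∈ Ω` and all
`t`, for some `a₁, a₂ > 0` and `r ∈ (p, p^*)`. -/
def SubcriticalGrowth {N : ℕ} (Ω : Set (EuclideanSpace ℝ (Fin N))) (p : ℝ)
    (f : EuclideanSpace ℝ (Fin N) → ℝ → ℝ) : Prop :=
  ∃ a₁ a₂ r : ℝ, 0 < a₁ ∧ 0 < a₂ ∧ p < r ∧ r < pStar N p ∧
    ∀ᵐ x ∂(volume.restrict Ω), ∀ t : ℝ, |f x t| ≤ a₁ * |t| ^ (r - 1) + a₂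

/-- The functional `E_ν` on `W_0^{1,p}(Ω)`, with `F(x,t) = ∫_0^t f(x,τ) dτ`. -/
def energy (q ν : ℝ) (f : EuclideanSpace ℝ (Fin N) → ℝ → ℝ) (u : W0 Ω p) : ℝ :=
  ∫ x in Ω, (1 / p * ‖u.grad x‖ ^ p + ν / q * ‖u.grad x‖ ^ q - (∫ τ in (0 : ℝ)..(u.fn x), f x τ)
    - 1 / pStar N p * |u.fn x| ^ pStar N p)

/-- The best Sobolev constant `S`. -/
def sobolevConst {N : ℕ} (Ω : Set (EuclideanSpace ℝ (Fin N))) (p : ℝ)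
    [Fact (1 ≤ ENNReal.ofReal p)] : ℝ :=
  ⨅ u : {u : W0 Ω p // u ≠ 0},
    (∫ x in Ω, ‖u.1.grad x‖ ^ p) / (∫ x in Ω, |u.1.fn x| ^ pStar N p) ^ (p / pStar N p)

/-- The threshold level `c^* = S^{N/p} / N`. -/
def cStar {N : ℕ} (Ω : Set (EuclideanSpace ℝ (Fin N))) (p : ℝ)
    [Fact (1 ≤ ENNReal.ofReal p)] : ℝ :=
  1 / N * sobolevConst Ω p ^ (N / p)

/-- A Palais–Smale sequence at level `c`: `I(u_j) → c`, and `I'(u_j) → 0` in the dual space. -/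
structure IsPalaisSmale {X : Type*} [NormedAddCommGroup X] [NormedSpace ℝ X] (I : X → ℝ) (c : ℝ)
    (u : ℕ → X) : Prop where
  level : Tendsto (fun j => I (u j)) atTop (𝓝 c)
  deriv : Tendsto (fun j => fderiv ℝ I (u j)) atTop (𝓝 0)

/-- A critical point: `I` is Fréchet differentiable at `u`, with derivative `0`. -/
def IsCriticalPoint {X : Type*} [NormedAddCommGroup X] [NormedSpace ℝ X] (I : X → ℝ) (u : X) :
    Prop :=
  HasFDerivAt I (0 : X →L[ℝ] ℝ) u

/-- Weak convergence of a sequence in a normed space. -/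
def WeaklyConverges {X : Type*} [NormedAddCommGroup X] [NormedSpace ℝ X] (u : ℕ → X) (v : X) :
    Prop :=
  Tendsto (fun j => toWeakSpace ℝ X (u j)) atTop (𝓝 (toWeakSpace ℝ X v))

end CriticalPQ

end

/-! Write `P`, `Q`, `R` for the integrals of |∇u|^p, |∇u|^q, |u|^{p*}. In E(u) - (1/p)⟨E'(u),u⟩ the
term `P` cancels, the q-term has a favourable sign because q < p, and `R` appears with the factor
1/p - 1/p* = 1/N. The subcritical terms are absorbed in `R`, so `R` and then `P` grow at most
linearly in ‖u‖. As p > 1, the sequence is bounded (`exists_norm_le_of_palaisSmale`).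

A subsequence converges weakly to some v (`exists_subseq_weakly_converges`). This rests on the
uniform convexity of the Dirichlet energy: minimising it minus a functional represents the dual by
L^{p'} fields, so the dual is separable, and decreasing closed convex hulls of tails have a common
point. By a Rellich argument the functions also converge a.e. (`exists_subseq_ae_tendsto_zero`).

The critical power is not compact, so strong convergence is out of reach. Convergence a.e. of the
gradients is enough to pass to the limit in E'(u_j)φ for fixed φ (`isCriticalPoint_of_tendsto`). To
get it, E'(u_j) is tested with arctan(u_j - v). These functions are uniformly bounded and tend to 0
a.e., so the whole reaction term disappears in the limit, and strict monotonicity of the p-Laplacian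
field forces ∇u_j → ∇v a.e. (`exists_subseq_grad_tendsto`).

If v were 0, the integrals of F(x,u_j) and f(x,u_j)u_j would tend to 0. Along a subsequence P → l,
νQ → m and R → l + m, with c = l/N + (1/q - 1/p*) m. Sobolev's inequality gives S (l+m)^{p/p*} ≤ l ≤
l + m, and l + m > 0 because c > 0. Hence l ≥ S^{N/p} and c ≥ c*, a contradiction
(`cStar_le_of_tendsto_zero`). The q-term only raises the level. -/

noncomputable section

namespace CriticalPQ

/-! ### Integral convergence and L^s tools -/

section MeasureTools

variable {α : Type*} [MeasurableSpace α] {μ : Measure α}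

/-- A Vitali-type criterion: dominated convergence up to a remainder with small integral. -/
theorem tendsto_integral_norm_zero {G : Type*} [NormedAddCommGroup G] {g : ℕ → α → G}
    (hg : ∀ j, AEStronglyMeasurable (g j) μ)
    (hlim : ∀ᵐ x ∂μ, Tendsto (fun j => g j x) atTop (𝓝 0))
    (hdom : ∀ ε : ℝ, 0 < ε → ∃ b : α → ℝ, ∃ k : ℕ → α → ℝ, Integrable b μ ∧
      (∀ j, Integrable (k j) μ) ∧ (∀ j, ∀ᵐ x ∂μ, 0 ≤ k j x) ∧ (∀ᶠ j in atTop, ∫ x, k j x ∂μ ≤ ε) ∧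
      ∀ j, ∀ᵐ x ∂μ, ‖g j x‖ ≤ b x + k j x) :
    Tendsto (fun j => ∫ x, ‖g j x‖ ∂μ) atTop (𝓝 0) := by
  rw [Metric.tendsto_atTop']
  suffices H : ∀ ε : ℝ, 0 < ε → ∀ᶠ j in atTop, ∫ x, ‖g j x‖ ∂μ < ε by
    intro ε hε
    obtain ⟨n, hn⟩ := eventually_atTop.1 (H ε hε)
    refine ⟨n, fun j hj => ?_⟩
    rw [Real.dist_0_eq_abs, abs_of_nonneg (by positivity)]
    exact hn j hj.le
  intro ε hε
  obtain ⟨b, k, hb, hk, hk0, hkε, hle⟩ := hdom (ε / 2) (by positivity)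
  have hgi : ∀ j, Integrable (g j) μ := fun j =>
    (hb.add (hk j)).mono' (hg j) (hle j)
  -- The part of ‖g j‖ above `k j` is dominated by |b| and tends to 0; what lies below `k j` has
  -- small integral.
  have hm : Tendsto (fun j => ∫ x, max (‖g j x‖ - k j x) 0 ∂μ) atTop (𝓝 (∫ _, (0 : ℝ) ∂μ)) := by
    refine tendsto_integral_of_dominated_convergence (fun x => |b x|) ?_ hb.abs ?_ ?_
    · intro j
      exact (((hgi j).norm.sub (hk j)).sup (integrable_zero _ _ _)).aestronglyMeasurable
    · intro j
      filter_upwards [hle j] with x hx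
      rw [Real.norm_eq_abs, abs_of_nonneg (le_max_right _ _)]
      refine max_le ?_ (abs_nonneg _)
      linarith [le_abs_self (b x)]
    · filter_upwards [hlim, ae_all_iff.2 hk0] with x hx hx0
      have h1 : Tendsto (fun j => ‖g j x‖) atTop (𝓝 0) := by simpa using hx.norm
      refine squeeze_zero (fun j => le_max_right _ _) (fun j => ?_) h1
      exact max_le (by linarith [hx0 j]) (norm_nonneg _)
  rw [integral_zero] at hm
  filter_upwards [hkε, (tendsto_order.1 hm).2 (ε / 2) (by positivity)] with j h1 h2
  have h3 : ∫ x, ‖g j x‖ ∂μ ≤ ∫ x, (max (‖g j x‖ - k j x) 0 + k j x) ∂μ := by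
    refine integral_mono_ae (hgi j).norm
      ((((hgi j).norm.sub (hk j)).sup (integrable_zero _ _ _)).add (hk j)) ?_
    refine Eventually.of_forall fun x => ?_
    have := le_max_left (‖g j x‖ - k j x) 0
    simp only
    linarith
  have h4 : ∫ x, (max (‖g j x‖ - k j x) 0 + k j x) ∂μ
      = ∫ x, max (‖g j x‖ - k j x) 0 ∂μ + ∫ x, k j x ∂μ :=
    integral_add (((hgi j).norm.sub (hk j)).sup (integrable_zero _ _ _)) (hk j)
  linarith

theorem tendsto_integral_zero_of_norm {G : Type*} [NormedAddCommGroup G] [NormedSpace ℝ G]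
    {g : ℕ → α → G}
    (h : Tendsto (fun j => ∫ x, ‖g j x‖ ∂μ) atTop (𝓝 0)) :
    Tendsto (fun j => ∫ x, g j x ∂μ) atTop (𝓝 0) :=
  squeeze_zero_norm (fun _ => norm_integral_le_integral_norm _) h

theorem add_rpow_le_two_rpow {a b s : ℝ} (ha : 0 ≤ a) (hb : 0 ≤ b) (hs : 0 ≤ s) :
    (a + b) ^ s ≤ 2 ^ s * (a ^ s + b ^ s) := by
  have h1 : (a + b) ^ s ≤ (2 * max a b) ^ s :=
    Real.rpow_le_rpow (by positivity) (by linarith [le_max_left a b, le_max_right a b]) hs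
  have h2 : (max a b) ^ s ≤ a ^ s + b ^ s := by
    rcases max_cases a b with h | h <;> rw [h.1]
    · linarith [Real.rpow_nonneg hb s]
    · linarith [Real.rpow_nonneg ha s]
  rw [Real.mul_rpow (by norm_num) (le_max_of_le_left ha)] at h1
  exact h1.trans (by gcongr)

/-- The identity (s-1)s' = s turns growth of order s-1 into integrability in L^{s'} for arguments in
L^s. -/
theorem growth_rpow_le {C t s s' : ℝ} (hC : 0 ≤ C) (ht : 0 ≤ t) (hss : s.HolderConjugate s') :
    (C * (1 + t ^ (s - 1))) ^ s' ≤ (2 * C) ^ s' * (1 + t ^ s) := by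
  have hs' : 0 ≤ s' := hss.symm.nonneg
  have h1 : 1 + t ^ (s - 1) ≥ 0 := by positivity
  rw [Real.mul_rpow hC h1, Real.mul_rpow (by norm_num) hC]
  have h2 := add_rpow_le_two_rpow (a := 1) (b := t ^ (s - 1)) zero_le_one (by positivity) hs'
  rw [Real.one_rpow, ← Real.rpow_mul ht, hss.sub_one_mul_conj] at h2
  have : 0 ≤ C ^ s' := by positivity
  nlinarith

theorem one_le_ofReal {s : ℝ} (hs : 1 ≤ s) : 1 ≤ ENNReal.ofReal s := by
  simpa using ENNReal.ofReal_le_ofReal hs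

variable {V : Type*} [NormedAddCommGroup V]

theorem integral_norm_rpow_eq {s : ℝ} (hs : 0 < s) (w : Lp V (ENNReal.ofReal s) μ) :
    ∫ x, ‖w x‖ ^ s ∂μ = ‖w‖ ^ s := by
  have h := (Lp.memLp w).eLpNorm_eq_integral_rpow_norm (by simpa using hs) ENNReal.ofReal_ne_top
  rw [Lp.norm_def, h, ENNReal.toReal_ofReal hs.le, ENNReal.toReal_ofReal (by positivity),
    ← Real.rpow_mul (by positivity), inv_mul_cancel₀ hs.ne', Real.rpow_one]

theorem integrable_norm_rpow_ofReal {s : ℝ} (hs : 0 < s) {w : α → V}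
    (hw : MemLp w (ENNReal.ofReal s) μ) : Integrable (fun x => ‖w x‖ ^ s) μ := by
  have := hw.integrable_norm_rpow (by simpa using hs) ENNReal.ofReal_ne_top
  rwa [ENNReal.toReal_ofReal hs.le] at this

theorem memLp_ofReal_of_integrable {s : ℝ} (hs : 0 < s) {w : α → V}
    (hm : AEStronglyMeasurable w μ) (hw : Integrable (fun x => ‖w x‖ ^ s) μ) :
    MemLp w (ENNReal.ofReal s) μ := by
  rw [← integrable_norm_rpow_iff hm (by simpa using hs) ENNReal.ofReal_ne_top,
    ENNReal.toReal_ofReal hs.le]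
  exact hw

theorem memLp_growth [IsFiniteMeasure μ] {U : Type*} [NormedAddCommGroup U] {C s s' : ℝ}
    (hC : 0 ≤ C) (hss : s.HolderConjugate s')
    {w : α → V} {g : α → U} (hg : AEStronglyMeasurable g μ) (hw : MemLp w (ENNReal.ofReal s) μ)
    (hb : ∀ᵐ x ∂μ, ‖g x‖ ≤ C * (1 + ‖w x‖ ^ (s - 1))) : MemLp g (ENNReal.ofReal s') μ := by
  refine memLp_ofReal_of_integrable hss.symm.pos hg ?_
  refine (((integrable_const (1 : ℝ)).add (integrable_norm_rpow_ofReal hss.pos hw)).const_mul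
    ((2 * C) ^ s')).mono' (hg.norm.aemeasurable.pow_const s').aestronglyMeasurable ?_
  filter_upwards [hb] with x hx
  rw [Real.norm_eq_abs, abs_of_nonneg (by positivity)]
  exact (Real.rpow_le_rpow (norm_nonneg _) hx hss.symm.nonneg).trans
    (growth_rpow_le hC (norm_nonneg _) hss)

end MeasureTools

/-! ### Differentiability of integral functionals on L^s -/

section Nemytskii

variable {α : Type*} [MeasurableSpace α] {μ : Measure α}
variable {V : Type*} [NormedAddCommGroup V] [InnerProductSpace ℝ V]

/-- The data of a potential `H(x, v)` with gradient `h(x, v)` of growth `|v|^{s-1}`. -/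
structure IsPotential (μ : Measure α) (s : ℝ) (H : α → V → ℝ) (h : α → V → V) : Prop where
  bound : ∃ C : ℝ, 0 ≤ C ∧ ∀ᵐ x ∂μ, ∀ v, ‖h x v‖ ≤ C * (1 + ‖v‖ ^ (s - 1))
  grad : ∀ᵐ x ∂μ, ∀ v, HasFDerivAt (H x) (innerSL ℝ (h x v)) v
  zero : ∀ᵐ x ∂μ, H x 0 = 0
  meas : ∀ w : α → V, AEStronglyMeasurable w μ → AEStronglyMeasurable (fun x => H x (w x)) μ
  meas_grad : ∀ w : α → V, AEStronglyMeasurable w μ →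
    AEStronglyMeasurable (fun x => h x (w x)) μ

/-- Mean value inequality on the segment from v to w for H minus its linear part at v; every point
of the segment has norm at most ‖v‖ + ‖w - v‖. -/
theorem norm_sub_sub_le_of_growth {H : V → ℝ} {h : V → V} {C s : ℝ} (hC : 0 ≤ C) (hs : 1 ≤ s)
    (hb : ∀ v, ‖h v‖ ≤ C * (1 + ‖v‖ ^ (s - 1)))
    (hd : ∀ v, HasFDerivAt H (innerSL ℝ (h v)) v) (v w : V) :
    |H w - H v - inner ℝ (h v) (w - v)| ≤
      (2 * C * (1 + (‖v‖ + ‖w - v‖) ^ (s - 1))) * ‖w - v‖ := by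
  have key := (convex_segment v w).norm_image_sub_le_of_norm_hasFDerivWithin_le
    (f := fun z => H z - innerSL ℝ (h v) z) (f' := fun z => innerSL ℝ (h z) - innerSL ℝ (h v))
    (C := 2 * C * (1 + (‖v‖ + ‖w - v‖) ^ (s - 1)))
    (fun z _ => ((hd z).sub (innerSL ℝ (h v)).hasFDerivAt).hasFDerivWithinAt) ?_
    (left_mem_segment ℝ v w) (right_mem_segment ℝ v w)
  · rw [Real.norm_eq_abs] at key
    convert key using 2
    simp only [innerSL_apply_apply, inner_sub_right]
    ring
  · intro z hz
    have hz' : ‖z‖ ≤ ‖v‖ + ‖w - v‖ := by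
      have h1 : ‖z - v‖ ≤ ‖w - v‖ := by
        obtain ⟨t, ht, rfl⟩ := segment_eq_image' ℝ v w ▸ hz
        rw [add_sub_cancel_left, norm_smul, Real.norm_eq_abs, abs_of_nonneg ht.1]
        exact mul_le_of_le_one_left (norm_nonneg _) ht.2
      calc ‖z‖ = ‖v + (z - v)‖ := by congr 1; abel
        _ ≤ _ := (norm_add_le _ _).trans (by gcongr)
    have hv' : ‖v‖ ≤ ‖v‖ + ‖w - v‖ := by linarith [norm_nonneg (w - v)]
    have e1 : ‖z‖ ^ (s - 1) ≤ (‖v‖ + ‖w - v‖) ^ (s - 1) :=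
      Real.rpow_le_rpow (norm_nonneg _) hz' (by linarith)
    have e2 : ‖v‖ ^ (s - 1) ≤ (‖v‖ + ‖w - v‖) ^ (s - 1) :=
      Real.rpow_le_rpow (norm_nonneg _) hv' (by linarith)
    calc ‖innerSL ℝ (h z) - innerSL ℝ (h v)‖ ≤ ‖innerSL ℝ (h z)‖ + ‖innerSL ℝ (h v)‖ :=
          norm_sub_le _ _
      _ = ‖h z‖ + ‖h v‖ := by simp
      _ ≤ C * (1 + (‖v‖ + ‖w - v‖) ^ (s - 1)) + C * (1 + (‖v‖ + ‖w - v‖) ^ (s - 1)) := by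
          refine add_le_add ((hb z).trans ?_) ((hb v).trans ?_) <;> gcongr
      _ = _ := by ring

theorem abs_le_of_growth {H : V → ℝ} {h : V → V} {C s : ℝ} (hC : 0 ≤ C) (hs : 1 ≤ s)
    (hb : ∀ v, ‖h v‖ ≤ C * (1 + ‖v‖ ^ (s - 1)))
    (hd : ∀ v, HasFDerivAt H (innerSL ℝ (h v)) v) (h0 : H 0 = 0) (w : V) :
    |H w| ≤ 4 * C * (1 + ‖w‖ ^ (s - 1)) * ‖w‖ := by
  have := norm_sub_sub_le_of_growth hC hs hb hd 0 w
  simp only [h0, sub_zero, norm_zero, zero_add] at this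
  have h1 : |inner ℝ (h 0) w| ≤ C * (1 + ‖w‖ ^ (s - 1)) * ‖w‖ * 2 := by
    refine (abs_real_inner_le_norm _ _).trans ?_
    have h2 := hb 0
    have h3 : ‖(0 : V)‖ ^ (s - 1) ≤ 1 := by
      rw [norm_zero]; exact Real.zero_rpow_le_one _
    have : ‖h 0‖ ≤ C * (1 + ‖w‖ ^ (s - 1)) * 2 := by
      have : 0 ≤ ‖w‖ ^ (s - 1) := by positivity
      nlinarith
    nlinarith [norm_nonneg w]
  have h2 : |H w| ≤ |H w - inner ℝ (h 0) w| + |inner ℝ (h 0) w| := by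
    have := abs_add_le (H w - inner ℝ (h 0) w) (inner ℝ (h 0) w)
    simpa using this
  linarith

variable {s s' : ℝ} {H : α → V → ℝ} {h : α → V → V}

theorem IsPotential.memLp_grad [IsFiniteMeasure μ] (hH : IsPotential μ s H h)
    (hss : s.HolderConjugate s') {w : α → V} (hw : MemLp w (ENNReal.ofReal s) μ) :
    MemLp (fun x => h x (w x)) (ENNReal.ofReal s') μ := by
  obtain ⟨C, hC, hb⟩ := hH.bound
  exact memLp_growth hC hss (hH.meas_grad w hw.1) hw (hb.mono fun x hx => hx _)

theorem growth_mul_le {s t : ℝ} (hs : 1 ≤ s) (ht : 0 ≤ t) :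
    (1 + t ^ (s - 1)) * t ≤ 1 + 2 * t ^ s := by
  have e : t ^ (s - 1) * t = t ^ s := by
    rcases ht.eq_or_lt with rfl | ht
    · rw [mul_zero, Real.zero_rpow (by linarith)]
    · rw [Real.rpow_sub_one ht.ne']; field_simp
  have : t ≤ 1 + t ^ s := by
    rcases le_total t 1 with h | h
    · linarith [Real.rpow_nonneg ht s]
    · have := Real.rpow_le_rpow_of_exponent_le h hs
      rw [Real.rpow_one] at this; linarith
  nlinarith

theorem IsPotential.integrable [IsFiniteMeasure μ] (hH : IsPotential μ s H h) (hs : 1 < s)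
    {w : α → V} (hw : MemLp w (ENNReal.ofReal s) μ) : Integrable (fun x => H x (w x)) μ := by
  obtain ⟨C, hC, hb⟩ := hH.bound
  refine (((integrable_const (1 : ℝ)).add ((integrable_norm_rpow_ofReal (by linarith) hw).const_mul
    2)).const_mul (4 * C)).mono' (hH.meas w hw.1) ?_
  filter_upwards [hb, hH.grad, hH.zero] with x h1 h2 h3
  refine (abs_le_of_growth hC hs.le h1 h2 h3 (w x)).trans ?_
  rw [mul_assoc]
  exact mul_le_mul_of_nonneg_left (growth_mul_le hs.le (norm_nonneg _)) (by positivity)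

theorem integrable_inner_holder (hss : s.HolderConjugate s') {f g : α → V}
    (hf : MemLp f (ENNReal.ofReal s') μ) (hg : MemLp g (ENNReal.ofReal s) μ) :
    Integrable (fun x => inner ℝ (f x) (g x)) μ := by
  have := hss.ennrealOfReal.symm
  refine (hf.norm.integrable_mul hg.norm).mono (hf.1.inner hg.1) ?_
  refine Eventually.of_forall fun x => ?_
  simpa using abs_real_inner_le_norm (f x) (g x)

theorem integral_norm_mul_norm_le (hss : s.HolderConjugate s') {U W : Type*}
    [NormedAddCommGroup U] [NormedAddCommGroup W] {f : α → U} {g : α → W}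
    (hf : MemLp f (ENNReal.ofReal s) μ) (hg : MemLp g (ENNReal.ofReal s') μ) :
    ∫ x, ‖f x‖ * ‖g x‖ ∂μ ≤
      (∫ x, ‖f x‖ ^ s ∂μ) ^ (1 / s) * (∫ x, ‖g x‖ ^ s' ∂μ) ^ (1 / s') :=
  integral_mul_le_Lp_mul_Lq_of_nonneg hss (Eventually.of_forall fun _ => norm_nonneg _)
    (Eventually.of_forall fun _ => norm_nonneg _) hf.norm hg.norm

/-- The functional `φ ↦ ∫ ⟨g, φ⟩` on `L^s`, for `g ∈ L^{s'}`. -/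
def pairing (hss : s.HolderConjugate s') [Fact (1 ≤ ENNReal.ofReal s)] :
    haveI : Fact (1 ≤ ENNReal.ofReal s') := ⟨one_le_ofReal hss.symm.lt.le⟩
    Lp V (ENNReal.ofReal s') μ →L[ℝ] Lp V (ENNReal.ofReal s) μ →L[ℝ] ℝ :=
  haveI : Fact (1 ≤ ENNReal.ofReal s') := ⟨one_le_ofReal hss.symm.lt.le⟩
  haveI := hss.ennrealOfReal.symm
  (innerSL ℝ).lpPairing μ (ENNReal.ofReal s') (ENNReal.ofReal s)

theorem pairing_apply (hss : s.HolderConjugate s') [Fact (1 ≤ ENNReal.ofReal s)]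
    (g : Lp V (ENNReal.ofReal s') μ) (φ : Lp V (ENNReal.ofReal s) μ) :
    pairing hss g φ = ∫ x, inner ℝ (g x) (φ x) ∂μ := by
  have : Fact (1 ≤ ENNReal.ofReal s') := ⟨one_le_ofReal hss.symm.lt.le⟩
  have := hss.ennrealOfReal.symm
  exact (innerSL ℝ).lpPairing_eq_integral g φ

/-- The integral functional of a potential is Fréchet differentiable on `L^s`. -/
theorem IsPotential.hasFDerivAt [IsFiniteMeasure μ] (hH : IsPotential μ s H h) (hs : 1 < s)
    [Fact (1 ≤ ENNReal.ofReal s)] (w : Lp V (ENNReal.ofReal s) μ) :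
    ∃ L : Lp V (ENNReal.ofReal s) μ →L[ℝ] ℝ,
      HasFDerivAt (fun w : Lp V (ENNReal.ofReal s) μ => ∫ x, H x (w x) ∂μ) L w ∧
      ∀ φ : Lp V (ENNReal.ofReal s) μ, L φ = ∫ x, inner ℝ (h x (w x)) (φ x) ∂μ := by
  obtain ⟨s', hss⟩ : ∃ s', s.HolderConjugate s' := ⟨_, Real.HolderConjugate.conjExponent hs⟩
  have hs0 : 0 < s := hss.pos
  have hs'0 : 0 < s' := hss.symm.pos
  have hhw := hH.memLp_grad hss (Lp.memLp w)
  refine ⟨pairing hss (hhw.toLp _), ?_, ?_⟩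
  swap
  · intro φ
    rw [pairing_apply]
    refine integral_congr_ae ?_
    filter_upwards [hhw.coeFn_toLp] with x hx
    rw [hx]
  rw [hasFDerivAt_iff_tendsto]
  -- It suffices that every sequence tending to w has a subsequence along which the quotient tends
  -- to 0, so a.e. convergence may be assumed.
  refine tendsto_of_seq_tendsto fun w' hw' => ?_
  refine tendsto_of_subseq_tendsto fun ns hns => ?_
  have hw'' := hw'.comp hns
  obtain ⟨ms, hmono, hae⟩ := (tendstoInMeasure_of_tendsto_Lp hw'').exists_seq_tendsto_ae
  refine ⟨ms, ?_⟩
  have hms := hmono.tendsto_atTop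
  set z : ℕ → Lp V (ENNReal.ofReal s) μ := fun n => w' (ns (ms n)) with hz
  have hzw : Tendsto z atTop (𝓝 w) := hw''.comp hms
  have hzn : Tendsto (fun n => ‖z n - w‖) atTop (𝓝 0) := by
    rw [tendsto_iff_norm_sub_tendsto_zero] at hzw
    exact hzw
  obtain ⟨C, hC, hb⟩ := hH.bound
  set R : ℕ → α → ℝ := fun n x => H x (z n x) - H x (w x) - inner ℝ (h x (w x)) ((z n - w) x) with hR
  -- `D` is the pointwise remainder per unit of increment (0 where the increment vanishes). By
  -- Hölder, ∫|R| ≤ ‖z - w‖ ‖D‖_{s'}, so the goal becomes D → 0 in L^{s'}.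
  set D : ℕ → α → ℝ := fun n x => |R n x| / ‖(z n - w) x‖ with hD
  have hRm : ∀ n, AEStronglyMeasurable (R n) μ := fun n =>
    ((hH.meas _ (Lp.aestronglyMeasurable _)).sub (hH.meas _ (Lp.aestronglyMeasurable _))).sub
      ((hH.meas_grad _ (Lp.aestronglyMeasurable _)).inner (Lp.aestronglyMeasurable _))
  have hDm : ∀ n, AEStronglyMeasurable (D n) μ := fun n =>
    ((hRm n).norm.aemeasurable.div (Lp.aestronglyMeasurable _).norm.aemeasurable).aestronglyMeasurable
  have hsub : ∀ n, ∀ᵐ x ∂μ, (z n - w) x = z n x - w x := fun n => by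
    filter_upwards [Lp.coeFn_sub (z n) w] with x hx using hx
  have hRb : ∀ n, ∀ᵐ x ∂μ, |R n x| ≤
      (2 * C * (1 + (‖w x‖ + ‖(z n - w) x‖) ^ (s - 1))) * ‖(z n - w) x‖ := fun n => by
    filter_upwards [hb, hH.grad, hsub n] with x h1 h2 h3
    simp only [hR, h3]
    exact norm_sub_sub_le_of_growth hC hs.le h1 h2 _ _
  have hRD : ∀ n, ∀ᵐ x ∂μ, |R n x| = ‖(z n - w) x‖ * ‖D n x‖ := fun n => by
    filter_upwards [hRb n] with x hx
    by_cases h0 : ‖(z n - w) x‖ = 0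
    · rw [h0, mul_zero] at hx
      rw [h0, zero_mul]
      exact le_antisymm hx (abs_nonneg _)
    · have : |D n x| = D n x := abs_of_nonneg (by simp only [hD]; positivity)
      rw [Real.norm_eq_abs (D n x), this]
      simp only [hD]
      field_simp
  -- The constant of `growth_rpow_le` with `2 * C` in place of `C`.
  set K : ℝ := (2 * (2 * C)) ^ s' with hK
  have hDb : ∀ n, ∀ᵐ x ∂μ, ‖D n x‖ ^ s' ≤
      K * (1 + 2 ^ s * ‖w x‖ ^ s) + K * 2 ^ s * ‖(z n - w) x‖ ^ s := fun n => by
    filter_upwards [hRb n] with x hx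
    have hn : ‖D n x‖ ≤ 2 * C * (1 + (‖w x‖ + ‖(z n - w) x‖) ^ (s - 1)) := by
      rw [hD, Real.norm_eq_abs, abs_of_nonneg (by positivity)]
      exact div_le_of_le_mul₀ (norm_nonneg _) (by positivity) hx
    have h1 := (Real.rpow_le_rpow (norm_nonneg _) hn hs'0.le).trans
      (growth_rpow_le (by positivity) (by positivity) hss)
    have h2 := add_rpow_le_two_rpow (norm_nonneg (w x)) (norm_nonneg ((z n - w) x)) hs0.le
    have hK0 : 0 ≤ K := by positivity
    calc _ ≤ K * (1 + (‖w x‖ + ‖(z n - w) x‖) ^ s) := h1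
      _ ≤ K * (1 + 2 ^ s * (‖w x‖ ^ s + ‖(z n - w) x‖ ^ s)) := by gcongr
      _ = _ := by ring
  have hiw := integrable_norm_rpow_ofReal hs0 (Lp.memLp w)
  have hizw := fun n => integrable_norm_rpow_ofReal hs0 (Lp.memLp (z n - w))
  have hb1 : Integrable (fun x => K * (1 + 2 ^ s * ‖w x‖ ^ s)) μ :=
    ((integrable_const 1).add (hiw.const_mul _)).const_mul K
  have hDi : ∀ n, Integrable (fun x => ‖D n x‖ ^ s') μ := fun n => by
    refine (hb1.add ((hizw n).const_mul (K * 2 ^ s))).mono'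
      ((hDm n).norm.aemeasurable.pow_const s').aestronglyMeasurable ?_
    filter_upwards [hDb n] with x hx
    rwa [Real.norm_eq_abs, abs_of_nonneg (by positivity)]
  have hDlim : Tendsto (fun n => ∫ x, ‖(‖D n x‖ ^ s')‖ ∂μ) atTop (𝓝 0) := by
    refine tendsto_integral_norm_zero (fun n => (hDi n).1) ?_ ?_
    · filter_upwards [hae, hH.grad, ae_all_iff.2 hsub] with x h1 h2 h3
      -- Differentiability of `H x` at the single point `w x` is exactly D → 0 at x.
      have h4 := (hasFDerivAt_iff_tendsto.1 (h2 (w x))).comp h1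
      have h5 : Tendsto (fun n => ‖D n x‖) atTop (𝓝 0) := by
        refine h4.congr fun n => ?_
        simp only [hD, hR, Function.comp_apply, innerSL_apply_apply, Real.norm_eq_abs, hz,
          abs_div, abs_abs, abs_norm]
        rw [div_eq_inv_mul, ← h3]
      have := h5.rpow_const (p := s') (Or.inr hs'0.le)
      rwa [Real.zero_rpow hs'0.ne'] at this
    · intro ε hε
      refine ⟨_, fun n x => K * 2 ^ s * ‖(z n - w) x‖ ^ s, hb1, fun n => (hizw n).const_mul _,
        fun n => Eventually.of_forall fun x => by positivity, ?_, ?_⟩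
      · have : Tendsto (fun n => ∫ x, K * 2 ^ s * ‖(z n - w) x‖ ^ s ∂μ) atTop (𝓝 0) := by
          simp_rw [integral_const_mul, integral_norm_rpow_eq hs0]
          have := (hzn.rpow_const (p := s) (Or.inr hs0.le)).const_mul (K * 2 ^ s)
          simpa [Real.zero_rpow hs0.ne'] using this
        exact ((tendsto_order.1 this).2 ε hε).mono fun _ => le_of_lt
      · intro n
        filter_upwards [hDb n] with x hx
        rwa [Real.norm_eq_abs, abs_of_nonneg (by positivity)]
  have hDlim' : Tendsto (fun n => (∫ x, ‖D n x‖ ^ s' ∂μ) ^ (1 / s')) atTop (𝓝 0) := by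
    have h1 : Tendsto (fun n => ∫ x, ‖D n x‖ ^ s' ∂μ) atTop (𝓝 0) := by
      refine hDlim.congr fun n => integral_congr_ae (Eventually.of_forall fun x => ?_)
      simp only [Real.norm_eq_abs]
      exact abs_of_nonneg (Real.rpow_nonneg (abs_nonneg _) _)
    have := h1.rpow_const (p := 1 / s') (Or.inr (by positivity))
    rwa [Real.zero_rpow (by positivity)] at this
  refine squeeze_zero (fun n => mul_nonneg (inv_nonneg.2 (norm_nonneg _)) (norm_nonneg _))
    (fun n => ?_) hDlim'
  have hint : (∫ x, H x (z n x) ∂μ) - (∫ x, H x (w x) ∂μ) - pairing hss (hhw.toLp _) (z n - w) =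
      ∫ x, R n x ∂μ := by
    have i1 := hH.integrable hs (Lp.memLp (z n))
    have i2 := hH.integrable hs (Lp.memLp w)
    have i3 := integrable_inner_holder hss hhw (Lp.memLp (z n - w))
    have e1 : pairing hss (hhw.toLp _) (z n - w)
        = ∫ x, inner ℝ (h x (w x)) ((z n - w) x) ∂μ := by
      rw [pairing_apply]
      refine integral_congr_ae ?_
      filter_upwards [hhw.coeFn_toLp] with x hx
      rw [hx]
    rw [e1, ← integral_sub i1 i2]
    exact (integral_sub (i1.sub i2) i3).symm
  have hle : ‖∫ x, R n x ∂μ‖ ≤ ‖z n - w‖ * (∫ x, ‖D n x‖ ^ s' ∂μ) ^ (1 / s') := by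
    calc ‖∫ x, R n x ∂μ‖ ≤ ∫ x, ‖R n x‖ ∂μ := norm_integral_le_integral_norm _
      _ = ∫ x, ‖(z n - w) x‖ * ‖D n x‖ ∂μ := integral_congr_ae (hRD n)
      _ ≤ _ := integral_norm_mul_norm_le hss (Lp.memLp _)
          (memLp_ofReal_of_integrable hs'0 (hDm n) (hDi n))
      _ = _ := by
        rw [integral_norm_rpow_eq hs0, ← Real.rpow_mul (norm_nonneg _), mul_one_div_cancel hs0.ne',
          Real.rpow_one]
  change ‖z n - w‖⁻¹ * ‖_ - _ - pairing hss (hhw.toLp _) (z n - w)‖ ≤ _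
  rw [hint]
  by_cases h0 : ‖z n - w‖ = 0
  · rw [h0, inv_zero, zero_mul]; positivity
  · rw [inv_mul_le_iff₀ (lt_of_le_of_ne (norm_nonneg _) (Ne.symm h0))]
    exact hle

end Nemytskii

/-! ### Convexity of |·|^p and monotonicity of its gradient -/

section Pointwise

variable {V : Type*} [NormedAddCommGroup V] [InnerProductSpace ℝ V]

/-- The vector field `ξ ↦ |ξ|^{p-2} ξ` of the `p`-Laplacian. -/
def plap (p : ℝ) (ξ : V) : V := ‖ξ‖ ^ (p - 2) • ξ

/-- The convexity defect of `|·|^p` at the midpoint. -/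
def convexDefect (p : ℝ) (a b : V) : ℝ :=
  (‖a‖ ^ p + ‖b‖ ^ p) / 2 - ‖(2 : ℝ)⁻¹ • (a + b)‖ ^ p

theorem norm_half_add_le (a b : V) : ‖(2 : ℝ)⁻¹ • (a + b)‖ ≤ (‖a‖ + ‖b‖) / 2 := by
  rw [norm_smul, Real.norm_eq_abs, abs_of_nonneg (by norm_num)]
  linarith [norm_add_le a b]

theorem half_add_rpow_le {p : ℝ} (hp : 1 ≤ p) {r t : ℝ} (hr : 0 ≤ r) (ht : 0 ≤ t) :
    ((r + t) / 2) ^ p ≤ (r ^ p + t ^ p) / 2 := by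
  have h := (convexOn_rpow hp).2
  have := h (mem_Ici.2 hr) (mem_Ici.2 ht) (a := 1 / 2) (b := 1 / 2) (by norm_num)
    (by norm_num) (by norm_num)
  simp only [smul_eq_mul] at this
  rw [show (r + t) / 2 = 1 / 2 * r + 1 / 2 * t by ring]
  linarith

theorem half_add_rpow_lt {p : ℝ} (hp : 1 < p) {r t : ℝ} (hr : 0 ≤ r) (ht : 0 ≤ t) (hrt : r ≠ t) :
    ((r + t) / 2) ^ p < (r ^ p + t ^ p) / 2 := by
  have h := (strictConvexOn_rpow hp).2
  have := h (mem_Ici.2 hr) (mem_Ici.2 ht) hrt (a := 1 / 2) (b := 1 / 2)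
    (by norm_num) (by norm_num) (by norm_num)
  simp only [smul_eq_mul] at this
  rw [show (r + t) / 2 = 1 / 2 * r + 1 / 2 * t by ring]
  linarith

theorem convexDefect_nonneg {p : ℝ} (hp : 1 ≤ p) (a b : V) : 0 ≤ convexDefect p a b := by
  have h1 := Real.rpow_le_rpow (norm_nonneg _) (norm_half_add_le a b) (by linarith : 0 ≤ p)
  have h2 := half_add_rpow_le hp (norm_nonneg a) (norm_nonneg b)
  unfold convexDefect
  linarith

/-- Different norms: strict convexity of t ↦ t^p. Equal norms: strict convexity of the inner product
norm. -/
theorem convexDefect_pos {p : ℝ} (hp : 1 < p) {a b : V} (hab : a ≠ b) :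
    0 < convexDefect p a b := by
  have h1 := Real.rpow_le_rpow (norm_nonneg _) (norm_half_add_le a b) (by linarith : 0 ≤ p)
  have h2 := half_add_rpow_le hp.le (norm_nonneg a) (norm_nonneg b)
  unfold convexDefect
  by_cases hn : ‖a‖ = ‖b‖
  · have h3 : ‖a + b‖ < ‖a‖ + ‖b‖ :=
      lt_of_le_of_ne (norm_add_le a b) fun h => hab (eq_of_norm_eq_of_norm_add_eq hn h)
    have h4 : ‖(2 : ℝ)⁻¹ • (a + b)‖ < (‖a‖ + ‖b‖) / 2 := by
      rw [norm_smul, Real.norm_eq_abs, abs_of_nonneg (by norm_num)]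
      linarith
    have := Real.rpow_lt_rpow (norm_nonneg _) h4 (by linarith : 0 < p)
    linarith
  · have := half_add_rpow_lt hp (norm_nonneg a) (norm_nonneg b) hn
    linarith

theorem continuous_convexDefect {p : ℝ} (hp : 0 ≤ p) :
    Continuous fun z : V × V => convexDefect p z.1 z.2 := by
  unfold convexDefect
  have h : ∀ f : V × V → V, Continuous f → Continuous fun z => ‖f z‖ ^ p := fun f hf =>
    hf.norm.rpow_const fun _ => Or.inr hp
  exact (((h _ continuous_fst).add (h _ continuous_snd)).div_const 2).sub
    (h _ ((continuous_fst.add continuous_snd).const_smul _))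

theorem norm_smul_rpow {p c : ℝ} (hc : 0 ≤ c) (v : V) : ‖c • v‖ ^ p = c ^ p * ‖v‖ ^ p := by
  rw [norm_smul, Real.norm_eq_abs, abs_of_nonneg hc, Real.mul_rpow hc (norm_nonneg _)]

theorem convexDefect_smul {p c : ℝ} (hc : 0 ≤ c) (a b : V) :
    convexDefect p (c • a) (c • b) = c ^ p * convexDefect p a b := by
  unfold convexDefect
  rw [← smul_add, smul_comm, norm_smul_rpow hc, norm_smul_rpow hc, norm_smul_rpow hc]
  ring

/-- A uniform convexity inequality for `|·|^p`, valid for all `p > 1`. -/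
theorem exists_norm_sub_rpow_le [FiniteDimensional ℝ V] {p ε : ℝ} (hp : 1 < p) (hε : 0 < ε) :
    ∃ C : ℝ, 0 ≤ C ∧ ∀ a b : V, ‖a - b‖ ^ p ≤
      ε * (‖a‖ ^ p + ‖b‖ ^ p) + C * convexDefect p a b := by
  have hp0 : 0 < p := by linarith
  have hc : ∀ f : V × V → V, Continuous f → Continuous fun z => ‖f z‖ ^ p := fun f hf =>
    hf.norm.rpow_const fun _ => Or.inr hp0.le
  -- Both sides are p-homogeneous, so pairs can be normalised. On this compact set a ≠ b, and the
  -- defect has a positive minimum.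
  set K : Set (V × V) := {z | ‖z.1‖ ^ p + ‖z.2‖ ^ p = 1 ∧ ε ≤ ‖z.1 - z.2‖ ^ p} with hK
  have hKc : IsCompact K := by
    refine (isCompact_closedBall (0 : V × V) 1).of_isClosed_subset ?_ ?_
    · exact (isClosed_eq ((hc _ continuous_fst).add (hc _ continuous_snd)) continuous_const).inter
        (isClosed_le continuous_const (hc _ (continuous_fst.sub continuous_snd)))
    · rintro ⟨a, b⟩ ⟨h1, -⟩
      have hle : ∀ t : ℝ, 0 ≤ t → t ^ p ≤ 1 → t ≤ 1 := fun t ht h => by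
        by_contra! hlt
        exact absurd h (not_le.2 (Real.one_lt_rpow hlt hp0))
      have ha : 0 ≤ ‖a‖ ^ p := by positivity
      have hb : 0 ≤ ‖b‖ ^ p := by positivity
      simp only at h1
      rw [mem_closedBall_zero_iff, Prod.norm_def, max_le_iff]
      exact ⟨hle _ (norm_nonneg _) (by linarith), hle _ (norm_nonneg _) (by linarith)⟩
  obtain ⟨δ, hδ, hδK⟩ : ∃ δ : ℝ, 0 < δ ∧ ∀ z ∈ K, δ ≤ convexDefect p z.1 z.2 := by
    rcases K.eq_empty_or_nonempty with h | h
    · exact ⟨1, one_pos, by simp [h]⟩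
    · obtain ⟨z, hz, hmin⟩ := hKc.exists_isMinOn h (continuous_convexDefect hp0.le).continuousOn
      refine ⟨_, convexDefect_pos hp (a := z.1) (b := z.2) ?_, fun w hw => hmin hw⟩
      intro h
      have := hz.2
      rw [h, sub_self, norm_zero, Real.zero_rpow hp0.ne'] at this
      linarith
  -- When |a - b|^p exceeds ε m it is still at most 2^p m, while the rescaled pair lies in `K` and
  -- gives defect at least δ m.
  refine ⟨2 ^ p / δ, by positivity, fun a b => ?_⟩
  set m : ℝ := ‖a‖ ^ p + ‖b‖ ^ p with hm
  have hD := convexDefect_nonneg hp.le a b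
  have hm0 : 0 ≤ m := by positivity
  by_cases hsmall : ‖a - b‖ ^ p ≤ ε * m
  · have : 0 ≤ 2 ^ p / δ * convexDefect p a b := by positivity
    linarith
  push Not at hsmall
  have hbig : ‖a - b‖ ^ p ≤ 2 ^ p * m :=
    (Real.rpow_le_rpow (norm_nonneg _) (norm_sub_le a b) hp0.le).trans
      (add_rpow_le_two_rpow (norm_nonneg _) (norm_nonneg _) hp0.le)
  have hmpos : 0 < m := by
    rcases hm0.eq_or_lt with h | h
    · rw [← h] at hsmall hbig; linarith
    · exact h
  set c : ℝ := (m⁻¹) ^ p⁻¹ with hcdef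
  have hc0 : 0 ≤ c := by positivity
  have hcp : c ^ p = m⁻¹ := by
    rw [hcdef, ← Real.rpow_mul (by positivity), inv_mul_cancel₀ hp0.ne', Real.rpow_one]
  have hmem : (c • a, c • b) ∈ K := by
    refine ⟨?_, ?_⟩
    · simp only [norm_smul_rpow hc0, hcp]
      rw [← mul_add, ← hm, inv_mul_cancel₀ hmpos.ne']
    · simp only [← smul_sub, norm_smul_rpow hc0, hcp]
      rw [inv_mul_eq_div, le_div_iff₀ hmpos]
      exact hsmall.le
  have := hδK _ hmem
  simp only [convexDefect_smul hc0, hcp] at this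
  rw [inv_mul_eq_div, le_div_iff₀ hmpos] at this
  have h1 : 2 ^ p * m ≤ 2 ^ p / δ * convexDefect p a b := by
    rw [div_mul_eq_mul_div, le_div_iff₀ hδ]
    have : 0 < (2 : ℝ) ^ p := by positivity
    nlinarith
  have : 0 ≤ ε * m := by positivity
  linarith

theorem norm_plap {p : ℝ} (hp : 1 < p) (ξ : V) : ‖plap p ξ‖ = ‖ξ‖ ^ (p - 1) := by
  unfold plap
  rw [norm_smul, Real.norm_eq_abs, abs_of_nonneg (by positivity)]
  by_cases h : ‖ξ‖ = 0
  · rw [h, mul_zero, Real.zero_rpow (by linarith)]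
  · have : p - 1 = (p - 2) + 1 := by ring
    rw [this, Real.rpow_add_one h]

theorem inner_plap_self {p : ℝ} (hp : 1 < p) (ξ : V) : inner ℝ (plap p ξ) ξ = ‖ξ‖ ^ p := by
  unfold plap
  rw [real_inner_smul_left, real_inner_self_eq_norm_sq]
  by_cases h : ‖ξ‖ = 0
  · rw [h, Real.zero_rpow (by linarith : p ≠ 0)]; simp
  · have : p = (p - 2) + 2 := by ring
    conv_rhs => rw [this, Real.rpow_add (lt_of_le_of_ne (norm_nonneg _) (Ne.symm h))]
    norm_num

theorem hasFDerivAt_norm_rpow_div {p : ℝ} (hp : 1 < p) (ξ : V) :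
    HasFDerivAt (fun x : V => 1 / p * ‖x‖ ^ p) (innerSL ℝ (plap p ξ)) ξ := by
  have h := (hasFDerivAt_norm_rpow ξ hp).const_mul (1 / p)
  have e : (1 / p) • (p * ‖ξ‖ ^ (p - 2)) • innerSL ℝ ξ = innerSL ℝ (plap p ξ) := by
    rw [plap, map_smul, smul_smul]
    congr 1
    field_simp
  rwa [e] at h

theorem continuous_plap {p : ℝ} (hp : 1 < p) : Continuous (plap p : V → V) := by
  rw [continuous_iff_continuousAt]
  intro ξ
  by_cases h : ξ = 0
  · subst h
    have h0 : plap p (0 : V) = 0 := by simp [plap]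
    rw [ContinuousAt, h0, tendsto_zero_iff_norm_tendsto_zero]
    simp_rw [norm_plap hp]
    have : Tendsto (fun x : V => ‖x‖ ^ (p - 1)) (𝓝 0) (𝓝 (‖(0 : V)‖ ^ (p - 1))) :=
      (continuous_norm.tendsto 0).rpow_const (Or.inr (by linarith))
    rwa [norm_zero, Real.zero_rpow (by linarith)] at this
  · exact (continuous_norm.continuousAt.rpow_const (Or.inl (by simpa using h))).smul
      continuousAt_id

/-- The first summand compares lengths, the second directions. Both are nonnegative, by monotonicity
of powers and Cauchy–Schwarz, so each can be used separately. -/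
theorem inner_plap_sub_eq {p : ℝ} (hp : 1 < p) (ξ η : V) :
    inner ℝ (plap p ξ - plap p η) (ξ - η) =
      (‖ξ‖ ^ (p - 1) - ‖η‖ ^ (p - 1)) * (‖ξ‖ - ‖η‖) +
        (‖ξ‖ ^ (p - 2) + ‖η‖ ^ (p - 2)) * (‖ξ‖ * ‖η‖ - inner ℝ ξ η) := by
  have e : ∀ ζ : V, ‖ζ‖ ^ (p - 1) = ‖ζ‖ ^ (p - 2) * ‖ζ‖ := fun ζ => by
    rw [← norm_plap hp, plap, norm_smul, Real.norm_eq_abs, abs_of_nonneg (by positivity)]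
  rw [e, e]
  simp only [plap, inner_sub_left, inner_sub_right, real_inner_smul_left,
    real_inner_self_eq_norm_sq, real_inner_comm ξ η]
  ring

theorem rpow_sub_mul_sub_nonneg {s a b : ℝ} (hs : 0 ≤ s) (ha : 0 ≤ a) (hb : 0 ≤ b) :
    0 ≤ (a ^ s - b ^ s) * (a - b) := by
  rcases le_total a b with h | h
  · exact mul_nonneg_of_nonpos_of_nonpos (by linarith [Real.rpow_le_rpow ha h hs]) (by linarith)
  · exact mul_nonneg (by linarith [Real.rpow_le_rpow hb h hs]) (by linarith)

theorem le_inner_plap_sub {p : ℝ} (hp : 1 < p) (ξ η : V) :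
    (‖ξ‖ ^ (p - 1) - ‖η‖ ^ (p - 1)) * (‖ξ‖ - ‖η‖) ≤ inner ℝ (plap p ξ - plap p η) (ξ - η) := by
  rw [inner_plap_sub_eq hp]
  have h1 : 0 ≤ ‖ξ‖ * ‖η‖ - inner ℝ ξ η := by linarith [real_inner_le_norm ξ η]
  have : 0 ≤ (‖ξ‖ ^ (p - 2) + ‖η‖ ^ (p - 2)) * (‖ξ‖ * ‖η‖ - inner ℝ ξ η) := by positivity
  linarith

theorem inner_plap_sub_nonneg {p : ℝ} (hp : 1 < p) (ξ η : V) :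
    0 ≤ inner ℝ (plap p ξ - plap p η) (ξ - η) :=
  (rpow_sub_mul_sub_nonneg (by linarith) (norm_nonneg _) (norm_nonneg _)).trans
    (le_inner_plap_sub hp ξ η)

/-- The length part forces equal norms; then the direction part is equality in Cauchy–Schwarz. -/
theorem eq_of_inner_plap_sub_eq_zero {p : ℝ} (hp : 1 < p) {ξ η : V}
    (h : inner ℝ (plap p ξ - plap p η) (ξ - η) = 0) : ξ = η := by
  have hnn := rpow_sub_mul_sub_nonneg (s := p - 1) (by linarith) (norm_nonneg ξ) (norm_nonneg η)
  have hle := le_inner_plap_sub hp ξ η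
  have h0 : (‖ξ‖ ^ (p - 1) - ‖η‖ ^ (p - 1)) * (‖ξ‖ - ‖η‖) = 0 := by linarith
  have hn : ‖ξ‖ = ‖η‖ := by
    rcases mul_eq_zero.1 h0 with h1 | h1
    · exact (Real.rpow_left_inj (norm_nonneg _) (norm_nonneg _) (by linarith)).1 (sub_eq_zero.1 h1)
    · exact sub_eq_zero.1 h1
  rw [inner_plap_sub_eq hp, h0, zero_add] at h
  by_cases hξ : ‖ξ‖ = 0
  · rw [norm_eq_zero.1 hξ, norm_eq_zero.1 (hn.symm.trans hξ)]
  · have hpos : 0 < ‖ξ‖ := lt_of_le_of_ne (norm_nonneg _) (Ne.symm hξ)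
    have hpos' : 0 < ‖η‖ := hn ▸ hpos
    have h2 : ‖ξ‖ * ‖η‖ - inner ℝ ξ η = 0 := by
      rcases mul_eq_zero.1 h with h1 | h1
      · have : 0 < ‖ξ‖ ^ (p - 2) + ‖η‖ ^ (p - 2) := by positivity
        linarith
      · exact h1
    have h3 : ‖η‖ • ξ = ‖ξ‖ • η := inner_eq_norm_mul_iff_real.1 (by linarith)
    rw [hn] at h3
    exact smul_right_injective V hpos'.ne' h3

/-- Pointwise convergence from the decay of the monotonicity expression. -/
theorem tendsto_of_inner_plap_sub [FiniteDimensional ℝ V] {p : ℝ} (hp : 1 < p) {ξ : ℕ → V} {η : V}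
    (h : Tendsto (fun j => inner ℝ (plap p (ξ j) - plap p η) (ξ j - η)) atTop (𝓝 0)) :
    Tendsto ξ atTop (𝓝 η) := by
  have hbdd : ∀ᶠ j in atTop, ‖ξ j‖ ≤ ‖η‖ + 1 := by
    -- Once ‖ξ j‖ exceeds ‖η‖ + 1, the length part alone is at least this gap, which convergence to
    -- 0 eventually forbids.
    have hδ : 0 < (‖η‖ + 1) ^ (p - 1) - ‖η‖ ^ (p - 1) :=
      sub_pos.2 (Real.rpow_lt_rpow (norm_nonneg _) (by linarith) (by linarith))
    filter_upwards [(tendsto_order.1 h).2 _ hδ] with j hj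
    by_contra! hlt
    have h1 := le_inner_plap_sub hp (ξ j) η
    have h2 := Real.rpow_le_rpow (by positivity) hlt.le (by linarith : 0 ≤ p - 1)
    nlinarith
  refine tendsto_of_subseq_tendsto fun ns hns => ?_
  obtain ⟨n0, hn0⟩ := eventually_atTop.1 (hns.eventually hbdd)
  obtain ⟨a, -, φ, hφ, hlim⟩ := (isCompact_closedBall (0 : V) (‖η‖ + 1)).tendsto_subseq
    (x := fun k => ξ (ns (k + n0))) fun k => by
      simpa using hn0 (k + n0) (by omega)
  refine ⟨fun k => φ k + n0, ?_⟩
  have h1 : Tendsto (fun k => ns (φ k + n0)) atTop atTop :=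
    hns.comp ((tendsto_add_atTop_nat n0).comp hφ.tendsto_atTop)
  -- At a cluster point a the expression is 0 by continuity, so a = η.
  have h2 := h.comp h1
  have h3 : Tendsto (fun k => inner ℝ (plap p (ξ (ns (φ k + n0))) - plap p η)
      (ξ (ns (φ k + n0)) - η)) atTop (𝓝 (inner ℝ (plap p a - plap p η) (a - η))) :=
    Tendsto.inner ((((continuous_plap hp).tendsto a).comp hlim).sub_const _) (hlim.sub_const _)
  have := eq_of_inner_plap_sub_eq_zero hp (tendsto_nhds_unique h3 h2)
  rw [← this]
  exact hlim

end Pointwise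

/-! ### Weak sequential compactness from a uniformly convex functional -/

section WeakCompactness

variable {X : Type*} [NormedAddCommGroup X] [NormedSpace ℝ X]

theorem weaklyConverges_of_forall_dual {u : ℕ → X} {v : X}
    (h : ∀ Λ : StrongDual ℝ X, Tendsto (fun j => Λ (u j)) atTop (𝓝 (Λ v))) :
    WeaklyConverges u v := by
  refine (WeakBilin.tendsto_iff_forall_eval_tendsto (topDualPairing ℝ X).flip ?_).2 h
  intro x y hxy
  exact (SeparatingDual.eq_iff_forall_dual_eq (R := ℝ)).2 fun Λ => LinearMap.congr_fun hxy Λ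

/-- A continuous coercive functional comparable to `‖·‖^p` whose midpoint defect controls
distances. -/
structure IsUniformlyConvexFunctional (p : ℝ) (Φ : X → ℝ) : Prop where
  one_lt : 1 < p
  continuous : Continuous Φ
  coercive : ∃ K : ℝ, 0 < K ∧ ∀ v, ‖v‖ ^ p ≤ K * Φ v
  defect : ∀ ε : ℝ, 0 < ε → ∃ C : ℝ, 0 ≤ C ∧ ∀ a b, ‖a - b‖ ^ p ≤
    ε * (Φ a + Φ b) + C * ((Φ a + Φ b) / 2 - Φ ((2 : ℝ)⁻¹ • (a + b)))

variable {p : ℝ} {Φ : X → ℝ}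

theorem IsUniformlyConvexFunctional.nonneg (hΦ : IsUniformlyConvexFunctional p Φ) (v : X) :
    0 ≤ Φ v := by
  obtain ⟨K, hK, h⟩ := hΦ.coercive
  have h1 : 0 ≤ ‖v‖ ^ p := by positivity
  exact nonneg_of_mul_nonneg_right (h1.trans (h v)) hK

/-- With Φ bounded along the sequence, small midpoint defects force small distances. Minimising
sequences produce such defects because the midpoint remains a competitor. -/
theorem IsUniformlyConvexFunctional.cauchySeq (hΦ : IsUniformlyConvexFunctional p Φ)
    {v : ℕ → X} {M : ℝ} (hM : ∀ n, Φ (v n) ≤ M)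
    (hd : ∀ ε : ℝ, 0 < ε → ∃ n₀, ∀ n ≥ n₀, ∀ m ≥ n,
      (Φ (v n) + Φ (v m)) / 2 - Φ ((2 : ℝ)⁻¹ • (v n + v m)) ≤ ε) : CauchySeq v := by
  have hp0 : 0 < p := by linarith [hΦ.one_lt]
  have hM0 : 0 ≤ M := (hΦ.nonneg (v 0)).trans (hM 0)
  rw [Metric.cauchySeq_iff']
  intro ε hε
  -- The two tolerances make the terms of `defect` at most ε^p/2 and ε^p/4.
  obtain ⟨C, hC, hle⟩ := hΦ.defect (ε ^ p / (4 * (M + 1))) (by positivity)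
  obtain ⟨n₀, hn⟩ := hd (ε ^ p / (4 * (C + 1))) (by positivity)
  refine ⟨n₀, fun n hn' => ?_⟩
  have h1 := hn n₀ le_rfl n hn'
  have h2 := hle (v n₀) (v n)
  have hεp : 0 < ε ^ p := by positivity
  have h3 : ε ^ p / (4 * (M + 1)) * (Φ (v n₀) + Φ (v n)) ≤ ε ^ p / 2 := by
    rw [div_mul_eq_mul_div, div_le_iff₀ (by positivity)]
    nlinarith [hM n₀, hM n]
  have h4 : C * ((Φ (v n₀) + Φ (v n)) / 2 - Φ ((2 : ℝ)⁻¹ • (v n₀ + v n))) ≤ ε ^ p / 4 := by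
    refine (mul_le_mul_of_nonneg_left h1 hC).trans ?_
    rw [mul_div_assoc', div_le_div_iff₀ (by positivity) (by positivity)]
    nlinarith
  have h5 : ‖v n₀ - v n‖ ^ p < ε ^ p := by linarith
  rw [dist_comm, dist_eq_norm]
  exact (Real.rpow_lt_rpow_iff (norm_nonneg _) hε.le hp0).1 h5

/-- A power p > 1 beats any linear term. It serves the coercivity of Φ - Λ and, later, the
boundedness of Palais–Smale sequences. -/
theorem exists_le_rpow_sub_linear {K L : ℝ} (hp : 1 < p) (hK : 0 < K) (hL : 0 ≤ L) :
    ∃ B : ℝ, ∀ t : ℝ, 0 ≤ t → t ≤ t ^ p / K - L * t + B := by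
  -- Beyond this `T` one has t^p / K ≥ (L + 1) t.
  set T : ℝ := ((L + 1) * K) ^ (p - 1)⁻¹ with hT
  have hT0 : 0 ≤ T := by positivity
  have hTp : T ^ (p - 1) = (L + 1) * K := by
    rw [hT, ← Real.rpow_mul (by positivity), inv_mul_cancel₀ (by linarith), Real.rpow_one]
  refine ⟨(L + 1) * T, fun t ht => ?_⟩
  have h0 : 0 ≤ t ^ p / K := by positivity
  rcases le_total t T with h | h
  · nlinarith
  · have htp : 0 < t := by
      refine lt_of_lt_of_le ?_ h
      positivity
    have h1 : (L + 1) * t ≤ t ^ p / K := by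
      rw [le_div_iff₀ hK]
      have := Real.rpow_le_rpow hT0 h (by linarith : 0 ≤ p - 1)
      rw [hTp] at this
      have e : t ^ p = t ^ (p - 1) * t := by
        rw [← Real.rpow_add_one htp.ne']; ring_nf
      rw [e]
      nlinarith
    have : 0 ≤ (L + 1) * T := by positivity
    linarith

/-- Compactness of a countable product of intervals performs the diagonal extraction on a dense
sequence of functionals; boundedness of u extends convergence to all of them. That the limits come
from a vector is a separate matter. -/
theorem exists_subseq_dual_tendsto [TopologicalSpace.SeparableSpace (StrongDual ℝ X)]
    {u : ℕ → X} {B : ℝ} (hu : ∀ n, ‖u n‖ ≤ B) :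
    ∃ φ : ℕ → ℕ, StrictMono φ ∧ ∀ Λ : StrongDual ℝ X,
      ∃ l, Tendsto (fun n => Λ (u (φ n))) atTop (𝓝 l) := by
  have hB : 0 ≤ B := (norm_nonneg _).trans (hu 0)
  set D := TopologicalSpace.denseSeq (StrongDual ℝ X) with hD
  have hK : IsCompact (univ.pi fun i => Icc (-(‖D i‖ * B)) (‖D i‖ * B)) :=
    isCompact_univ_pi fun i => isCompact_Icc
  obtain ⟨a, -, φ, hφ, hlim⟩ := hK.tendsto_subseq (x := fun n i => D i (u n)) fun n i _ => by
    exact abs_le.1 <| ((D i).le_opNorm (u n)).trans (mul_le_mul_of_nonneg_left (hu n) (norm_nonneg _))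
  refine ⟨φ, hφ, fun Λ => cauchySeq_tendsto_of_complete ?_⟩
  rw [Metric.cauchySeq_iff']
  intro ε hε
  obtain ⟨i, hi⟩ := (TopologicalSpace.denseRange_denseSeq (StrongDual ℝ X)).exists_dist_lt Λ
    (show 0 < ε / (3 * (B + 1)) by positivity)
  rw [dist_eq_norm, lt_div_iff₀ (by positivity)] at hi
  obtain ⟨n₀, hn₀⟩ := Metric.cauchySeq_iff'.1 ((tendsto_pi_nhds.1 hlim) i).cauchySeq (ε / 3)
    (by positivity)
  refine ⟨n₀, fun n hn => ?_⟩
  have h1 := hn₀ n hn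
  have h2 : ∀ k, |Λ (u k) - D i (u k)| < ε / 3 := fun k => by
    have h3 := ((Λ - D i).le_opNorm (u k)).trans
      (mul_le_mul_of_nonneg_left (hu k) (norm_nonneg _))
    have h4 : ‖Λ - D i‖ * B ≤ ‖Λ - D i‖ * (B + 1) := by gcongr; linarith
    rw [← Real.norm_eq_abs]
    have h5 : (Λ - D i) (u k) = Λ (u k) - D i (u k) := rfl
    rw [h5] at h3
    have : ‖Λ - D i‖ * (B + 1) < ε / 3 := by
      have : ‖Λ - D i‖ * (3 * (B + 1)) = 3 * (‖Λ - D i‖ * (B + 1)) := by ring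
      have h6 : 3 * (‖Λ - D i‖ * (B + 1)) < ε := by rw [← this]; exact hi
      linarith
    linarith
  have h3 := h2 (φ n)
  have h4 := h2 (φ n₀)
  simp only [Function.comp_apply, Real.dist_eq] at h1 ⊢
  rw [abs_lt] at *
  constructor <;> linarith

variable [CompleteSpace X]

/-- Perturbing by a continuous linear functional, a minimum is attained. -/
theorem IsUniformlyConvexFunctional.exists_isMinOn (hΦ : IsUniformlyConvexFunctional p Φ)
    (Λ : StrongDual ℝ X) : ∃ v, IsMinOn (fun w => Φ w - Λ w) univ v := by
  obtain ⟨K, hK, hcoer⟩ := hΦ.coercive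
  obtain ⟨B, hB⟩ := exists_le_rpow_sub_linear hΦ.one_lt hK (norm_nonneg Λ)
  set J : X → ℝ := fun w => Φ w - Λ w with hJ
  have hJc : Continuous J := hΦ.continuous.sub Λ.continuous
  have hJB : ∀ w, ‖w‖ ≤ J w + B := fun w => by
    have h1 := hB ‖w‖ (norm_nonneg w)
    have h2 : ‖w‖ ^ p / K ≤ Φ w := by rw [div_le_iff₀ hK, mul_comm]; exact hcoer w
    have h3 := (le_abs_self _).trans (Λ.le_opNorm w)
    simp only [hJ]
    linarith
  have hbdd : BddBelow (range J) := ⟨-B, by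
    rintro _ ⟨w, rfl⟩
    linarith [hJB w, norm_nonneg w]⟩
  set m : ℝ := ⨅ w, J w with hm
  have hlow : ∀ w, m ≤ J w := fun w => ciInf_le hbdd w
  have hex : ∀ n : ℕ, ∃ w, J w < m + 1 / ((n : ℝ) + 1) := fun n =>
    exists_lt_of_ciInf_lt (lt_add_of_pos_right _ (by positivity))
  choose v hv using hex
  have hle1 : ∀ n : ℕ, 1 / ((n : ℝ) + 1) ≤ 1 := fun n => by
    rw [div_le_one (by positivity)]; linarith [n.cast_nonneg (α := ℝ)]
  have hcau : CauchySeq v := by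
    refine hΦ.cauchySeq (M := m + 1 + ‖Λ‖ * (m + 1 + B)) (fun n => ?_) fun ε hε => ?_
    · have h1 := hJB (v n)
      have h2 := hv n
      have h3 := hle1 n
      have h4 := (le_abs_self _).trans (Λ.le_opNorm (v n))
      have h5 : ‖Λ‖ * ‖v n‖ ≤ ‖Λ‖ * (m + 1 + B) :=
        mul_le_mul_of_nonneg_left (by linarith) (norm_nonneg _)
      have h6 : Φ (v n) = J (v n) + Λ (v n) := by simp [hJ]
      linarith
    · obtain ⟨n₀, hn₀⟩ := exists_nat_one_div_lt hε
      refine ⟨n₀, fun n hn k hk => ?_⟩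
      -- A linear term does not affect midpoint defects, and J at the midpoint is at least the
      -- infimum.
      have e : (Φ (v n) + Φ (v k)) / 2 - Φ ((2 : ℝ)⁻¹ • (v n + v k)) =
          (J (v n) + J (v k)) / 2 - J ((2 : ℝ)⁻¹ • (v n + v k)) := by
        simp only [hJ, map_smul, map_add, smul_eq_mul]
        ring
      have h1 : ∀ i ≥ n₀, 1 / ((i : ℝ) + 1) ≤ 1 / ((n₀ : ℝ) + 1) := fun i hi =>
        one_div_le_one_div_of_le (by positivity) (by
          have : (n₀ : ℝ) ≤ i := by exact_mod_cast hi
          linarith)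
      have h2 := h1 n hn
      have h3 := h1 k (hn.trans hk)
      rw [e]
      linarith [hv n, hv k, hlow ((2 : ℝ)⁻¹ • (v n + v k))]
  obtain ⟨w, hw⟩ := cauchySeq_tendsto_of_complete hcau
  refine ⟨w, fun z _ => ?_⟩
  have h1 : Tendsto (fun n => J (v n)) atTop (𝓝 (J w)) := (hJc.tendsto w).comp hw
  have h2 : Tendsto (fun n : ℕ => m + 1 / ((n : ℝ) + 1)) atTop (𝓝 (m + 0)) :=
    tendsto_one_div_add_atTop_nhds_zero_nat.const_add m
  rw [add_zero] at h2
  exact (le_of_tendsto_of_tendsto' h1 h2 fun n => (hv n).le).trans (hlow z)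

/-- Decreasing sequences of closed convex sets meeting a sublevel set have a common point. -/
theorem IsUniformlyConvexFunctional.exists_mem_iInter (hΦ : IsUniformlyConvexFunctional p Φ)
    {C : ℕ → Set X} (hanti : Antitone C) (hclosed : ∀ n, IsClosed (C n))
    (hconv : ∀ n, Convex ℝ (C n)) {M : ℝ} (hM : ∀ n, ∃ v ∈ C n, Φ v ≤ M) :
    ∃ v, ∀ n, v ∈ C n := by
  -- The infima increase with n and stay below `M`, hence converge; near-minimisers in `C n` will
  -- form a Cauchy sequence.
  set d : ℕ → ℝ := fun n => sInf (Φ '' C n) with hd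
  have hbdd : ∀ n, BddBelow (Φ '' C n) := fun n => ⟨0, by
    rintro _ ⟨w, -, rfl⟩
    exact hΦ.nonneg w⟩
  have hlow : ∀ n, ∀ w ∈ C n, d n ≤ Φ w := fun n w hw => csInf_le (hbdd n) ⟨w, hw, rfl⟩
  have hne : ∀ n, (Φ '' C n).Nonempty := fun n => by
    obtain ⟨v, hv, -⟩ := hM n
    exact ⟨_, v, hv, rfl⟩
  have hdM : ∀ n, d n ≤ M := fun n => by
    obtain ⟨v, hv, hvM⟩ := hM n
    exact (hlow n v hv).trans hvM
  have hmono : Monotone d := fun m n hmn =>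
    csInf_le_csInf (hbdd m) (hne n) (image_mono (hanti hmn))
  have hlim := tendsto_atTop_ciSup hmono ⟨M, by rintro _ ⟨n, rfl⟩; exact hdM n⟩
  have hex : ∀ n : ℕ, ∃ w ∈ C n, Φ w < d n + 1 / ((n : ℝ) + 1) := fun n => by
    obtain ⟨_, ⟨w, hw, rfl⟩, hlt⟩ := exists_lt_of_csInf_lt (hne n)
      (lt_add_of_pos_right (d n) (by positivity : (0 : ℝ) < 1 / ((n : ℝ) + 1)))
    exact ⟨w, hw, hlt⟩
  choose v hvC hv using hex
  have hcau : CauchySeq v := by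
    refine hΦ.cauchySeq (M := M + 1) (fun n => ?_) fun ε hε => ?_
    · have : 1 / ((n : ℝ) + 1) ≤ 1 := by
        rw [div_le_one (by positivity)]; linarith [n.cast_nonneg (α := ℝ)]
      linarith [hv n, hdM n]
    · obtain ⟨n₀, hn₀⟩ := exists_nat_one_div_lt (half_pos hε)
      obtain ⟨n₁, hn₁⟩ := Metric.cauchySeq_iff.1 hlim.cauchySeq ε hε
      refine ⟨max n₀ n₁, fun n hn k hk => ?_⟩
      have h1 : ∀ i ≥ n₀, 1 / ((i : ℝ) + 1) ≤ 1 / ((n₀ : ℝ) + 1) := fun i hi =>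
        one_div_le_one_div_of_le (by positivity) (by
          have : (n₀ : ℝ) ≤ i := by exact_mod_cast hi
          linarith)
      have h2 := h1 n ((le_max_left _ _).trans hn)
      have h3 := h1 k ((le_max_left _ _).trans (hn.trans hk))
      have h4 := hn₁ n ((le_max_right _ _).trans hn) k ((le_max_right _ _).trans (hn.trans hk))
      rw [Real.dist_eq, abs_lt] at h4
      -- For k ≥ n both points lie in `C n`, so the midpoint is a competitor for `d n`, and the
      -- defect is controlled by d k - d n and the tolerances.
      have h5 : (2 : ℝ)⁻¹ • (v n + v k) ∈ C n := by
        rw [smul_add]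
        exact hconv n (hvC n) (hanti hk (hvC k)) (by norm_num) (by norm_num) (by norm_num)
      linarith [hv n, hv k, hlow n _ h5]
  obtain ⟨w, hw⟩ := cauchySeq_tendsto_of_complete hcau
  refine ⟨w, fun n => (hclosed n).mem_of_tendsto hw ?_⟩
  exact (eventually_ge_atTop n).mono fun k hk => hanti hk (hvC k)

/-- Weak sequential compactness of bounded sequences. -/
theorem IsUniformlyConvexFunctional.exists_subseq_weak (hΦ : IsUniformlyConvexFunctional p Φ)
    [TopologicalSpace.SeparableSpace (StrongDual ℝ X)] {u : ℕ → X} {B M : ℝ}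
    (hu : ∀ n, ‖u n‖ ≤ B) (hM : ∀ n, Φ (u n) ≤ M) :
    ∃ φ : ℕ → ℕ, StrictMono φ ∧ ∃ v, ∀ Λ : StrongDual ℝ X,
      Tendsto (fun n => Λ (u (φ n))) atTop (𝓝 (Λ v)) := by
  obtain ⟨φ, hφ, hlim⟩ := exists_subseq_dual_tendsto hu
  obtain ⟨v, hv⟩ := hΦ.exists_mem_iInter
    (C := fun n => closedConvexHull ℝ ((fun k => u (φ k)) '' Ici n))
    (fun m n hmn => (closedConvexHull ℝ).monotone (image_mono (Ici_subset_Ici.2 hmn)))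
    (fun n => isClosed_closedConvexHull) (fun n => convex_closedConvexHull)
    (M := M) (fun n => ⟨u (φ n), subset_closedConvexHull ⟨n, self_mem_Ici, rfl⟩, hM _⟩)
  refine ⟨φ, hφ, v, fun Λ => ?_⟩
  obtain ⟨l, hl⟩ := hlim Λ
  suffices Λ v = l by rwa [this]
  refine eq_of_forall_dist_le fun ε hε => ?_
  obtain ⟨n, hn⟩ := Metric.tendsto_atTop.1 hl ε hε
  -- A closed slab around l contains a tail and hence its closed hull. As v lies in all the hulls, Λ
  -- v is within every ε of l.
  have hsub : closedConvexHull ℝ ((fun k => u (φ k)) '' Ici n) ⊆ Λ ⁻¹' Metric.closedBall l ε := by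
    refine closedConvexHull_min ?_ ((convex_closedBall l ε).linear_preimage Λ.toLinearMap)
      (Metric.isClosed_closedBall.preimage Λ.continuous)
    rintro _ ⟨k, hk, rfl⟩
    exact (hn k hk).le
  exact hsub (hv n)

end WeakCompactness

/-! ### Sobolev and Poincaré inequalities in W_0^{1,p} -/

section Sobolev

variable {N : ℕ} {Ω : Set (EuclideanSpace ℝ (Fin N))} {p : ℝ}

theorem IsTestFunction.contDiff_one {φ : EuclideanSpace ℝ (Fin N) → ℝ} (h : IsTestFunction Ω φ) :
    ContDiff ℝ 1 φ := h.smooth.of_le (by exact_mod_cast le_top)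

theorem norm_gradient (φ : EuclideanSpace ℝ (Fin N) → ℝ) (x : EuclideanSpace ℝ (Fin N)) :
    ‖gradient φ x‖ = ‖fderiv ℝ φ x‖ := by
  simp [gradient]

theorem IsTestFunction.continuous_gradient {φ : EuclideanSpace ℝ (Fin N) → ℝ}
    (h : IsTestFunction Ω φ) : Continuous (gradient φ) :=
  (InnerProductSpace.toDual ℝ (EuclideanSpace ℝ (Fin N))).symm.continuous.comp
    (h.contDiff_one.continuous_fderiv one_ne_zero)

theorem support_gradient_subset (φ : EuclideanSpace ℝ (Fin N) → ℝ) :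
    Function.support (gradient φ) ⊆ tsupport φ := by
  intro x hx
  by_contra hx'
  refine hx ?_
  have : fderiv ℝ φ x = 0 := by
    by_contra h
    exact hx' (support_fderiv_subset ℝ h)
  simp [gradient, this]

theorem IsTestFunction.hasCompactSupport_gradient {φ : EuclideanSpace ℝ (Fin N) → ℝ}
    (h : IsTestFunction Ω φ) : HasCompactSupport (gradient φ) :=
  h.compact.mono' (support_gradient_subset φ)

theorem finrank_pos_of_lt (hp : 1 < p) (hpN : p < N) :
    0 < Module.finrank ℝ (EuclideanSpace ℝ (Fin N)) := by
  rw [finrank_euclideanSpace_fin]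
  have : (0 : ℝ) < N := by linarith
  exact_mod_cast this

theorem lt_pStar (hp : 1 < p) (hpN : p < N) : p < pStar N p := by
  unfold pStar
  rw [lt_div_iff₀ (by linarith)]
  nlinarith

theorem pStar_inv (hp : 1 < p) (hpN : p < N) : (pStar N p)⁻¹ = p⁻¹ - (N : ℝ)⁻¹ := by
  unfold pStar
  have h1 : (N : ℝ) ≠ 0 := by linarith
  have h2 : p ≠ 0 := by linarith
  have h3 : (N : ℝ) - p ≠ 0 := by linarith
  field_simp

/-- The Sobolev inequality for test functions. -/
theorem exists_eLpNorm_test_le (Ω : Set (EuclideanSpace ℝ (Fin N))) (hp : 1 < p) (hpN : p < N) :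
    ∃ C : NNReal, ∀ φ, IsTestFunction Ω φ →
      eLpNorm φ (ENNReal.ofReal (pStar N p)) (volume.restrict Ω) ≤
        C * eLpNorm (gradient φ) (ENNReal.ofReal p) (volume.restrict Ω) := by
  refine ⟨SNormLESNormFDerivOfEqConst ℝ (volume : Measure (EuclideanSpace ℝ (Fin N)))
    (p.toNNReal : ℝ), fun φ hφ => ?_⟩
  have hps := lt_pStar hp hpN
  have key := eLpNorm_le_eLpNorm_fderiv_of_eq (volume : Measure (EuclideanSpace ℝ (Fin N)))
    hφ.contDiff_one hφ.compact (p := p.toNNReal) (p' := (pStar N p).toNNReal)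
    (by simpa using Real.toNNReal_le_toNNReal hp.le)
    (finrank_pos_of_lt hp hpN) (by
      rw [finrank_euclideanSpace_fin, NNReal.coe_inv,
        Real.coe_toNNReal _ (by linarith), Real.coe_toNNReal _ (by linarith)]
      exact pStar_inv hp hpN)
  have e1 : eLpNorm (fderiv ℝ φ) (p.toNNReal : ℝ≥0∞) volume =
      eLpNorm (gradient φ) (ENNReal.ofReal p) (volume.restrict Ω) := by
    rw [eLpNorm_restrict_eq_of_support_subset ((support_gradient_subset φ).trans hφ.supp)]
    exact eLpNorm_congr_norm_ae (Eventually.of_forall fun x => (norm_gradient φ x).symm)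
  rw [e1] at key
  exact (eLpNorm_restrict_le φ _ volume Ω).trans key

variable [Fact (1 ≤ ENNReal.ofReal p)]

/-- The gradient as a continuous linear map. -/
def gradL : W0 Ω p →L[ℝ] Lp (EuclideanSpace ℝ (Fin N)) (ENNReal.ofReal p) (volume.restrict Ω) :=
  (ContinuousLinearMap.snd ℝ _ _).comp (testPairs Ω p).topologicalClosure.subtypeL

/-- The inclusion of `W_0^{1,p}` in `L^p`. -/
def fnL : W0 Ω p →L[ℝ] Lp ℝ (ENNReal.ofReal p) (volume.restrict Ω) :=
  (ContinuousLinearMap.fst ℝ _ _).comp (testPairs Ω p).topologicalClosure.subtypeL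

theorem gradL_coe (u : W0 Ω p) : ⇑(gradL u) = u.grad := rfl

theorem fnL_coe (u : W0 Ω p) : ⇑(fnL u) = u.fn := rfl

theorem W0.norm_eq (u : W0 Ω p) : ‖u‖ = max ‖fnL u‖ ‖gradL u‖ := rfl

theorem norm_gradL_le (u : W0 Ω p) : ‖gradL u‖ ≤ ‖u‖ := le_max_right _ _

theorem norm_fnL_le (u : W0 Ω p) : ‖fnL u‖ ≤ ‖u‖ := le_max_left _ _

theorem W0.memLp_grad (u : W0 Ω p) : MemLp u.grad (ENNReal.ofReal p) (volume.restrict Ω) :=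
  Lp.memLp (gradL u)

theorem W0.memLp_fn (u : W0 Ω p) : MemLp u.fn (ENNReal.ofReal p) (volume.restrict Ω) :=
  Lp.memLp (fnL u)

theorem W0.sub_fn (u v : W0 Ω p) : (u - v).fn =ᵐ[volume.restrict Ω] fun x => u.fn x - v.fn x :=
  Lp.coeFn_sub (fnL u) (fnL v)

theorem W0.sub_grad (u v : W0 Ω p) :
    (u - v).grad =ᵐ[volume.restrict Ω] fun x => u.grad x - v.grad x :=
  Lp.coeFn_sub (gradL u) (gradL v)

/-- `u` is the element of `W_0^{1,p}` given by the test function `φ`. -/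
structure IsTestRep (u : W0 Ω p) (φ : EuclideanSpace ℝ (Fin N) → ℝ) : Prop where
  test : IsTestFunction Ω φ
  fn_ae : u.fn =ᵐ[volume.restrict Ω] φ
  grad_ae : u.grad =ᵐ[volume.restrict Ω] gradient φ

theorem IsTestFunction.exists_rep {φ : EuclideanSpace ℝ (Fin N) → ℝ} (h : IsTestFunction Ω φ) :
    ∃ u : W0 Ω p, IsTestRep u φ := by
  have h1 : MemLp φ (ENNReal.ofReal p) (volume.restrict Ω) :=
    (h.contDiff_one.continuous.memLp_of_hasCompactSupport h.compact).restrict Ω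
  have h2 : MemLp (gradient φ) (ENNReal.ofReal p) (volume.restrict Ω) :=
    (h.continuous_gradient.memLp_of_hasCompactSupport h.hasCompactSupport_gradient).restrict Ω
  exact ⟨⟨(h1.toLp φ, h2.toLp _), (testPairs Ω p).le_topologicalClosure
    ⟨φ, h, h1.coeFn_toLp, h2.coeFn_toLp⟩⟩, h, h1.coeFn_toLp, h2.coeFn_toLp⟩

theorem exists_test_dist_lt (u : W0 Ω p) {ε : ℝ} (hε : 0 < ε) :
    ∃ (w : W0 Ω p) (φ : EuclideanSpace ℝ (Fin N) → ℝ), IsTestRep w φ ∧ ‖u - w‖ < ε := by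
  obtain ⟨z, ⟨φ, hφ, h1, h2⟩, hz⟩ := Metric.mem_closure_iff.1 u.2 ε hε
  refine ⟨⟨z, (testPairs Ω p).le_topologicalClosure ⟨φ, hφ, h1, h2⟩⟩, φ, ⟨hφ, h1, h2⟩, ?_⟩
  rw [dist_eq_norm] at hz
  exact hz

theorem exists_test_seq (u : W0 Ω p) :
    ∃ (w : ℕ → W0 Ω p) (φ : ℕ → EuclideanSpace ℝ (Fin N) → ℝ), (∀ n, IsTestRep (w n) (φ n)) ∧
      Tendsto w atTop (𝓝 u) := by
  choose w φ h1 h2 using fun n : ℕ =>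
    exists_test_dist_lt u (ε := 1 / ((n : ℝ) + 1)) (by positivity)
  refine ⟨w, φ, h1, ?_⟩
  rw [tendsto_iff_norm_sub_tendsto_zero]
  refine squeeze_zero (fun _ => norm_nonneg _) (fun n => ?_)
    tendsto_one_div_add_atTop_nhds_zero_nat
  rw [norm_sub_rev]
  exact (h2 n).le

/-- The Sobolev inequality in `W_0^{1,p}`. -/
theorem exists_eLpNorm_fn_le (Ω : Set (EuclideanSpace ℝ (Fin N))) (hp : 1 < p) (hpN : p < N) :
    ∃ C : NNReal, ∀ u : W0 Ω p,
      eLpNorm u.fn (ENNReal.ofReal (pStar N p)) (volume.restrict Ω) ≤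
        C * eLpNorm u.grad (ENNReal.ofReal p) (volume.restrict Ω) := by
  obtain ⟨C, hC⟩ := exists_eLpNorm_test_le Ω hp hpN
  refine ⟨C, fun u => ?_⟩
  obtain ⟨w, φ, hw, hlim⟩ := exists_test_seq u
  obtain ⟨ns, hns, hae⟩ := (tendstoInMeasure_of_tendsto_Lp
    ((fnL.continuous.tendsto u).comp hlim)).exists_seq_tendsto_ae
  -- Fatou along an a.e. convergent subsequence of test functions: convergence in L^{p*} need not be
  -- known beforehand.
  have h1 : eLpNorm u.fn (ENNReal.ofReal (pStar N p)) (volume.restrict Ω) ≤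
      liminf (fun n => eLpNorm (w (ns n)).fn (ENNReal.ofReal (pStar N p)) (volume.restrict Ω))
        atTop :=
    Lp.eLpNorm_lim_le_liminf_eLpNorm (fun n => (w (ns n)).memLp_fn.1) _ hae
  have h2 : ∀ n, eLpNorm (w (ns n)).fn (ENNReal.ofReal (pStar N p)) (volume.restrict Ω) ≤
      C * eLpNorm (w (ns n)).grad (ENNReal.ofReal p) (volume.restrict Ω) := fun n => by
    rw [eLpNorm_congr_ae (hw (ns n)).fn_ae, eLpNorm_congr_ae (hw (ns n)).grad_ae]
    exact hC _ (hw (ns n)).test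
  have h3 : Tendsto (fun n => eLpNorm (w (ns n)).grad (ENNReal.ofReal p) (volume.restrict Ω))
      atTop (𝓝 (eLpNorm u.grad (ENNReal.ofReal p) (volume.restrict Ω))) := by
    have e : ∀ v : W0 Ω p, eLpNorm v.grad (ENNReal.ofReal p) (volume.restrict Ω) =
        ENNReal.ofReal ‖gradL v‖ := fun v => by
      rw [Lp.norm_def, gradL_coe, ENNReal.ofReal_toReal (v.memLp_grad.eLpNorm_ne_top)]
    simp_rw [e]
    exact ENNReal.tendsto_ofReal
      (((gradL.continuous.tendsto u).comp (hlim.comp hns.tendsto_atTop)).norm)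
  have h4 := ENNReal.Tendsto.const_mul (a := (C : ℝ≥0∞)) h3 (Or.inr ENNReal.coe_ne_top)
  calc _ ≤ _ := h1
    _ ≤ liminf (fun n => C * eLpNorm (w (ns n)).grad (ENNReal.ofReal p) (volume.restrict Ω))
        atTop := liminf_le_liminf (Eventually.of_forall h2)
    _ = _ := h4.liminf_eq

theorem W0.memLp_fn_pStar (hp : 1 < p) (hpN : p < N) (u : W0 Ω p) :
    MemLp u.fn (ENNReal.ofReal (pStar N p)) (volume.restrict Ω) := by
  obtain ⟨C, hC⟩ := exists_eLpNorm_fn_le Ω hp hpN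
  exact ⟨u.memLp_fn.1, (hC u).trans_lt (ENNReal.mul_lt_top ENNReal.coe_lt_top
    u.memLp_grad.eLpNorm_lt_top)⟩

/-- The Sobolev embedding `W_0^{1,p} → L^{p^*}`. -/
theorem exists_sobolev_embedding (hp : 1 < p) (hpN : p < N)
    [Fact (1 ≤ ENNReal.ofReal (pStar N p))] :
    ∃ J : W0 Ω p →L[ℝ] Lp ℝ (ENNReal.ofReal (pStar N p)) (volume.restrict Ω),
      ∀ u, J u =ᵐ[volume.restrict Ω] u.fn := by
  obtain ⟨C, hC⟩ := exists_eLpNorm_fn_le Ω hp hpN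
  let L : W0 Ω p →ₗ[ℝ] Lp ℝ (ENNReal.ofReal (pStar N p)) (volume.restrict Ω) :=
    { toFun := fun u => (u.memLp_fn_pStar hp hpN).toLp
      map_add' := fun u v => by
        rw [← MemLp.toLp_add]
        exact MemLp.toLp_congr _ _ (Lp.coeFn_add (fnL u) (fnL v))
      map_smul' := fun c u => by
        rw [RingHom.id_apply, ← MemLp.toLp_const_smul]
        exact MemLp.toLp_congr _ _ (Lp.coeFn_smul c (fnL u)) }
  refine ⟨L.mkContinuous C fun u => ?_, fun u => (u.memLp_fn_pStar hp hpN).coeFn_toLp⟩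
  have h1 : ‖L u‖ = (eLpNorm u.fn (ENNReal.ofReal (pStar N p)) (volume.restrict Ω)).toReal :=
    Lp.norm_toLp _ (u.memLp_fn_pStar hp hpN)
  rw [h1]
  refine (ENNReal.toReal_mono (ENNReal.mul_ne_top ENNReal.coe_ne_top
    u.memLp_grad.eLpNorm_ne_top) (hC u)).trans ?_
  rw [ENNReal.toReal_mul, ENNReal.coe_toReal]
  exact mul_le_mul_of_nonneg_left (norm_gradL_le u) C.2

/-- Poincaré's inequality. -/
theorem exists_norm_le_gradL (hΩ : Bornology.IsBounded Ω) (hp : 1 < p) (hpN : p < N) :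
    ∃ K : ℝ, 0 < K ∧ ∀ u : W0 Ω p, ‖u‖ ≤ K * ‖gradL u‖ := by
  obtain ⟨C, hC⟩ := exists_eLpNorm_fn_le Ω hp hpN
  -- Hölder's factor |Ω|^{1/p - 1/p*} for passing from L^{p*} to L^p, finite because Ω is bounded.
  set m : ℝ≥0∞ := volume.restrict Ω univ ^ (1 / (ENNReal.ofReal p).toReal -
    1 / (ENNReal.ofReal (pStar N p)).toReal) with hm
  have hps := lt_pStar hp hpN
  have hm_top : m ≠ ⊤ := by
    refine ENNReal.rpow_ne_top_of_nonneg ?_ ?_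
    · rw [ENNReal.toReal_ofReal (by linarith), ENNReal.toReal_ofReal (by linarith), sub_nonneg]
      exact one_div_le_one_div_of_le (by linarith) hps.le
    · rw [Measure.restrict_apply_univ]
      exact hΩ.measure_lt_top.ne
  refine ⟨C * m.toReal + 1, by positivity, fun u => ?_⟩
  have h1 : eLpNorm u.fn (ENNReal.ofReal p) (volume.restrict Ω) ≤
      C * eLpNorm u.grad (ENNReal.ofReal p) (volume.restrict Ω) * m :=
    (eLpNorm_le_eLpNorm_mul_rpow_measure_univ (ENNReal.ofReal_le_ofReal hps.le)
      u.memLp_fn.1).trans (mul_le_mul_left (hC u) m)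
  have h2 := ENNReal.toReal_mono (ENNReal.mul_ne_top (ENNReal.mul_ne_top ENNReal.coe_ne_top
    u.memLp_grad.eLpNorm_ne_top) hm_top) h1
  rw [ENNReal.toReal_mul, ENNReal.toReal_mul, ENNReal.coe_toReal] at h2
  have h3 : ‖fnL u‖ ≤ C * ‖gradL u‖ * m.toReal := h2
  rw [W0.norm_eq]
  have : 0 ≤ ‖gradL u‖ := norm_nonneg _
  have : 0 ≤ C * m.toReal * ‖gradL u‖ := by positivity
  refine max_le ?_ ?_ <;> nlinarith

end Sobolev

/-! ### The dual of W_0^{1,p} and weak compactness -/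

section DualSpace

variable {N : ℕ} {Ω : Set (EuclideanSpace ℝ (Fin N))} {p : ℝ}

theorem isPotential_norm_rpow {α V : Type*} [MeasurableSpace α] {μ : Measure α}
    [NormedAddCommGroup V] [InnerProductSpace ℝ V] (hp : 1 < p) :
    IsPotential μ p (fun _ (v : V) => 1 / p * ‖v‖ ^ p) (fun _ => plap p) where
  bound := ⟨1, zero_le_one, Eventually.of_forall fun _ v => by rw [norm_plap hp]; linarith⟩
  grad := Eventually.of_forall fun _ => hasFDerivAt_norm_rpow_div hp
  zero := Eventually.of_forall fun _ => by
    rw [norm_zero, Real.zero_rpow (by linarith), mul_zero]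
  meas w hw := (continuous_const.mul (continuous_norm.rpow_const fun _ =>
    Or.inr (by linarith))).comp_aestronglyMeasurable hw
  meas_grad w hw := (continuous_plap hp).comp_aestronglyMeasurable hw

variable [Fact (1 ≤ ENNReal.ofReal p)]

/-- The `p`-Dirichlet energy. -/
def dirichlet (u : W0 Ω p) : ℝ := ∫ x in Ω, 1 / p * ‖u.grad x‖ ^ p

theorem dirichlet_eq (hp : 1 < p) (u : W0 Ω p) : dirichlet u = 1 / p * ‖gradL u‖ ^ p := by
  rw [dirichlet, integral_const_mul, ← integral_norm_rpow_eq (by linarith)]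
  rfl

/-- The pointwise convexity inequality is integrated, and Poincaré bounds the full norm by that of
the gradient. No distinction between p < 2 and p ≥ 2 is needed. -/
theorem isUniformlyConvexFunctional_dirichlet (hΩ : Bornology.IsBounded Ω) (hp : 1 < p)
    (hpN : p < N) : IsUniformlyConvexFunctional p (dirichlet : W0 Ω p → ℝ) := by
  have hp0 : 0 < p := by linarith
  obtain ⟨K, hK, hKle⟩ := exists_norm_le_gradL (Ω := Ω) hΩ hp hpN
  have hcoer : ∀ v : W0 Ω p, ‖v‖ ^ p ≤ K ^ p * ‖gradL v‖ ^ p := fun v => by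
    rw [← Real.mul_rpow hK.le (norm_nonneg _)]
    exact Real.rpow_le_rpow (norm_nonneg _) (hKle v) hp0.le
  refine ⟨hp, ?_, ⟨K ^ p * p, by positivity, fun v => ?_⟩, fun ε hε => ?_⟩
  · simp_rw [funext (dirichlet_eq (Ω := Ω) hp)]
    exact continuous_const.mul (gradL.continuous.norm.rpow_const fun _ => Or.inr hp0.le)
  · rw [dirichlet_eq hp]
    refine (hcoer v).trans (le_of_eq ?_)
    field_simp
  · have hKp : 0 < K ^ p := by positivity
    obtain ⟨C, hC, hle⟩ := exists_norm_sub_rpow_le (V := EuclideanSpace ℝ (Fin N)) hp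
      (show 0 < ε / (K ^ p * p) by positivity)
    refine ⟨K ^ p * p * C, by positivity, fun a b => ?_⟩
    have hi : ∀ v : W0 Ω p, Integrable (fun x => ‖v.grad x‖ ^ p) (volume.restrict Ω) := fun v =>
      integrable_norm_rpow_ofReal hp0 v.memLp_grad
    have hn : ∀ v : W0 Ω p, ∫ x in Ω, ‖v.grad x‖ ^ p = p * dirichlet v := fun v => by
      rw [dirichlet, integral_const_mul, ← mul_assoc, mul_one_div_cancel hp0.ne', one_mul]
    have hsub := W0.sub_grad a b
    have hmid : ((2 : ℝ)⁻¹ • (a + b)).grad =ᵐ[volume.restrict Ω]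
        fun x => (2 : ℝ)⁻¹ • (a.grad x + b.grad x) := by
      filter_upwards [Lp.coeFn_smul (2 : ℝ)⁻¹ (gradL (a + b)), Lp.coeFn_add (gradL a) (gradL b)]
        with x h1 h2
      rw [← gradL_coe, map_smul, h1, Pi.smul_apply, map_add, h2]
      rfl
    have hint : ∫ x in Ω, ‖(a - b).grad x‖ ^ p ≤
        ε / (K ^ p * p) * (p * dirichlet a + p * dirichlet b) +
          C * ((p * dirichlet a + p * dirichlet b) / 2 - p * dirichlet ((2 : ℝ)⁻¹ • (a + b))) := by
      simp only [← hn]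
      have i0 : Integrable (fun x => ‖a.grad x‖ ^ p + ‖b.grad x‖ ^ p) (volume.restrict Ω) :=
        (hi a).add (hi b)
      have i1 := i0.const_mul (ε / (K ^ p * p))
      have i2 : Integrable (fun x => (‖a.grad x‖ ^ p + ‖b.grad x‖ ^ p) / 2 -
          ‖((2 : ℝ)⁻¹ • (a + b)).grad x‖ ^ p) (volume.restrict Ω) :=
        (i0.div_const 2).sub (hi ((2 : ℝ)⁻¹ • (a + b)))
      rw [← integral_add (hi a) (hi b), ← integral_div, ← integral_sub
        (i0.div_const 2) (hi _), ← integral_const_mul, ← integral_const_mul,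
        ← integral_add i1 (i2.const_mul C)]
      refine integral_mono_ae (hi _) (i1.add (i2.const_mul C)) ?_
      filter_upwards [hsub, hmid] with x h1 h2
      have := hle (a.grad x) (b.grad x)
      simp only [convexDefect, ← h1, ← h2] at this
      exact this
    rw [hn, dirichlet_eq hp (a - b), ← mul_assoc, mul_one_div_cancel hp0.ne', one_mul] at hint
    have h1 := mul_le_mul_of_nonneg_left hint hKp.le
    refine ((hcoer (a - b)).trans h1).trans (le_of_eq ?_)
    field_simp

/-- Every functional on `W_0^{1,p}` is of the form `φ ↦ ∫ ⟨g, ∇φ⟩` with `g ∈ L^{p'}`. -/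
theorem exists_dual_representation (hΩ : Bornology.IsBounded Ω) (hp : 1 < p) (hpN : p < N)
    {p' : ℝ} (hpp : p.HolderConjugate p') (Λ : StrongDual ℝ (W0 Ω p)) :
    ∃ g : Lp (EuclideanSpace ℝ (Fin N)) (ENNReal.ofReal p') (volume.restrict Ω),
      (pairing hpp g).comp gradL = Λ := by
  have : IsFiniteMeasure (volume.restrict Ω) := ⟨by
    rw [Measure.restrict_apply_univ]; exact hΩ.measure_lt_top⟩
  obtain ⟨v, hv⟩ := (isUniformlyConvexFunctional_dirichlet hΩ hp hpN).exists_isMinOn Λ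
  have hpot := isPotential_norm_rpow (V := EuclideanSpace ℝ (Fin N)) (μ := volume.restrict Ω) hp
  obtain ⟨L, hL, hLeq⟩ := hpot.hasFDerivAt hp (gradL v)
  have hd : HasFDerivAt (fun w : W0 Ω p => dirichlet w - Λ w) (L.comp gradL - Λ) v :=
    (hL.comp v gradL.hasFDerivAt).sub Λ.hasFDerivAt
  -- Euler equation of the minimiser v of the Dirichlet energy minus Λ: the representing field is
  -- |∇v|^{p-2}∇v.
  have h0 := (hv.isLocalMin univ_mem).hasFDerivAt_eq_zero hd
  have hg := hpot.memLp_grad hpp v.memLp_grad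
  refine ⟨hg.toLp, ?_⟩
  rw [← sub_eq_zero.1 h0]
  ext φ
  rw [ContinuousLinearMap.comp_apply, ContinuousLinearMap.comp_apply, hLeq, pairing_apply]
  refine integral_congr_ae ?_
  filter_upwards [hg.coeFn_toLp] with x hx
  rw [hx]
  rfl

/-- The dual is a continuous image of the separable space L^{p'}. -/
theorem separableSpace_dual (hΩ : Bornology.IsBounded Ω) (hp : 1 < p) (hpN : p < N) :
    TopologicalSpace.SeparableSpace (StrongDual ℝ (W0 Ω p)) := by
  have hpp := Real.HolderConjugate.conjExponent hp
  have : Fact (1 ≤ ENNReal.ofReal p.conjExponent) := ⟨one_le_ofReal hpp.symm.lt.le⟩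
  have : Fact (ENNReal.ofReal p.conjExponent ≠ ⊤) := ⟨ENNReal.ofReal_ne_top⟩
  have hc : Continuous fun g : Lp (EuclideanSpace ℝ (Fin N)) (ENNReal.ofReal p.conjExponent)
      (volume.restrict Ω) => (pairing hpp g).comp (gradL : W0 Ω p →L[ℝ] _) :=
    (ContinuousLinearMap.precomp ℝ (gradL : W0 Ω p →L[ℝ] _)).continuous.comp
      (pairing hpp).continuous
  have hs : Function.Surjective fun g : Lp (EuclideanSpace ℝ (Fin N))
      (ENNReal.ofReal p.conjExponent) (volume.restrict Ω) =>
        (pairing hpp g).comp (gradL : W0 Ω p →L[ℝ] _) := fun Λ =>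
    exists_dual_representation hΩ hp hpN hpp Λ
  exact hs.denseRange.separableSpace hc

instance : CompleteSpace (W0 Ω p) :=
  (testPairs Ω p).isClosed_topologicalClosure.completeSpace_coe

/-- Bounded sequences in `W_0^{1,p}` have weakly convergent subsequences. -/
theorem exists_subseq_weakly_converges (hΩ : Bornology.IsBounded Ω) (hp : 1 < p) (hpN : p < N)
    {u : ℕ → W0 Ω p} {B : ℝ} (hu : ∀ n, ‖u n‖ ≤ B) :
    ∃ φ : ℕ → ℕ, StrictMono φ ∧ ∃ v, ∀ Λ : StrongDual ℝ (W0 Ω p),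
      Tendsto (fun n => Λ (u (φ n))) atTop (𝓝 (Λ v)) := by
  have := separableSpace_dual (Ω := Ω) hΩ hp hpN
  refine (isUniformlyConvexFunctional_dirichlet hΩ hp hpN).exists_subseq_weak hu
    (M := 1 / p * B ^ p) fun n => ?_
  rw [dirichlet_eq hp]
  have : 0 ≤ p := by linarith
  gcongr
  exact (norm_gradL_le _).trans (hu n)

end DualSpace

/-! ### Rellich compactness by averaging over small balls -/

section Rellich

variable {N : ℕ} {Ω : Set (EuclideanSpace ℝ (Fin N))} {p : ℝ}

theorem IsTestFunction.enorm_shift_sub_le {φ : EuclideanSpace ℝ (Fin N) → ℝ} (h : IsTestFunction Ω φ)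
    (x y : EuclideanSpace ℝ (Fin N)) :
    ‖φ (x + y) - φ x‖ₑ ≤ ∫⁻ t in Ioc (0 : ℝ) 1, ‖gradient φ (x + t • y)‖ₑ * ‖y‖ₑ := by
  have hd : ∀ t ∈ uIcc (0 : ℝ) 1, HasDerivAt (fun t : ℝ => φ (x + t • y))
      (fderiv ℝ φ (x + t • y) y) t := fun t _ => by
    have h1 : HasDerivAt (fun t : ℝ => x + t • y) y t := by
      simpa using ((hasDerivAt_id t).smul_const y).const_add x
    exact (h.contDiff_one.differentiable one_ne_zero _).hasFDerivAt.comp_hasDerivAt t h1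
  have hc : Continuous fun t : ℝ => fderiv ℝ φ (x + t • y) y :=
    ((h.contDiff_one.continuous_fderiv one_ne_zero).comp
      (continuous_const.add (continuous_id.smul continuous_const))).clm_apply continuous_const
  have key := intervalIntegral.integral_eq_sub_of_hasDerivAt hd (hc.intervalIntegrable 0 1)
  rw [one_smul, zero_smul, add_zero, intervalIntegral.integral_of_le zero_le_one] at key
  rw [← key]
  refine (enorm_integral_le_lintegral_enorm _).trans (lintegral_mono fun t => ?_)
  have : ‖fderiv ℝ φ (x + t • y)‖ₑ = ‖gradient φ (x + t • y)‖ₑ := by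
    rw [← ofReal_norm, ← ofReal_norm, norm_gradient]
  rw [← this]
  exact ContinuousLinearMap.le_opENorm _ _

/-- The `L^1` modulus of continuity of a test function. -/
theorem IsTestFunction.lintegral_shift_le {φ : EuclideanSpace ℝ (Fin N) → ℝ}
    (h : IsTestFunction Ω φ) (y : EuclideanSpace ℝ (Fin N)) :
    ∫⁻ x, ‖φ (x + y) - φ x‖ₑ ≤ ‖y‖ₑ * ∫⁻ x, ‖gradient φ x‖ₑ := by
  have hc : Continuous fun z : EuclideanSpace ℝ (Fin N) × ℝ =>
      ‖gradient φ (z.1 + z.2 • y)‖ₑ * ‖y‖ₑ :=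
    (ENNReal.continuous_mul_const enorm_ne_top).comp (h.continuous_gradient.comp
      (continuous_fst.add (continuous_snd.smul continuous_const))).enorm
  calc ∫⁻ x, ‖φ (x + y) - φ x‖ₑ
      ≤ ∫⁻ x, ∫⁻ t in Ioc (0 : ℝ) 1, ‖gradient φ (x + t • y)‖ₑ * ‖y‖ₑ :=
        lintegral_mono fun x => h.enorm_shift_sub_le x y
    _ = ∫⁻ t in Ioc (0 : ℝ) 1, ∫⁻ x, ‖gradient φ (x + t • y)‖ₑ * ‖y‖ₑ :=
        lintegral_lintegral_swap hc.measurable.aemeasurable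
    _ = ∫⁻ t in Ioc (0 : ℝ) 1, ‖y‖ₑ * ∫⁻ x, ‖gradient φ x‖ₑ := by
        refine lintegral_congr fun t => ?_
        rw [lintegral_add_right_eq_self (fun x => ‖gradient φ x‖ₑ * ‖y‖ₑ) (t • y),
          lintegral_mul_const' _ _ enorm_ne_top, mul_comm]
    _ = _ := by simp

/-- The mean of φ over the ball about x differs from φ(x) by the mean of φ(x+y) - φ(x). Tonelli and
the L^1 shift estimate bound this error by ε∫|∇φ|. -/
theorem IsTestFunction.lintegral_enorm_le {φ : EuclideanSpace ℝ (Fin N) → ℝ}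
    (h : IsTestFunction Ω φ) (ε : ℝ) :
    volume (Metric.ball (0 : EuclideanSpace ℝ (Fin N)) ε) * ∫⁻ x in Ω, ‖φ x‖ₑ ≤
      (∫⁻ x in Ω, ‖∫ y in Metric.ball (0 : EuclideanSpace ℝ (Fin N)) ε, φ (x + y)‖ₑ) +
        volume (Metric.ball (0 : EuclideanSpace ℝ (Fin N)) ε) *
          (ENNReal.ofReal ε * ∫⁻ x, ‖gradient φ x‖ₑ) := by
  set S := Metric.ball (0 : EuclideanSpace ℝ (Fin N)) ε with hS
  have hφc : Continuous φ := h.contDiff_one.continuous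
  have hSfin : volume S ≠ ⊤ := measure_ball_lt_top.ne
  have hφi : Integrable φ := hφc.integrable_of_hasCompactSupport h.compact
  have hpt : ∀ x, volume S * ‖φ x‖ₑ ≤ ‖∫ y in S, φ (x + y)‖ₑ +
      ∫⁻ y in S, ‖φ (x + y) - φ x‖ₑ := fun x => by
    have i1 : IntegrableOn (fun y => φ (x + y)) S :=
      (hφi.comp_add_left x).integrableOn
    have i2 : IntegrableOn (fun _ => φ x) S := integrableOn_const hSfin
    have e : ∫ y in S, φ x = (∫ y in S, φ (x + y)) - ∫ y in S, (φ (x + y) - φ x) := by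
      rw [integral_sub i1 i2]; ring
    have e2 : ‖∫ y in S, φ x‖ₑ = volume S * ‖φ x‖ₑ := by
      rw [setIntegral_const, enorm_smul, measureReal_def, Real.enorm_eq_ofReal ENNReal.toReal_nonneg,
        ENNReal.ofReal_toReal hSfin]
    rw [← e2, e]
    exact enorm_sub_le.trans (by gcongr; exact enorm_integral_le_lintegral_enorm _)
  have hc2 : Continuous fun z : EuclideanSpace ℝ (Fin N) × EuclideanSpace ℝ (Fin N) =>
      ‖φ (z.1 + z.2) - φ z.1‖ₑ :=
    ((hφc.comp (continuous_fst.add continuous_snd)).sub (hφc.comp continuous_fst)).enorm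
  rw [← lintegral_const_mul' _ _ hSfin]
  refine (lintegral_mono hpt).trans ?_
  rw [lintegral_add_right']
  swap
  · exact (hc2.measurable.lintegral_prod_right' (ν := volume.restrict S)).aemeasurable
  refine add_le_add_right ?_ _
  calc ∫⁻ x in Ω, ∫⁻ y in S, ‖φ (x + y) - φ x‖ₑ
      ≤ ∫⁻ x, ∫⁻ y in S, ‖φ (x + y) - φ x‖ₑ := setLIntegral_le_lintegral _ _
    _ = ∫⁻ y in S, ∫⁻ x, ‖φ (x + y) - φ x‖ₑ :=
        lintegral_lintegral_swap hc2.measurable.aemeasurable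
    _ ≤ ∫⁻ y in S, ENNReal.ofReal ε * ∫⁻ x, ‖gradient φ x‖ₑ := by
        refine setLIntegral_mono' measurableSet_ball fun y hy => ?_
        refine (h.lintegral_shift_le y).trans (mul_le_mul_left ?_ _)
        rw [← ofReal_norm]
        exact ENNReal.ofReal_le_ofReal (mem_ball_zero_iff.1 hy).le
    _ = _ := by rw [setLIntegral_const, mul_comm]

theorem IsTestFunction.eq_zero {φ : EuclideanSpace ℝ (Fin N) → ℝ}
    (h : IsTestFunction Ω φ) {x : EuclideanSpace ℝ (Fin N)} (hx : x ∉ Ω) : φ x = 0 :=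
  image_eq_zero_of_notMem_tsupport fun hx' => hx (h.supp hx')

/-- Rewrites the average about x as a pairing over Ω with a fixed indicator, which weak convergence
can see; φ vanishes off Ω. -/
theorem IsTestFunction.integral_ball_eq {φ : EuclideanSpace ℝ (Fin N) → ℝ}
    (h : IsTestFunction Ω φ) (ε : ℝ) (x : EuclideanSpace ℝ (Fin N)) :
    ∫ y in Metric.ball (0 : EuclideanSpace ℝ (Fin N)) ε, φ (x + y) =
      ∫ z in Ω, (Metric.ball x ε).indicator φ z := by
  rw [← integral_indicator measurableSet_ball, setIntegral_eq_integral_of_forall_compl_eq_zero]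
  · rw [← integral_add_left_eq_self ((Metric.ball x ε).indicator φ) x]
    refine integral_congr_ae (Eventually.of_forall fun y => ?_)
    by_cases hy : ‖y‖ < ε <;> simp [indicator, hy]
  · intro z hz
    simp [h.eq_zero hz]

variable [Fact (1 ≤ ENNReal.ofReal p)]

/-- At a fixed radius the ball averages tend to 0 pointwise by weak convergence and are uniformly
bounded, so dominated convergence applies. The averaging error is O(ε) uniformly in n. -/
theorem IsTestRep.tendsto_lintegral (hΩ : Bornology.IsBounded Ω) (hp : 1 < p)
    {w : ℕ → W0 Ω p} {φ : ℕ → EuclideanSpace ℝ (Fin N) → ℝ} (hw : ∀ n, IsTestRep (w n) (φ n))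
    {B : ℝ} (hB : ∀ n, ‖w n‖ ≤ B)
    (hweak : ∀ Λ : StrongDual ℝ (W0 Ω p), Tendsto (fun n => Λ (w n)) atTop (𝓝 0)) :
    Tendsto (fun n => ∫⁻ x in Ω, ‖φ n x‖ₑ) atTop (𝓝 0) := by
  have hfin : IsFiniteMeasure (volume.restrict Ω) := ⟨by
    rw [Measure.restrict_apply_univ]; exact hΩ.measure_lt_top⟩
  have hp1 : 1 ≤ ENNReal.ofReal p := one_le_ofReal hp.le
  obtain ⟨K, hK, hKle⟩ : ∃ K : ℝ≥0∞, K ≠ ⊤ ∧ ∀ {V : Type} [NormedAddCommGroup V]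
      (f : Lp V (ENNReal.ofReal p) (volume.restrict Ω)), ‖f‖ ≤ B →
        eLpNorm f 1 (volume.restrict Ω) ≤ K := by
    refine ⟨ENNReal.ofReal B * volume.restrict Ω univ ^ (1 / (1 : ℝ≥0∞).toReal -
      1 / (ENNReal.ofReal p).toReal), ?_, fun f hf => ?_⟩
    · refine ENNReal.mul_ne_top ENNReal.ofReal_ne_top (ENNReal.rpow_ne_top_of_nonneg ?_
        (measure_ne_top _ _))
      rw [ENNReal.toReal_ofReal (by linarith), ENNReal.toReal_one, sub_nonneg]
      exact one_div_le_one_div_of_le one_pos hp.le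
    · refine (eLpNorm_le_eLpNorm_mul_rpow_measure_univ hp1 (Lp.aestronglyMeasurable f)).trans
        (mul_le_mul_left ?_ _)
      rw [← ENNReal.ofReal_toReal (Lp.memLp f).eLpNorm_ne_top, ← Lp.norm_def]
      exact ENNReal.ofReal_le_ofReal hf
  have hφ1 : ∀ n, ∫⁻ x in Ω, ‖φ n x‖ₑ ≤ K := fun n => by
    rw [← eLpNorm_one_eq_lintegral_enorm, ← eLpNorm_congr_ae (hw n).fn_ae]
    exact hKle (fnL (w n)) ((norm_fnL_le _).trans (hB n))
  have hg1 : ∀ n, ∫⁻ x, ‖gradient (φ n) x‖ₑ ≤ K := fun n => by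
    rw [← eLpNorm_one_eq_lintegral_enorm, ← eLpNorm_restrict_eq_of_support_subset
      ((support_gradient_subset (φ n)).trans (hw n).test.supp),
      ← eLpNorm_congr_ae (hw n).grad_ae]
    exact hKle (gradL (w n)) ((norm_gradL_le _).trans (hB n))
  have hI : ∀ ε : ℝ, Tendsto (fun n => ∫⁻ x in Ω,
      ‖∫ y in Metric.ball (0 : EuclideanSpace ℝ (Fin N)) ε, φ n (x + y)‖ₑ) atTop (𝓝 0) := by
    intro ε
    have hz : ∫⁻ _ in Ω, (0 : ℝ≥0∞) = 0 := by simp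
    rw [← hz]
    refine tendsto_lintegral_of_dominated_convergence' (fun _ => K) (fun n => ?_) (fun n => ?_)
      (by simpa using ENNReal.mul_ne_top hK (measure_ne_top (volume.restrict Ω) univ))
      (Eventually.of_forall fun x => ?_)
    · have hc : Continuous (Function.uncurry fun x y : EuclideanSpace ℝ (Fin N) => φ n (x + y)) :=
        (hw n).test.contDiff_one.continuous.comp (continuous_fst.add continuous_snd)
      exact (hc.stronglyMeasurable.integral_prod_right
        (f := fun x y : EuclideanSpace ℝ (Fin N) => φ n (x + y))).enorm.aemeasurable
    · refine Eventually.of_forall fun x => ?_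
      simp only
      rw [(hw n).test.integral_ball_eq]
      refine (enorm_integral_le_lintegral_enorm _).trans ((lintegral_mono fun z => ?_).trans
        (hφ1 n))
      exact enorm_indicator_le_enorm_self _ _
    · have hpp := Real.HolderConjugate.conjExponent hp
      have hmem : MemLp ((Metric.ball x ε).indicator fun _ => (1 : ℝ))
          (ENNReal.ofReal p.conjExponent) (volume.restrict Ω) :=
        memLp_indicator_const _ measurableSet_ball _ (Or.inr (measure_ne_top _ _))
      have h1 := hweak ((pairing hpp (hmem.toLp _)).comp fnL)
      have h2 : ∀ n, (pairing hpp (hmem.toLp _)).comp fnL (w n) =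
          ∫ y in Metric.ball (0 : EuclideanSpace ℝ (Fin N)) ε, φ n (x + y) := fun n => by
        rw [(hw n).test.integral_ball_eq, ContinuousLinearMap.comp_apply, pairing_apply]
        refine integral_congr_ae ?_
        filter_upwards [hmem.coeFn_toLp, (hw n).fn_ae] with z h3 h4
        rw [h3, fnL_coe, h4]
        by_cases hz : z ∈ Metric.ball x ε <;> simp [hz]
      simp_rw [h2] at h1
      simpa using h1.enorm
  rw [ENNReal.tendsto_nhds_zero]
  intro δ hδ
  by_cases hδ' : δ = ⊤
  · simp [hδ']
  obtain ⟨ε, hε, hεδ⟩ : ∃ ε : ℝ, 0 < ε ∧ ENNReal.ofReal ε * K ≤ δ / 2 := by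
    have ht : Tendsto (fun ε : ℝ => ENNReal.ofReal ε * K) (𝓝[>] 0) (𝓝 0) := by
      have h1 : Tendsto (fun ε : ℝ => ENNReal.ofReal ε) (𝓝[>] 0) (𝓝 (ENNReal.ofReal 0)) :=
        (ENNReal.continuous_ofReal.tendsto 0).mono_left nhdsWithin_le_nhds
      have h2 := ENNReal.Tendsto.mul_const (b := K) h1 (Or.inr hK)
      rwa [ENNReal.ofReal_zero, zero_mul] at h2
    have h3 := (ENNReal.tendsto_nhds_zero.1 ht (δ / 2) (ENNReal.half_pos hδ.ne')).and
      self_mem_nhdsWithin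
    obtain ⟨ε, h4, h5⟩ := h3.exists
    exact ⟨ε, h5, h4⟩
  set m := volume (Metric.ball (0 : EuclideanSpace ℝ (Fin N)) ε) with hm
  have hm0 : m ≠ 0 := (Metric.measure_ball_pos _ _ hε).ne'
  have hmt : m ≠ ⊤ := measure_ball_lt_top.ne
  filter_upwards [ENNReal.tendsto_nhds_zero.1 (hI ε) (m * (δ / 2))
    (ENNReal.mul_pos hm0 (ENNReal.half_pos hδ.ne').ne')] with n hn
  refine (ENNReal.mul_le_mul_iff_right hm0 hmt).1 (((hw n).test.lintegral_enorm_le ε).trans ?_)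
  calc _ ≤ m * (δ / 2) + m * (δ / 2) := by
        refine add_le_add hn (mul_le_mul_right (le_trans ?_ hεδ) _)
        exact mul_le_mul_right (hg1 n) _
    _ = m * δ := by rw [← mul_add, ENNReal.add_halves]

/-- A form of the Rellich theorem: weakly null sequences have a subsequence that
converges to zero almost everywhere. -/
theorem exists_subseq_ae_tendsto_zero (hΩ : Bornology.IsBounded Ω) (hp : 1 < p)
    {w : ℕ → W0 Ω p} {B : ℝ} (hB : ∀ n, ‖w n‖ ≤ B)
    (hweak : ∀ Λ : StrongDual ℝ (W0 Ω p), Tendsto (fun n => Λ (w n)) atTop (𝓝 0)) :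
    ∃ ns : ℕ → ℕ, StrictMono ns ∧
      ∀ᵐ x ∂(volume.restrict Ω), Tendsto (fun n => (w (ns n)).fn x) atTop (𝓝 0) := by
  -- Each `w n` is replaced by a test function at distance below 1/(n+1), which preserves
  -- boundedness and weak convergence to 0.
  choose z φ hz hwz using fun n : ℕ =>
    exists_test_dist_lt (w n) (ε := 1 / ((n : ℝ) + 1)) (by positivity)
  have hdiff : Tendsto (fun n => w n - z n) atTop (𝓝 0) :=
    squeeze_zero_norm (fun n => (hwz n).le) tendsto_one_div_add_atTop_nhds_zero_nat
  have hzB : ∀ n, ‖z n‖ ≤ B + 1 := fun n => by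
    have h1 : 1 / ((n : ℝ) + 1) ≤ 1 := by
      rw [div_le_one (by positivity)]; linarith [n.cast_nonneg (α := ℝ)]
    have h2 := norm_sub_le (w n) (w n - z n)
    rw [sub_sub_cancel] at h2
    linarith [hwz n, hB n]
  have hzweak : ∀ Λ : StrongDual ℝ (W0 Ω p), Tendsto (fun n => Λ (z n)) atTop (𝓝 0) := fun Λ => by
    have h1 := (hweak Λ).sub ((Λ.continuous.tendsto 0).comp hdiff)
    simpa using h1
  have h1 := IsTestRep.tendsto_lintegral hΩ hp hz hzB hzweak
  have h2 : TendstoInMeasure (volume.restrict Ω) φ atTop (fun _ => (0 : ℝ)) := by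
    refine tendstoInMeasure_of_tendsto_eLpNorm one_ne_zero
      (fun n => (hz n).test.contDiff_one.continuous.aestronglyMeasurable)
      aestronglyMeasurable_const ?_
    refine h1.congr fun n => ?_
    rw [eLpNorm_one_eq_lintegral_enorm]
    simp
  obtain ⟨ns, hns, hae⟩ := h2.exists_seq_tendsto_ae
  obtain ⟨ms, hms, hae2⟩ := (tendstoInMeasure_of_tendsto_Lp
    ((fnL.continuous.tendsto 0).comp (hdiff.comp hns.tendsto_atTop))).exists_seq_tendsto_ae
  refine ⟨ns ∘ ms, hns.comp hms, ?_⟩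
  have h0 : ∀ᵐ x ∂(volume.restrict Ω), fnL (0 : W0 Ω p) x = 0 := by
    rw [map_zero]
    exact Lp.coeFn_zero _ _ _
  filter_upwards [hae, hae2, h0, ae_all_iff.2 fun n => (hz n).fn_ae,
    ae_all_iff.2 fun n => W0.sub_fn (w n) (z n)] with x h3 h4 h5 h6 h7
  rw [h5] at h4
  have h8 := h4.add (h3.comp hms.tendsto_atTop)
  rw [add_zero] at h8
  refine h8.congr fun n => ?_
  have h9 := h7 (ns (ms n))
  simp only [Function.comp_apply, fnL_coe]
  rw [h9, h6]
  ring

end Rellich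

/-! ### Truncation by arctan inside W_0^{1,p} -/

section Truncation

theorem abs_arctan_sub_le (a b : ℝ) : |Real.arctan a - Real.arctan b| ≤ |a - b| := by
  have key := convex_univ.norm_image_sub_le_of_norm_hasDerivWithin_le (f := Real.arctan)
    (f' := fun x => 1 / (1 + x ^ 2)) (C := 1) (s := univ) (x := b) (y := a)
    (fun x _ => (Real.hasDerivAt_arctan x).hasDerivWithinAt) (fun x _ => ?_) trivial trivial
  · simpa using key
  · rw [Real.norm_eq_abs, abs_of_nonneg (by positivity), div_le_one (by positivity)]
    nlinarith [sq_nonneg x]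

theorem abs_arctan_le (a : ℝ) : |Real.arctan a| ≤ |a| := by
  simpa using abs_arctan_sub_le a 0

theorem one_div_one_add_sq_le (a : ℝ) : 1 / (1 + a ^ 2) ≤ 1 := by
  rw [div_le_one (by positivity)]; nlinarith [sq_nonneg a]

/-- The s-th power of the difference is dominated by 2^s|Y|^s up to 2^s|y n|^s, whose integral tends
to 0. -/
theorem tendsto_Lp_of_ae_of_norm_sub_le {α V U : Type*} [MeasurableSpace α] {μ : Measure α}
    [NormedAddCommGroup V] [NormedAddCommGroup U] {s : ℝ} (hs : 0 < s)
    [Fact (1 ≤ ENNReal.ofReal s)] {z : ℕ → Lp V (ENNReal.ofReal s) μ}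
    {z₀ : Lp V (ENNReal.ofReal s) μ} {Y : Lp U (ENNReal.ofReal s) μ}
    {y : ℕ → Lp U (ENNReal.ofReal s) μ} (hy : Tendsto y atTop (𝓝 0))
    (hae : ∀ᵐ x ∂μ, Tendsto (fun n => z n x) atTop (𝓝 (z₀ x)))
    (hle : ∀ n, ∀ᵐ x ∂μ, ‖z n x - z₀ x‖ ≤ ‖Y x‖ + ‖y n x‖) : Tendsto z atTop (𝓝 z₀) := by
  have hsub : ∀ n, ∀ᵐ x ∂μ, (z n - z₀) x = z n x - z₀ x := fun n => by
    filter_upwards [Lp.coeFn_sub (z n) z₀] with x hx using hx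
  have hi : ∀ {W : Type _} [NormedAddCommGroup W] (f : Lp W (ENNReal.ofReal s) μ),
      Integrable (fun x => ‖f x‖ ^ s) μ := fun f => integrable_norm_rpow_ofReal hs (Lp.memLp f)
  have h1 : Tendsto (fun n => ∫ x, ‖(‖(z n - z₀) x‖ ^ s)‖ ∂μ) atTop (𝓝 0) := by
    refine tendsto_integral_norm_zero (fun n => (hi _).1) ?_ fun ε hε => ?_
    · filter_upwards [hae, ae_all_iff.2 hsub] with x h2 h3
      simp_rw [h3]
      have h4 := ((h2.sub_const (z₀ x)).norm).rpow_const (p := s) (Or.inr hs.le)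
      simpa [Real.zero_rpow hs.ne'] using h4
    · refine ⟨fun x => 2 ^ s * ‖Y x‖ ^ s, fun n x => 2 ^ s * ‖y n x‖ ^ s,
        (integrable_norm_rpow_ofReal hs (Lp.memLp Y)).const_mul _, fun n =>
        (integrable_norm_rpow_ofReal hs (Lp.memLp (y n))).const_mul _,
        fun n => Eventually.of_forall fun x => by positivity, ?_, fun n => ?_⟩
      · have : Tendsto (fun n => ∫ x, 2 ^ s * ‖y n x‖ ^ s ∂μ) atTop (𝓝 0) := by
          simp_rw [integral_const_mul, integral_norm_rpow_eq hs]
          have := ((hy.norm.rpow_const (p := s) (Or.inr hs.le))).const_mul (2 ^ s : ℝ)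
          simpa [Real.zero_rpow hs.ne'] using this
        exact ((tendsto_order.1 this).2 ε hε).mono fun _ => le_of_lt
      · filter_upwards [hle n, hsub n] with x h2 h3
        rw [h3, Real.norm_eq_abs, abs_of_nonneg (by positivity), ← mul_add]
        exact (Real.rpow_le_rpow (norm_nonneg _) h2 hs.le).trans
          (add_rpow_le_two_rpow (norm_nonneg _) (norm_nonneg _) hs.le)
  have h2 : ∀ n, ∫ x, ‖(‖(z n - z₀) x‖ ^ s)‖ ∂μ = ‖z n - z₀‖ ^ s := fun n => by
    rw [← integral_norm_rpow_eq hs]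
    refine integral_congr_ae (Eventually.of_forall fun x => ?_)
    exact abs_of_nonneg (by positivity)
  simp_rw [h2] at h1
  have h3 := h1.rpow_const (p := s⁻¹) (Or.inr (by positivity))
  rw [Real.zero_rpow (by positivity)] at h3
  rw [tendsto_iff_norm_sub_tendsto_zero]
  refine h3.congr fun n => ?_
  rw [← Real.rpow_mul (norm_nonneg _), mul_inv_cancel₀ hs.ne', Real.rpow_one]

variable {N : ℕ} {Ω : Set (EuclideanSpace ℝ (Fin N))} {p : ℝ}

theorem gradient_arctan {φ : EuclideanSpace ℝ (Fin N) → ℝ} (h : IsTestFunction Ω φ)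
    (x : EuclideanSpace ℝ (Fin N)) :
    gradient (fun y => Real.arctan (φ y)) x = (1 / (1 + φ x ^ 2)) • gradient φ x := by
  have h1 := (h.contDiff_one.differentiable one_ne_zero x).hasFDerivAt.arctan
  rw [gradient, h1.fderiv, map_smul]
  rfl

theorem IsTestFunction.arctan {φ : EuclideanSpace ℝ (Fin N) → ℝ} (h : IsTestFunction Ω φ) :
    IsTestFunction Ω fun x => Real.arctan (φ x) where
  smooth := h.smooth.arctan
  compact := h.compact.comp_left Real.arctan_zero
  supp := (closure_mono (Function.support_comp_subset Real.arctan_zero φ)).trans h.supp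

variable [Fact (1 ≤ ENNReal.ofReal p)]

theorem tendsto_fnL_zero {w : ℕ → W0 Ω p} (h : Tendsto w atTop (𝓝 0)) :
    Tendsto (fun n => fnL (w n)) atTop (𝓝 0) :=
  squeeze_zero_norm (fun n => norm_fnL_le (w n)) (tendsto_zero_iff_norm_tendsto_zero.1 h)

theorem tendsto_gradL_zero {w : ℕ → W0 Ω p} (h : Tendsto w atTop (𝓝 0)) :
    Tendsto (fun n => gradL (w n)) atTop (𝓝 0) :=
  squeeze_zero_norm (fun n => norm_gradL_le (w n)) (tendsto_zero_iff_norm_tendsto_zero.1 h)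

theorem exists_test_seq_ae (w : W0 Ω p) :
    ∃ (u : ℕ → W0 Ω p) (φ : ℕ → EuclideanSpace ℝ (Fin N) → ℝ), (∀ n, IsTestRep (u n) (φ n)) ∧
      Tendsto u atTop (𝓝 w) ∧
      (∀ᵐ x ∂(volume.restrict Ω), Tendsto (fun n => (u n).fn x) atTop (𝓝 (w.fn x))) ∧
      ∀ᵐ x ∂(volume.restrict Ω), Tendsto (fun n => (u n).grad x) atTop (𝓝 (w.grad x)) := by
  obtain ⟨u, φ, hu, hlim⟩ := exists_test_seq w
  obtain ⟨ns, hns, hae1⟩ := (tendstoInMeasure_of_tendsto_Lp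
    ((fnL.continuous.tendsto w).comp hlim)).exists_seq_tendsto_ae
  obtain ⟨ms, hms, hae2⟩ := (tendstoInMeasure_of_tendsto_Lp
    ((gradL.continuous.tendsto w).comp (hlim.comp hns.tendsto_atTop))).exists_seq_tendsto_ae
  refine ⟨fun n => u (ns (ms n)), fun n => φ (ns (ms n)), fun n => hu _,
    hlim.comp (hns.comp hms).tendsto_atTop, ?_, hae2⟩
  filter_upwards [hae1] with x hx using hx.comp hms.tendsto_atTop

/-- The chain rule for `arctan` in `W_0^{1,p}`. -/
theorem exists_arctan (hp : 1 < p) (w : W0 Ω p) : ∃ z : W0 Ω p,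
    z.fn =ᵐ[volume.restrict Ω] (fun x => Real.arctan (w.fn x)) ∧
    z.grad =ᵐ[volume.restrict Ω] (fun x => (1 / (1 + w.fn x ^ 2)) • w.grad x) := by
  have hp0 : 0 < p := by linarith
  have hm1 : MemLp (fun x => Real.arctan (w.fn x)) (ENNReal.ofReal p) (volume.restrict Ω) :=
    w.memLp_fn.of_le (Real.continuous_arctan.comp_aestronglyMeasurable w.memLp_fn.1)
      (Eventually.of_forall fun x => abs_arctan_le _)
  have hcont : Continuous fun t : ℝ => 1 / (1 + t ^ 2) :=
    continuous_const.div (continuous_const.add (continuous_pow 2)) fun t => by positivity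
  have hm2 : MemLp (fun x => (1 / (1 + w.fn x ^ 2)) • w.grad x) (ENNReal.ofReal p)
      (volume.restrict Ω) := by
    have hm : AEStronglyMeasurable (fun x => (1 / (1 + w.fn x ^ 2)) • w.grad x)
        (volume.restrict Ω) :=
      (hcont.comp_aestronglyMeasurable w.memLp_fn.1).smul w.memLp_grad.1
    refine w.memLp_grad.of_le hm (Eventually.of_forall fun x => ?_)
    rw [norm_smul, Real.norm_eq_abs, abs_of_nonneg (by positivity)]
    exact mul_le_of_le_one_left (norm_nonneg _) (one_div_one_add_sq_le _)
  obtain ⟨u, φ, hrep, hlim, hfn, hgrad⟩ := exists_test_seq_ae w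
  choose z hz using fun n => (hrep n).test.arctan.exists_rep (p := p)
  have hdiff : Tendsto (fun n => u n - w) atTop (𝓝 0) := by
    have h := hlim.sub_const w
    rwa [sub_self] at h
  have hzfn : ∀ n, ∀ᵐ x ∂(volume.restrict Ω), (z n).fn x = Real.arctan ((u n).fn x) := fun n => by
    filter_upwards [(hz n).fn_ae, (hrep n).fn_ae] with x h1 h2
    rw [h1, h2]
  have hzgrad : ∀ n, ∀ᵐ x ∂(volume.restrict Ω),
      (z n).grad x = (1 / (1 + (u n).fn x ^ 2)) • (u n).grad x := fun n => by
    filter_upwards [(hz n).grad_ae, (hrep n).fn_ae, (hrep n).grad_ae] with x h1 h2 h3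
    rw [h1, h2, h3, gradient_arctan (hrep n).test]
  have hd1 : Tendsto (fun n => fnL (u n - w)) atTop (𝓝 0) :=
    tendsto_fnL_zero hdiff
  have hd2 : Tendsto (fun n => gradL (u n - w)) atTop (𝓝 0) :=
    tendsto_gradL_zero hdiff
  have t1 : Tendsto (fun n => fnL (z n)) atTop (𝓝 (hm1.toLp _)) := by
    refine tendsto_Lp_of_ae_of_norm_sub_le hp0 (Y := fnL w) hd1 ?_ ?_
    · filter_upwards [hfn, ae_all_iff.2 hzfn, hm1.coeFn_toLp] with x h1 h2 h3
      rw [h3]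
      simp only [fnL_coe, h2]
      exact (Real.continuous_arctan.tendsto _).comp h1
    · intro n
      filter_upwards [hzfn n, hm1.coeFn_toLp, W0.sub_fn (u n) w] with x h1 h2 h3
      rw [h2, fnL_coe, fnL_coe, fnL_coe, h1, h3]
      exact (abs_arctan_sub_le _ _).trans (le_add_of_nonneg_left (norm_nonneg _))
  have t2 : Tendsto (fun n => gradL (z n)) atTop (𝓝 (hm2.toLp _)) := by
    refine tendsto_Lp_of_ae_of_norm_sub_le hp0 (Y := gradL w) hd2 ?_ ?_
    · filter_upwards [hfn, hgrad, ae_all_iff.2 hzgrad, hm2.coeFn_toLp] with x h1 h2 h3 h4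
      rw [h4]
      simp only [gradL_coe, h3]
      exact ((hcont.tendsto _).comp h1).smul h2
    · intro n
      filter_upwards [hzgrad n, hm2.coeFn_toLp, W0.sub_grad (u n) w] with x h1 h2 h3
      rw [h2, gradL_coe, gradL_coe, gradL_coe, h1, h3]
      set a := 1 / (1 + (u n).fn x ^ 2) with ha
      set b := 1 / (1 + w.fn x ^ 2) with hb
      have ha0 : 0 ≤ a := by positivity
      have hb0 : 0 ≤ b := by positivity
      have ha1 : a ≤ 1 := one_div_one_add_sq_le _
      have hb1 : b ≤ 1 := one_div_one_add_sq_le _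
      -- The first piece is bounded by the fixed function |∇w|, the second by |∇(u n - w)|, which
      -- tends to 0 in L^p.
      have e : a • (u n).grad x - b • w.grad x =
          (a - b) • w.grad x + a • ((u n).grad x - w.grad x) := by
        rw [smul_sub, sub_smul]; abel
      rw [e]
      refine (norm_add_le _ _).trans (add_le_add ?_ ?_)
      · rw [norm_smul]
        exact mul_le_of_le_one_left (norm_nonneg _) (by
          rw [Real.norm_eq_abs, abs_le]; constructor <;> linarith)
      · rw [norm_smul, Real.norm_eq_abs, abs_of_nonneg ha0]
        exact mul_le_of_le_one_left (norm_nonneg _) ha1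
  have hmem : (hm1.toLp _, hm2.toLp _) ∈ (testPairs Ω p).topologicalClosure :=
    (testPairs Ω p).isClosed_topologicalClosure.mem_of_tendsto (t1.prodMk_nhds t2)
      (Eventually.of_forall fun n => (z n).2)
  exact ⟨⟨_, hmem⟩, hm1.coeFn_toLp, hm2.coeFn_toLp⟩

end Truncation

/-! ### Carathéodory functions and growth calculus -/

section Caratheodory

variable {α : Type*} [MeasurableSpace α] {μ : Measure α} {f : α → ℝ → ℝ}

/-- For simple functions the composition is a finite sum of indicators times f(·, c); continuity in
the second variable passes to the limit. -/
theorem aemeasurable_caratheodory_comp (hm : ∀ t, AEMeasurable (fun x => f x t) μ)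
    (hc : ∀ᵐ x ∂μ, Continuous (f x)) {w : α → ℝ} (hw : AEMeasurable w μ) :
    AEMeasurable (fun x => f x (w x)) μ := by
  have hsm : StronglyMeasurable (hw.mk w) := hw.measurable_mk.stronglyMeasurable
  have key : AEMeasurable (fun x => f x (hw.mk w x)) μ := by
    refine aemeasurable_of_tendsto_metrizable_ae atTop
      (f := fun n x => f x (hsm.approx n x)) (fun n => ?_) ?_
    · have e : (fun x => f x (hsm.approx n x)) = fun x => ∑ c ∈ (hsm.approx n).range,
          ((hsm.approx n) ⁻¹' {c}).indicator (fun x => f x c) x := by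
        funext x
        rw [Finset.sum_eq_single (hsm.approx n x)]
        · rw [indicator_of_mem (by simp)]
        · intro c _ hc
          rw [indicator_of_notMem (by simpa using hc.symm)]
        · intro h
          exact absurd (SimpleFunc.mem_range_self _ x) h
      rw [e]
      exact Finset.aemeasurable_fun_sum _ fun c _ =>
        (hm c).indicator ((hsm.approx n).measurableSet_fiber c)
    · filter_upwards [hc] with x hx
      exact (hx.tendsto _).comp (hsm.tendsto_approx x)
  refine key.congr ?_
  filter_upwards [hw.ae_eq_mk] with x hx
  rw [hx]

/-- The substitution τ = w(x) t replaces the variable endpoint by the fixed interval (0,1], where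
measurability of partial integrals applies. -/
theorem aemeasurable_primitive_comp [SFinite μ] (hm : ∀ t, AEMeasurable (fun x => f x t) μ)
    (hc : ∀ᵐ x ∂μ, Continuous (f x)) {w : α → ℝ} (hw : AEMeasurable w μ) :
    AEMeasurable (fun x => ∫ τ in (0 : ℝ)..(w x), f x τ) μ := by
  have h1 : AEMeasurable (fun z : α × ℝ => f z.1 (w z.1 * z.2))
      (μ.prod (volume.restrict (Ioc (0 : ℝ) 1))) :=
    aemeasurable_caratheodory_comp (f := fun z : α × ℝ => f z.1)
      (fun t => (hm t).comp_fst) (Measure.quasiMeasurePreserving_fst.ae hc)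
      (hw.comp_fst.mul measurable_snd.aemeasurable)
  have h2 := h1.aestronglyMeasurable.integral_prod_right'
  refine (hw.mul h2.aemeasurable).congr (Eventually.of_forall fun x => ?_)
  have := intervalIntegral.mul_integral_comp_mul_left (a := 0) (b := 1) (f := f x) (w x)
  rw [mul_zero, mul_one, intervalIntegral.integral_of_le zero_le_one] at this
  exact this

theorem IsPotential.add {V : Type*} [NormedAddCommGroup V] [InnerProductSpace ℝ V] {s : ℝ}
    {H₁ H₂ : α → V → ℝ} {h₁ h₂ : α → V → V} (a : IsPotential μ s H₁ h₁)
    (b : IsPotential μ s H₂ h₂) :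
    IsPotential μ s (fun x v => H₁ x v + H₂ x v) (fun x v => h₁ x v + h₂ x v) where
  bound := by
    obtain ⟨C, hC, h⟩ := a.bound
    obtain ⟨C', hC', h'⟩ := b.bound
    refine ⟨C + C', by positivity, ?_⟩
    filter_upwards [h, h'] with x hx hx' v
    rw [add_mul]
    exact (norm_add_le _ _).trans (add_le_add (hx v) (hx' v))
  grad := by
    filter_upwards [a.grad, b.grad] with x hx hx' v
    rw [map_add]
    exact (hx v).add (hx' v)
  zero := by
    filter_upwards [a.zero, b.zero] with x hx hx'
    rw [hx, hx', add_zero]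
  meas w hw := (a.meas w hw).add (b.meas w hw)
  meas_grad w hw := (a.meas_grad w hw).add (b.meas_grad w hw)

theorem IsPotential.const_mul {V : Type*} [NormedAddCommGroup V] [InnerProductSpace ℝ V] {s : ℝ}
    {H : α → V → ℝ} {h : α → V → V} (a : IsPotential μ s H h) (c : ℝ) :
    IsPotential μ s (fun x v => c * H x v) (fun x v => c • h x v) where
  bound := by
    obtain ⟨C, hC, h⟩ := a.bound
    refine ⟨|c| * C, by positivity, ?_⟩
    filter_upwards [h] with x hx v
    rw [norm_smul, Real.norm_eq_abs, mul_assoc]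
    exact mul_le_mul_of_nonneg_left (hx v) (abs_nonneg _)
  grad := by
    filter_upwards [a.grad] with x hx v
    rw [map_smul]
    exact (hx v).const_mul c
  zero := by
    filter_upwards [a.zero] with x hx
    rw [hx, mul_zero]
  meas w hw := (a.meas w hw).const_mul c
  meas_grad w hw := (a.meas_grad w hw).const_smul c

theorem rpow_le_one_add_rpow {t a b : ℝ} (ht : 0 ≤ t) (ha : 0 ≤ a) (hab : a ≤ b) :
    t ^ a ≤ 1 + t ^ b := by
  rcases le_total t 1 with h | h
  · have h1 := Real.rpow_le_one ht h ha
    have h2 : 0 ≤ t ^ b := by positivity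
    linarith
  · have := Real.rpow_le_rpow_of_exponent_le h hab
    linarith

/-- Places the q-Laplacian under exponent p and the subcritical f under exponent p*, so that each
side of the equation is a single potential. -/
theorem IsPotential.mono {V : Type*} [NormedAddCommGroup V] [InnerProductSpace ℝ V] {q s : ℝ}
    {H : α → V → ℝ} {h : α → V → V} (a : IsPotential μ q H h) (hq : 1 ≤ q) (hqs : q ≤ s) :
    IsPotential μ s H h where
  bound := by
    obtain ⟨C, hC, h⟩ := a.bound
    refine ⟨2 * C, by positivity, ?_⟩
    filter_upwards [h] with x hx v
    refine (hx v).trans ?_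
    have h1 := rpow_le_one_add_rpow (norm_nonneg v) (by linarith : 0 ≤ q - 1)
      (by linarith : q - 1 ≤ s - 1)
    have h2 : 0 ≤ ‖v‖ ^ (s - 1) := by positivity
    nlinarith
  grad := a.grad
  zero := a.zero
  meas := a.meas
  meas_grad := a.meas_grad

/-- Beyond T = ε^{-1/(b-a)} the power b dominates with factor ε; below it T^a suffices. -/
theorem exists_rpow_le_mul_rpow_add {a b ε : ℝ} (ha : 0 ≤ a) (hab : a < b) (hε : 0 < ε) :
    ∃ C : ℝ, 0 ≤ C ∧ ∀ t : ℝ, 0 ≤ t → t ^ a ≤ ε * t ^ b + C := by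
  set T : ℝ := ε⁻¹ ^ (b - a)⁻¹ with hT
  have hT0 : 0 < T := by positivity
  have hTe : T ^ (b - a) = ε⁻¹ := by
    rw [hT, ← Real.rpow_mul (by positivity), inv_mul_cancel₀ (by linarith), Real.rpow_one]
  refine ⟨T ^ a, by positivity, fun t ht => ?_⟩
  rcases le_total t T with h | h
  · have h1 := Real.rpow_le_rpow ht h ha
    have : 0 ≤ ε * t ^ b := by positivity
    linarith
  · have htp : 0 < t := hT0.trans_le h
    have h1 := Real.rpow_le_rpow hT0.le h (by linarith : 0 ≤ b - a)
    rw [hTe] at h1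
    have h2 : t ^ b = t ^ a * t ^ (b - a) := by rw [← Real.rpow_add htp]; ring_nf
    have h3 : 1 ≤ ε * t ^ (b - a) := by
      rw [inv_le_iff_one_le_mul₀ hε] at h1
      linarith
    have h4 : 0 ≤ t ^ a := by positivity
    have h5 : 0 ≤ T ^ a := by positivity
    rw [h2]
    nlinarith

theorem abs_primitive_le {g : ℝ → ℝ} {a₁ a₂ r t : ℝ} (ha₁ : 0 ≤ a₁) (hr : 1 ≤ r)
    (hg : ∀ t, |g t| ≤ a₁ * |t| ^ (r - 1) + a₂) :
    |∫ τ in (0 : ℝ)..t, g τ| ≤ (a₁ * |t| ^ (r - 1) + a₂) * |t| := by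
  have := intervalIntegral.norm_integral_le_of_norm_le_const (a := 0) (b := t) (f := g)
    (C := a₁ * |t| ^ (r - 1) + a₂) fun τ hτ => by
      refine (hg τ).trans ?_
      have h1 : |τ| ≤ |t| := by
        rcases le_total 0 t with h | h
        · rw [uIoc_of_le h] at hτ
          rw [abs_of_pos hτ.1, abs_of_nonneg h]; exact hτ.2
        · rw [uIoc_of_ge h] at hτ
          rw [abs_of_nonpos hτ.2, abs_of_nonpos h]; linarith [hτ.1]
      have := Real.rpow_le_rpow (abs_nonneg τ) h1 (by linarith : 0 ≤ r - 1)
      gcongr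
  simpa using this

theorem growth_mul_abs {a₁ a₂ r : ℝ} (hr : 1 < r) (t : ℝ) :
    (a₁ * |t| ^ (r - 1) + a₂) * |t| = a₁ * |t| ^ r + a₂ * |t| := by
  have e : |t| ^ r = |t| ^ (r - 1) * |t| := by
    rcases (abs_nonneg t).eq_or_lt with h | h
    · rw [← h, Real.zero_rpow (by linarith), mul_zero]
    · rw [← Real.rpow_add_one h.ne']; ring_nf
  rw [e]; ring

theorem isPotential_caratheodory [SFinite μ] (hm : ∀ t, AEMeasurable (fun x => f x t) μ)
    (hc : ∀ᵐ x ∂μ, Continuous (f x)) {a₁ a₂ r : ℝ} (ha₁ : 0 ≤ a₁) (ha₂ : 0 ≤ a₂)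
    (hg : ∀ᵐ x ∂μ, ∀ t, |f x t| ≤ a₁ * |t| ^ (r - 1) + a₂) :
    IsPotential μ r (fun x t => ∫ τ in (0 : ℝ)..t, f x τ) f where
  bound := by
    refine ⟨a₁ + a₂, by positivity, ?_⟩
    filter_upwards [hg] with x hx t
    refine (hx t).trans ?_
    rw [Real.norm_eq_abs]
    have : 0 ≤ |t| ^ (r - 1) := by positivity
    nlinarith
  grad := by
    filter_upwards [hc] with x hx t
    have h1 : HasDerivAt (fun t => ∫ τ in (0 : ℝ)..t, f x τ) (f x t) t :=
      intervalIntegral.integral_hasDerivAt_right (hx.intervalIntegrable _ _)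
        (hx.stronglyMeasurableAtFilter _ _) hx.continuousAt
    have e : innerSL ℝ (f x t) = ContinuousLinearMap.toSpanSingleton ℝ (f x t) := by
      ext
      simp
    rw [e]
    exact h1.hasFDerivAt
  zero := Eventually.of_forall fun x => by simp
  meas w hw := (aemeasurable_primitive_comp hm hc hw.aemeasurable).aestronglyMeasurable
  meas_grad w hw := (aemeasurable_caratheodory_comp hm hc hw.aemeasurable).aestronglyMeasurable

end Caratheodory

/-! ### Passing to the limit under a.e. convergence -/

section Limits

variable {α : Type*} [MeasurableSpace α] {μ : Measure α}
variable {V : Type*} [NormedAddCommGroup V] [InnerProductSpace ℝ V]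

/-- A Young inequality, by cases on whether y ≤ ε t. -/
theorem rpow_sub_one_mul_le {s t y ε : ℝ} (hs : 1 < s) (ht : 0 ≤ t) (hy : 0 ≤ y) (hε : 0 < ε) :
    t ^ (s - 1) * y ≤ ε * t ^ s + ε⁻¹ ^ (s - 1) * y ^ s := by
  have e : ∀ z : ℝ, 0 ≤ z → z ^ s = z ^ (s - 1) * z := fun z hz => by
    rcases hz.eq_or_lt with h | h
    · rw [← h, Real.zero_rpow (by linarith), mul_zero]
    · rw [← Real.rpow_add_one h.ne']; ring_nf
  have ht' : 0 ≤ t ^ (s - 1) := by positivity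
  have hy' : 0 ≤ ε⁻¹ ^ (s - 1) * y ^ s := by positivity
  rcases le_total y (ε * t) with h | h
  · rw [e t ht]
    nlinarith
  · have h1 : t ≤ ε⁻¹ * y := by
      rw [inv_mul_eq_div, le_div_iff₀ hε]; linarith
    have h2 := Real.rpow_le_rpow ht h1 (by linarith : 0 ≤ s - 1)
    rw [Real.mul_rpow (by positivity) hy] at h2
    have h3 : 0 ≤ ε * t ^ s := by positivity
    rw [e y hy]
    nlinarith

/-- Almost everywhere convergence together with boundedness in `L^s` gives weak convergence of
the gradients of a potential. -/
theorem IsPotential.tendsto_integral_inner [IsFiniteMeasure μ] {s : ℝ} {H : α → V → ℝ}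
    {h : α → V → V} (hH : IsPotential μ s H h) (hs : 1 < s) (hc : ∀ᵐ x ∂μ, Continuous (h x))
    {w : ℕ → α → V} {w₀ φ : α → V} (hw : ∀ j, MemLp (w j) (ENNReal.ofReal s) μ)
    (hw₀ : MemLp w₀ (ENNReal.ofReal s) μ) (hφ : MemLp φ (ENNReal.ofReal s) μ) {M : ℝ}
    (hM : ∀ j, ∫ x, ‖w j x‖ ^ s ∂μ ≤ M)
    (hae : ∀ᵐ x ∂μ, Tendsto (fun j => w j x) atTop (𝓝 (w₀ x))) :
    Tendsto (fun j => ∫ x, inner ℝ (h x (w j x)) (φ x) ∂μ) atTop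
      (𝓝 (∫ x, inner ℝ (h x (w₀ x)) (φ x) ∂μ)) := by
  have hs0 : 0 < s := by linarith
  have hss := Real.HolderConjugate.conjExponent hs
  obtain ⟨C, hC, hb⟩ := hH.bound
  have hi : ∀ {v : α → V}, MemLp v (ENNReal.ofReal s) μ →
      Integrable (fun x => inner ℝ (h x (v x)) (φ x)) μ := fun hv =>
    integrable_inner_holder hss (hH.memLp_grad hss hv) hφ
  have hM0 : 0 ≤ M := (integral_nonneg fun x => by positivity).trans (hM 0)
  have iw := fun j => integrable_norm_rpow_ofReal hs0 (hw j)
  have iw₀ := integrable_norm_rpow_ofReal hs0 hw₀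
  have iφ := integrable_norm_rpow_ofReal hs0 hφ
  have iφ1 : Integrable (fun x => ‖φ x‖) μ := (hφ.integrable (one_le_ofReal hs.le)).norm
  rw [tendsto_iff_norm_sub_tendsto_zero]
  have key : Tendsto (fun j => ∫ x, ‖inner ℝ (h x (w j x) - h x (w₀ x)) (φ x)‖ ∂μ) atTop
      (𝓝 0) := by
    refine tendsto_integral_norm_zero (fun j => ?_) ?_ fun ε hε => ?_
    · exact ((hH.meas_grad _ (hw j).1).sub (hH.meas_grad _ hw₀.1)).inner hφ.1
    · filter_upwards [hae, hc] with x h1 h2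
      have h3 : Tendsto (fun j => inner ℝ (h x (w j x) - h x (w₀ x)) (φ x)) atTop
          (𝓝 (inner ℝ (h x (w₀ x) - h x (w₀ x)) (φ x))) :=
        (((h2.tendsto (w₀ x)).comp h1).sub_const _).inner tendsto_const_nhds
      simpa using h3
    -- Young with parameter η leaves C η |w_j|^s as the only part depending on j; this η brings its
    -- integral below ε.
    · set η : ℝ := ε / ((C + 1) * (M + 1)) with hη
      have hη0 : 0 < η := by positivity
      refine ⟨fun x => C * (2 * ‖φ x‖ + (‖w₀ x‖ ^ s + ‖φ x‖ ^ s) + η⁻¹ ^ (s - 1) * ‖φ x‖ ^ s),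
        fun j x => C * η * ‖w j x‖ ^ s,
        (((iφ1.const_mul 2).add (iw₀.add iφ)).add (iφ.const_mul _)).const_mul C,
        fun j => (iw j).const_mul _, fun j => Eventually.of_forall fun x => by positivity,
        Eventually.of_forall fun j => ?_, fun j => ?_⟩
      · rw [integral_const_mul]
        have h1 : C * η * ∫ x, ‖w j x‖ ^ s ∂μ ≤ (C + 1) * η * (M + 1) := by
          have := hM j
          gcongr <;> linarith
        refine h1.trans (le_of_eq ?_)
        rw [hη]
        field_simp
      · filter_upwards [hb] with x hx
        have h1 : ‖inner ℝ (h x (w j x) - h x (w₀ x)) (φ x)‖ ≤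
            (C * (1 + ‖w j x‖ ^ (s - 1)) + C * (1 + ‖w₀ x‖ ^ (s - 1))) * ‖φ x‖ := by
          refine (norm_inner_le_norm (𝕜 := ℝ) _ _).trans ?_
          gcongr
          exact (norm_sub_le _ _).trans (add_le_add (hx _) (hx _))
        have h2 := rpow_sub_one_mul_le hs (norm_nonneg (w j x)) (norm_nonneg (φ x)) hη0
        have h3 := rpow_sub_one_mul_le hs (norm_nonneg (w₀ x)) (norm_nonneg (φ x)) one_pos
        rw [inv_one, Real.one_rpow] at h3
        refine h1.trans ?_
        have h4 := mul_le_mul_of_nonneg_left (add_le_add h2 h3) hC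
        linarith
  refine squeeze_zero (fun j => norm_nonneg _) (fun j => ?_) key
  rw [← integral_sub (hi (hw j)) (hi hw₀)]
  simp_rw [← inner_sub_left]
  exact norm_integral_le_integral_norm _

end Limits

/-! ### The energy functional, its derivative and its expansion -/

section Energy

variable {N : ℕ} {Ω : Set (EuclideanSpace ℝ (Fin N))} {p q ν : ℝ}
  {f : EuclideanSpace ℝ (Fin N) → ℝ → ℝ}

/-- The vector field of the `(p, q)`-Laplacian. -/
def fieldPQ (p q ν : ℝ) (ξ : EuclideanSpace ℝ (Fin N)) : EuclideanSpace ℝ (Fin N) :=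
  plap p ξ + ν • plap q ξ

/-- The reaction term of the equation. -/
def reaction (p : ℝ) (f : EuclideanSpace ℝ (Fin N) → ℝ → ℝ) (x : EuclideanSpace ℝ (Fin N))
    (t : ℝ) : ℝ := f x t + plap (pStar N p) t

theorem isFiniteMeasure_restrict (hΩ : Bornology.IsBounded Ω) :
    IsFiniteMeasure (volume.restrict Ω) := ⟨by
  rw [Measure.restrict_apply_univ]; exact hΩ.measure_lt_top⟩

theorem isPotential_fieldPQ (hq : 1 < q) (hqp : q < p) :
    IsPotential (volume.restrict Ω) p
      (fun _ (ξ : EuclideanSpace ℝ (Fin N)) => 1 / p * ‖ξ‖ ^ p + ν * (1 / q * ‖ξ‖ ^ q))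
      (fun _ => fieldPQ p q ν) :=
  (isPotential_norm_rpow (hq.trans hqp)).add
    (((isPotential_norm_rpow hq).const_mul ν).mono hq.le hqp.le)

theorem continuous_fieldPQ (hq : 1 < q) (hqp : q < p) :
    Continuous (fieldPQ p q ν : EuclideanSpace ℝ (Fin N) → _) :=
  (continuous_plap (hq.trans hqp)).add ((continuous_plap hq).const_smul ν)

theorem isPotential_reaction (hp : 1 < p) (hpN : p < N) (hf : IsCaratheodory Ω f)
    (hg : SubcriticalGrowth Ω p f) :
    IsPotential (volume.restrict Ω) (pStar N p)
      (fun x (t : ℝ) => (∫ τ in (0 : ℝ)..t, f x τ) + 1 / pStar N p * ‖t‖ ^ pStar N p)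
      (reaction p f) := by
  obtain ⟨a₁, a₂, r, ha₁, ha₂, hr, hr', hb⟩ := hg
  exact ((isPotential_caratheodory hf.measurable hf.continuous ha₁.le ha₂.le hb).mono
    (by linarith) hr'.le).add (isPotential_norm_rpow (hp.trans (lt_pStar hp hpN)))

theorem continuous_reaction (hp : 1 < p) (hpN : p < N) (hf : IsCaratheodory Ω f) :
    ∀ᵐ x ∂(volume.restrict Ω), Continuous (reaction p f x) := by
  filter_upwards [hf.continuous] with x hx
  exact hx.add (continuous_plap (hp.trans (lt_pStar hp hpN)))

/-- The primitive and the product `f(x,t) t` are small compared to the critical power. -/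
theorem exists_subcritical_le (hp : 1 < p) (hg : SubcriticalGrowth Ω p f) {ε : ℝ} (hε : 0 < ε) :
    ∃ C : ℝ, 0 ≤ C ∧ ∀ᵐ x ∂(volume.restrict Ω), ∀ t : ℝ,
      |∫ τ in (0 : ℝ)..t, f x τ| ≤ C + ε * ‖t‖ ^ pStar N p ∧
      |f x t * t| ≤ C + ε * ‖t‖ ^ pStar N p := by
  obtain ⟨a₁, a₂, r, ha₁, ha₂, hr, hr', hb⟩ := hg
  -- Each of the terms a₁|t|^r and a₂|t| receives half of ε.
  obtain ⟨C₁, hC₁, h₁⟩ := exists_rpow_le_mul_rpow_add (a := r) (b := pStar N p)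
    (ε := ε / (2 * a₁)) (by linarith) hr' (by positivity)
  obtain ⟨C₂, hC₂, h₂⟩ := exists_rpow_le_mul_rpow_add (a := 1) (b := pStar N p)
    (ε := ε / (2 * a₂)) (by linarith) (by linarith) (by positivity)
  have key : ∀ t : ℝ, (a₁ * |t| ^ (r - 1) + a₂) * |t| ≤
      (a₁ * C₁ + a₂ * C₂) + ε * ‖t‖ ^ pStar N p := fun t => by
    rw [growth_mul_abs (by linarith), Real.norm_eq_abs]
    have h3 := mul_le_mul_of_nonneg_left (h₁ |t| (abs_nonneg t)) ha₁.le
    have h4 := mul_le_mul_of_nonneg_left (h₂ |t| (abs_nonneg t)) ha₂.le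
    rw [Real.rpow_one] at h4
    have e1 : a₁ * (ε / (2 * a₁) * |t| ^ pStar N p + C₁) =
      ε / 2 * |t| ^ pStar N p + a₁ * C₁ := by field_simp
    have e2 : a₂ * (ε / (2 * a₂) * |t| ^ pStar N p + C₂) =
      ε / 2 * |t| ^ pStar N p + a₂ * C₂ := by field_simp
    rw [e1] at h3
    rw [e2] at h4
    linarith
  refine ⟨a₁ * C₁ + a₂ * C₂, by positivity, ?_⟩
  filter_upwards [hb] with x hx t
  refine ⟨(abs_primitive_le ha₁.le (by linarith) hx).trans (key t), ?_⟩
  rw [abs_mul]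
  exact (mul_le_mul_of_nonneg_right (hx t) (abs_nonneg t)).trans (key t)

variable [Fact (1 ≤ ENNReal.ofReal p)]

/-- Separates a functional of ∇u on L^p from one of u on L^{p*}, each covered by
`IsPotential.hasFDerivAt`; the chain rule through the gradient map and the Sobolev embedding then
differentiates the energy. -/
theorem energy_eq_sub (hΩ : Bornology.IsBounded Ω) (hq : 1 < q) (hqp : q < p) (hpN : p < N)
    (hf : IsCaratheodory Ω f) (hg : SubcriticalGrowth Ω p f) (u : W0 Ω p) :
    energy q ν f u = (∫ x in Ω, (1 / p * ‖u.grad x‖ ^ p + ν * (1 / q * ‖u.grad x‖ ^ q))) -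
      ∫ x in Ω, ((∫ τ in (0 : ℝ)..(u.fn x), f x τ) +
        1 / pStar N p * ‖u.fn x‖ ^ pStar N p) := by
  have := isFiniteMeasure_restrict hΩ
  have hp : 1 < p := hq.trans hqp
  have i1 := (isPotential_fieldPQ (Ω := Ω) (ν := ν) hq hqp).integrable hp u.memLp_grad
  have i2 := (isPotential_reaction hp hpN hf hg).integrable (hp.trans (lt_pStar hp hpN))
    (u.memLp_fn_pStar hp hpN)
  rw [← integral_sub i1 i2, energy]
  refine integral_congr_ae (Eventually.of_forall fun x => ?_)
  simp only [Real.norm_eq_abs]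
  ring

/-- The energy is differentiable, with the expected derivative. -/
theorem hasFDerivAt_energy (hΩ : Bornology.IsBounded Ω) (hq : 1 < q) (hqp : q < p) (hpN : p < N)
    (hf : IsCaratheodory Ω f) (hg : SubcriticalGrowth Ω p f) (u : W0 Ω p) :
    ∃ L : W0 Ω p →L[ℝ] ℝ, HasFDerivAt (energy q ν f) L u ∧ ∀ φ : W0 Ω p,
      L φ = (∫ x in Ω, inner ℝ (fieldPQ p q ν (u.grad x)) (φ.grad x)) -
        ∫ x in Ω, inner ℝ (reaction p f x (u.fn x)) (φ.fn x) := by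
  have := isFiniteMeasure_restrict hΩ
  have hp : 1 < p := hq.trans hqp
  have hps := hp.trans (lt_pStar hp hpN)
  have : Fact (1 ≤ ENNReal.ofReal (pStar N p)) := ⟨one_le_ofReal hps.le⟩
  obtain ⟨J, hJ⟩ := exists_sobolev_embedding (Ω := Ω) hp hpN
  obtain ⟨L₁, hL₁, h₁⟩ := (isPotential_fieldPQ (Ω := Ω) (ν := ν) hq hqp).hasFDerivAt hp (gradL u)
  obtain ⟨L₂, hL₂, h₂⟩ := (isPotential_reaction hp hpN hf hg).hasFDerivAt hps (J u)
  refine ⟨L₁.comp gradL - L₂.comp J, ?_, fun φ => ?_⟩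
  · have hd := (hL₁.comp u gradL.hasFDerivAt).sub (hL₂.comp u J.hasFDerivAt)
    refine hd.congr_of_eventuallyEq (Eventually.of_forall fun v => ?_)
    rw [energy_eq_sub hΩ hq hqp hpN hf hg]
    refine congrArg₂ _ rfl (integral_congr_ae ?_)
    filter_upwards [hJ v] with x hx
    rw [hx]
  · have e : (L₁.comp gradL - L₂.comp J) φ = L₁ (gradL φ) - L₂ (J φ) := rfl
    rw [e, h₁, h₂]
    refine congrArg₂ _ rfl (integral_congr_ae ?_)
    filter_upwards [hJ u, hJ φ] with x hx hx'
    rw [hx, hx']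

theorem fderiv_energy_apply (hΩ : Bornology.IsBounded Ω) (hq : 1 < q) (hqp : q < p) (hpN : p < N)
    (hf : IsCaratheodory Ω f) (hg : SubcriticalGrowth Ω p f) (u φ : W0 Ω p) :
    fderiv ℝ (energy q ν f) u φ = (∫ x in Ω, inner ℝ (fieldPQ p q ν (u.grad x)) (φ.grad x)) -
        ∫ x in Ω, inner ℝ (reaction p f x (u.fn x)) (φ.fn x) := by
  obtain ⟨L, hL, h⟩ := hasFDerivAt_energy (ν := ν) hΩ hq hqp hpN hf hg u
  rw [hL.fderiv, h]

/-- `∫ |∇u|^s`. -/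
def gradInt (s : ℝ) (u : W0 Ω p) : ℝ := ∫ x in Ω, ‖u.grad x‖ ^ s

/-- `∫ |u|^s`. -/
def fnInt (s : ℝ) (u : W0 Ω p) : ℝ := ∫ x in Ω, ‖u.fn x‖ ^ s

theorem gradInt_nonneg (s : ℝ) (u : W0 Ω p) : 0 ≤ gradInt s u :=
  integral_nonneg fun x => by positivity

theorem fnInt_nonneg (s : ℝ) (u : W0 Ω p) : 0 ≤ fnInt s u :=
  integral_nonneg fun x => by positivity

theorem gradInt_eq (hp : 0 < p) (u : W0 Ω p) : gradInt p u = ‖gradL u‖ ^ p :=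
  integral_norm_rpow_eq hp (gradL u)

theorem W0.integrable_grad_rpow (hp : 0 < p) (u : W0 Ω p) :
    Integrable (fun x => ‖u.grad x‖ ^ p) (volume.restrict Ω) :=
  integrable_norm_rpow_ofReal hp u.memLp_grad

theorem W0.integrable_grad_rpow_of_le (hΩ : Bornology.IsBounded Ω) (hq : 0 < q) (hqp : q ≤ p)
    (u : W0 Ω p) : Integrable (fun x => ‖u.grad x‖ ^ q) (volume.restrict Ω) := by
  have := isFiniteMeasure_restrict hΩ
  exact integrable_norm_rpow_ofReal hq (u.memLp_grad.mono_exponent (ENNReal.ofReal_le_ofReal hqp))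

theorem W0.integrable_fn_rpow (hp : 1 < p) (hpN : p < N) (u : W0 Ω p) :
    Integrable (fun x => ‖u.fn x‖ ^ pStar N p) (volume.restrict Ω) :=
  integrable_norm_rpow_ofReal (by linarith [lt_pStar hp hpN]) (u.memLp_fn_pStar hp hpN)

theorem aestronglyMeasurable_f_comp (hf : IsCaratheodory Ω f) (u : W0 Ω p) :
    AEStronglyMeasurable (fun x => f x (u.fn x)) (volume.restrict Ω) :=
  (aemeasurable_caratheodory_comp hf.measurable hf.continuous
    u.memLp_fn.1.aemeasurable).aestronglyMeasurable

theorem aestronglyMeasurable_F_comp (hf : IsCaratheodory Ω f) (u : W0 Ω p) :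
    AEStronglyMeasurable (fun x => ∫ τ in (0 : ℝ)..(u.fn x), f x τ) (volume.restrict Ω) :=
  (aemeasurable_primitive_comp hf.measurable hf.continuous
    u.memLp_fn.1.aemeasurable).aestronglyMeasurable

theorem exists_subcritical_bound (hΩ : Bornology.IsBounded Ω) (hp : 1 < p) (hpN : p < N)
    (hf : IsCaratheodory Ω f) (hg : SubcriticalGrowth Ω p f) {ε : ℝ} (hε : 0 < ε) :
    ∃ C : ℝ, 0 ≤ C ∧ ∀ u : W0 Ω p,
      Integrable (fun x => ∫ τ in (0 : ℝ)..(u.fn x), f x τ) (volume.restrict Ω) ∧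
      Integrable (fun x => f x (u.fn x) * u.fn x) (volume.restrict Ω) ∧
      |∫ x in Ω, ∫ τ in (0 : ℝ)..(u.fn x), f x τ| ≤ C + ε * fnInt (pStar N p) u ∧
      |∫ x in Ω, f x (u.fn x) * u.fn x| ≤ C + ε * fnInt (pStar N p) u := by
  have := isFiniteMeasure_restrict hΩ
  obtain ⟨C, hC, h⟩ := exists_subcritical_le (N := N) hp hg hε
  refine ⟨C * (volume.restrict Ω).real univ, by positivity, fun u => ?_⟩
  have iu := (u.integrable_fn_rpow hp hpN).const_mul ε
  have ib : Integrable (fun x => C + ε * ‖u.fn x‖ ^ pStar N p) (volume.restrict Ω) :=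
    (integrable_const C).add iu
  have h1 : ∀ᵐ x ∂(volume.restrict Ω),
      ‖∫ τ in (0 : ℝ)..(u.fn x), f x τ‖ ≤ C + ε * ‖u.fn x‖ ^ pStar N p :=
    h.mono fun x hx => (hx _).1
  have h2 : ∀ᵐ x ∂(volume.restrict Ω),
      ‖f x (u.fn x) * u.fn x‖ ≤ C + ε * ‖u.fn x‖ ^ pStar N p :=
    h.mono fun x hx => (hx _).2
  have e : ∫ x in Ω, (C + ε * ‖u.fn x‖ ^ pStar N p) =
      C * (volume.restrict Ω).real univ + ε * fnInt (pStar N p) u := by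
    rw [integral_add (integrable_const C) iu, integral_const, integral_const_mul, smul_eq_mul,
      mul_comm, fnInt]
  refine ⟨ib.mono' (aestronglyMeasurable_F_comp hf u) h1,
    ib.mono' ((aestronglyMeasurable_f_comp hf u).mul u.memLp_fn.1) h2, ?_, ?_⟩
  · rw [← e]
    exact norm_integral_le_of_norm_le ib h1
  · rw [← e]
    exact norm_integral_le_of_norm_le ib h2

theorem energy_expand (hΩ : Bornology.IsBounded Ω) (hq : 1 < q) (hqp : q < p) (hpN : p < N)
    (hf : IsCaratheodory Ω f) (hg : SubcriticalGrowth Ω p f) (u : W0 Ω p) :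
    energy q ν f u = 1 / p * gradInt p u + ν * (1 / q * gradInt q u) -
      (∫ x in Ω, ∫ τ in (0 : ℝ)..(u.fn x), f x τ) - 1 / pStar N p * fnInt (pStar N p) u := by
  have hp : 1 < p := hq.trans hqp
  obtain ⟨C, -, h⟩ := exists_subcritical_bound hΩ hp hpN hf hg one_pos
  rw [energy_eq_sub hΩ hq hqp hpN hf hg, integral_add
    ((u.integrable_grad_rpow (by linarith)).const_mul _)
    (((u.integrable_grad_rpow_of_le hΩ (by linarith) hqp.le).const_mul _).const_mul _),
    integral_add (h u).1 ((u.integrable_fn_rpow hp hpN).const_mul _)]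
  simp only [integral_const_mul, gradInt, fnInt]
  ring

theorem fderiv_energy_self (hΩ : Bornology.IsBounded Ω) (hq : 1 < q) (hqp : q < p) (hpN : p < N)
    (hf : IsCaratheodory Ω f) (hg : SubcriticalGrowth Ω p f) (u : W0 Ω p) :
    fderiv ℝ (energy q ν f) u u = gradInt p u + ν * gradInt q u -
      (∫ x in Ω, f x (u.fn x) * u.fn x) - fnInt (pStar N p) u := by
  have hp : 1 < p := hq.trans hqp
  have hps := hp.trans (lt_pStar hp hpN)
  obtain ⟨C, -, h⟩ := exists_subcritical_bound hΩ hp hpN hf hg one_pos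
  have e1 : ∀ x, inner ℝ (fieldPQ p q ν (u.grad x)) (u.grad x) =
      ‖u.grad x‖ ^ p + ν * ‖u.grad x‖ ^ q := fun x => by
    rw [fieldPQ, inner_add_left, real_inner_smul_left, inner_plap_self hp, inner_plap_self hq]
  have e2 : ∀ x, inner ℝ (reaction p f x (u.fn x)) (u.fn x) =
      f x (u.fn x) * u.fn x + ‖u.fn x‖ ^ pStar N p := fun x => by
    rw [reaction, inner_add_left, inner_plap_self hps]
    simp [mul_comm]
  rw [fderiv_energy_apply hΩ hq hqp hpN hf hg]
  simp_rw [e1, e2]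
  rw [integral_add (u.integrable_grad_rpow (by linarith))
    ((u.integrable_grad_rpow_of_le hΩ (by linarith) hqp.le).const_mul _),
    integral_add (h u).2.1 (u.integrable_fn_rpow hp hpN), integral_const_mul]
  simp only [gradInt, fnInt]
  ring

end Energy

/-! ### Boundedness of Palais–Smale sequences -/

section PalaisSmale

variable {N : ℕ} {Ω : Set (EuclideanSpace ℝ (Fin N))} {p q ν : ℝ}
  {f : EuclideanSpace ℝ (Fin N) → ℝ → ℝ}

/-- The level and the derivative control the critical integral. -/
theorem critical_le_of_energy_le {n s P Q R G F M δ C : ℝ} (hp : 1 < p) (hq : 0 < q) (hqp : q ≤ p)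
    (hν : 0 ≤ ν) (hn : 0 < n) (hs : 1 / s = 1 / p - 1 / n) (hQ : 0 ≤ Q) (hR : 0 ≤ R) (hC : 0 ≤ C)
    (hδ : 0 ≤ δ) (hF : |F| ≤ C + 1 / (4 * n) * R) (hG : |G| ≤ C + 1 / (4 * n) * R)
    (hE : 1 / p * P + ν * (1 / q * Q) - F - 1 / s * R ≤ M)
    (hE' : -δ ≤ P + ν * Q - G - R) : R ≤ 2 * n * (|M| + δ + 2 * C) := by
  rw [abs_le] at hF hG
  have hp1 : 1 / p ≤ 1 := by rw [div_le_one (by linarith)]; exact hp.le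
  have hp1' : 0 ≤ 1 / p := by positivity
  -- Subtracting 1/p times the derivative from the energy removes `P` and leaves (1/p - 1/s) R =
  -- R/n.
  have k1 := mul_le_mul_of_nonneg_left hE' hp1'
  have k2 : 1 / p * δ ≤ δ := mul_le_of_le_one_left hδ hp1
  have k3 : -(C + 1 / (4 * n) * R) ≤ 1 / p * G := by
    have h : 0 ≤ C + 1 / (4 * n) * R := by positivity
    have k := mul_le_mul_of_nonneg_left hG.1 hp1'
    have k' := mul_le_of_le_one_left h hp1
    linarith
  have k4 : 0 ≤ (1 / q - 1 / p) * (ν * Q) :=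
    mul_nonneg (sub_nonneg.2 (one_div_le_one_div_of_le hq hqp)) (mul_nonneg hν hQ)
  have k6 : 1 / (4 * n) = 1 / 4 * (1 / n) := by rw [one_div_mul_one_div]
  rw [hs] at hE
  rw [k6] at k3 hF
  -- The errors from `F` and `G` cost R/(4n) each, so half of R/n survives.
  have k7 : 1 / n * R ≤ 2 * (|M| + δ + 2 * C) := by
    have := le_abs_self M
    linarith [hF.2]
  rw [one_div, inv_mul_le_iff₀ hn] at k7
  linarith

/-- Here t stands for ‖u‖: since `R` is at most linear in t, the energy bound makes `P` at most
linear as well. -/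
theorem gradient_le_of_energy_le {n s P Q R F M δ t C : ℝ} (hp : 0 < p) (hq : 0 < q)
    (hν : 0 ≤ ν) (hn : 1 ≤ n) (hs : 1 ≤ s) (hQ : 0 ≤ Q) (hR : 0 ≤ R) (hC : 0 ≤ C)
    (hδ : 0 ≤ δ) (ht : 0 ≤ t) (hF : |F| ≤ C + 1 / (4 * n) * R)
    (hE : 1 / p * P + ν * (1 / q * Q) - F - 1 / s * R ≤ M)
    (hR' : R ≤ 2 * n * (|M| + δ * t + 2 * C)) :
    P ≤ p * (|M| + C + 2 * (2 * n * (|M| + δ + 2 * C))) * (1 + t) := by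
  have hM := abs_nonneg M
  have hνQ : 0 ≤ ν * (1 / q * Q) := by positivity
  have k1 : 1 / s * R ≤ R := mul_le_of_le_one_left hR (by rw [div_le_one (by linarith)]; exact hs)
  have k2 : 1 / (4 * n) * R ≤ R :=
    mul_le_of_le_one_left hR (by rw [div_le_one (by linarith)]; linarith)
  have k3 : |M| + δ * t + 2 * C ≤ (|M| + δ + 2 * C) * (1 + t) := by
    have : 0 ≤ |M| * t + δ + 2 * C * t := by positivity
    linarith
  have k4 : R ≤ 2 * n * (|M| + δ + 2 * C) * (1 + t) := by
    refine hR'.trans ?_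
    rw [mul_assoc (2 * n)]
    exact mul_le_mul_of_nonneg_left k3 (by linarith)
  have k5 : 1 / p * P ≤ |M| + C + 2 * R := by
    linarith [le_abs_self M, (abs_le.1 hF).2]
  have k6 : |M| + C ≤ (|M| + C) * (1 + t) :=
    le_mul_of_one_le_right (by positivity) (by linarith)
  rw [one_div, inv_mul_le_iff₀ hp] at k5
  refine k5.trans ?_
  rw [mul_assoc]
  exact mul_le_mul_of_nonneg_left (by linarith) hp.le

variable [Fact (1 ≤ ENNReal.ofReal p)]

theorem gradInt_le_of_norm_le (hp : 0 < p) {u : W0 Ω p} {B : ℝ} (hB : ‖u‖ ≤ B) :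
    gradInt p u ≤ B ^ p := by
  rw [gradInt_eq hp]
  exact Real.rpow_le_rpow (norm_nonneg _) ((norm_gradL_le u).trans hB) hp.le

/-- Palais–Smale sequences are bounded. -/
theorem exists_norm_le_of_palaisSmale (hΩ : Bornology.IsBounded Ω) (hq : 1 < q) (hqp : q < p)
    (hpN : p < N) (hν : 0 ≤ ν) (hf : IsCaratheodory Ω f) (hg : SubcriticalGrowth Ω p f) {c : ℝ}
    {u : ℕ → W0 Ω p} (hu : IsPalaisSmale (energy q ν f) c u) : ∃ B : ℝ, ∀ j, ‖u j‖ ≤ B := by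
  have hp : 1 < p := hq.trans hqp
  have hp0 : 0 < p := by linarith
  have hN1 : (1 : ℝ) < N := by linarith
  have hps := lt_pStar hp hpN
  obtain ⟨M, hM⟩ := hu.level.bddAbove_range
  obtain ⟨D, hD⟩ := hu.deriv.norm.bddAbove_range
  have hM' : ∀ j, energy q ν f (u j) ≤ M := fun j => hM ⟨j, rfl⟩
  have hD' : ∀ j, ‖fderiv ℝ (energy q ν f) (u j)‖ ≤ D := fun j => hD ⟨j, rfl⟩
  have hD0 : 0 ≤ D :=
    le_trans (norm_nonneg (fderiv ℝ (energy q ν f) (u 0))) (hD' 0)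
  obtain ⟨C, hC, hsub⟩ := exists_subcritical_bound hΩ hp hpN hf hg
    (show 0 < 1 / (4 * (N : ℝ)) by positivity)
  obtain ⟨K, hK, hpoin⟩ := exists_norm_le_gradL (Ω := Ω) hΩ hp hpN
  have hP : ∀ j, gradInt p (u j) ≤
      p * (|M| + C + 2 * (2 * N * (|M| + D + 2 * C))) * (1 + ‖u j‖) := fun j => by
    obtain ⟨-, -, h1, h2⟩ := hsub (u j)
    have h3 := hM' j
    have h4 : -(D * ‖u j‖) ≤ fderiv ℝ (energy q ν f) (u j) (u j) := by
      have h5 := (fderiv ℝ (energy q ν f) (u j)).le_opNorm (u j)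
      have h6 := mul_le_mul_of_nonneg_right (hD' j) (norm_nonneg (u j))
      exact (abs_le.1 (h5.trans h6)).1
    rw [fderiv_energy_self hΩ hq hqp hpN hf hg] at h4
    rw [energy_expand hΩ hq hqp hpN hf hg] at h3
    have hRn := fnInt_nonneg (pStar N p) (u j)
    have hQn := gradInt_nonneg q (u j)
    have hn : 0 ≤ ‖u j‖ := norm_nonneg _
    have k5 : 1 / pStar N p = 1 / p - 1 / N := by simpa only [one_div] using pStar_inv hp hpN
    exact gradient_le_of_energy_le hp0 (by linarith) hν hN1.le (by linarith) hQn hRn hC hD0 hn h1 h3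
      (critical_le_of_energy_le hp (by linarith) hqp.le hν (by linarith) k5 hQn hRn hC
        (mul_nonneg hD0 hn) h1 h2 h3 h4)
  set A := p * (|M| + C + 2 * (2 * N * (|M| + D + 2 * C))) with hAdef
  have hA : 0 ≤ A := by positivity
  -- By Poincaré the gradient integral is at least ‖u‖^p / K^p, which the linear bound A(1 + ‖u‖)
  -- can meet only on a bounded set.
  obtain ⟨B, hB⟩ := exists_le_rpow_sub_linear hp (K := K ^ p) (by positivity) hA
  refine ⟨A + B, fun j => ?_⟩
  have h1 := hB ‖u j‖ (norm_nonneg _)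
  have h2 : ‖u j‖ ^ p / K ^ p ≤ gradInt p (u j) := by
    rw [div_le_iff₀ (by positivity), gradInt_eq hp0, mul_comm, ← Real.mul_rpow hK.le (norm_nonneg _)]
    exact Real.rpow_le_rpow (norm_nonneg _) (hpoin _) hp0.le
  have h3 := hP j
  linarith

theorem fnInt_zero {s : ℝ} (hs : s ≠ 0) : fnInt s (0 : W0 Ω p) = 0 := by
  have h : (0 : W0 Ω p).fn =ᵐ[volume.restrict Ω] 0 := Lp.coeFn_zero _ _ _
  rw [fnInt, ← integral_zero (EuclideanSpace ℝ (Fin N)) ℝ (μ := volume.restrict Ω)]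
  refine integral_congr_ae ?_
  filter_upwards [h] with x hx
  rw [hx, Pi.zero_apply, norm_zero, Real.zero_rpow hs]

/-- Sobolev's inequality with the best constant. -/
theorem sobolevConst_mul_le (hp : 1 < p) (hpN : p < N) (u : W0 Ω p) :
    sobolevConst Ω p * fnInt (pStar N p) u ^ (p / pStar N p) ≤ gradInt p u := by
  have hps := lt_pStar hp hpN
  by_cases hu : u = 0
  · have hps0 : pStar N p ≠ 0 := by linarith
    have hpp : p / pStar N p ≠ 0 := div_ne_zero (by linarith) hps0
    rw [hu, fnInt_zero hps0, Real.zero_rpow hpp, mul_zero]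
    exact gradInt_nonneg _ _
  · have hbdd : BddBelow (range fun u : {u : W0 Ω p // u ≠ 0} =>
        (∫ x in Ω, ‖u.1.grad x‖ ^ p) / (∫ x in Ω, |u.1.fn x| ^ pStar N p) ^ (p / pStar N p)) := by
      refine ⟨0, ?_⟩
      rintro _ ⟨v, rfl⟩
      positivity
    have h1 : sobolevConst Ω p ≤ gradInt p u / fnInt (pStar N p) u ^ (p / pStar N p) :=
      ciInf_le hbdd ⟨u, hu⟩
    have h2 : 0 ≤ fnInt (pStar N p) u ^ (p / pStar N p) := Real.rpow_nonneg (fnInt_nonneg _ _) _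
    rcases h2.eq_or_lt with h | h
    · rw [← h, mul_zero]
      exact gradInt_nonneg _ _
    · rwa [le_div_iff₀ h] at h1

end PalaisSmale

/-! ### Limits tested with bounded or variable functions -/

section Limits

variable {α : Type*} [MeasurableSpace α] {μ : Measure α}
variable {V : Type*} [NormedAddCommGroup V] [InnerProductSpace ℝ V]

/-- The gradient of a potential along a bounded sequence, tested with bounded functions that tend
to zero. -/
theorem IsPotential.tendsto_integral_inner_of_bounded [IsFiniteMeasure μ] {s : ℝ}
    {H : α → V → ℝ} {h : α → V → V} (hH : IsPotential μ s H h) (hs : 1 < s)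
    (hc : ∀ᵐ x ∂μ, Continuous (h x)) {w : ℕ → α → V} {w₀ : α → V}
    (hw : ∀ j, MemLp (w j) (ENNReal.ofReal s) μ) {M : ℝ} (hM : ∀ j, ∫ x, ‖w j x‖ ^ s ∂μ ≤ M)
    (hae : ∀ᵐ x ∂μ, Tendsto (fun j => w j x) atTop (𝓝 (w₀ x))) {z : ℕ → α → V}
    (hz : ∀ j, AEStronglyMeasurable (z j) μ) {A : ℝ} (hA : 0 ≤ A)
    (hzA : ∀ j, ∀ᵐ x ∂μ, ‖z j x‖ ≤ A) (hz0 : ∀ᵐ x ∂μ, Tendsto (fun j => z j x) atTop (𝓝 0)) :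
    Tendsto (fun j => ∫ x, inner ℝ (h x (w j x)) (z j x) ∂μ) atTop (𝓝 0) := by
  have hs0 : 0 < s := by linarith
  obtain ⟨C, hC, hb⟩ := hH.bound
  have hM0 : 0 ≤ M := (integral_nonneg fun x => by positivity).trans (hM 0)
  refine tendsto_integral_zero_of_norm (tendsto_integral_norm_zero (fun j => ?_) ?_ fun ε hε => ?_)
  · exact (hH.meas_grad _ (hw j).1).inner (hz j)
  · filter_upwards [hae, hc, hz0] with x h1 h2 h3
    simpa using ((h2.tendsto (w₀ x)).comp h1).inner h3
  · set η : ℝ := ε / ((C + 1) * (A + 1) * (M + 1)) with hη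
    have hη0 : 0 < η := by positivity
    -- The growth s-1 is strictly below the exponent s of the bound: tested with bounded functions,
    -- even a critical term is uniformly integrable.
    obtain ⟨C', hC', hle⟩ := exists_rpow_le_mul_rpow_add (a := s - 1) (b := s) (by linarith)
      (by linarith) hη0
    refine ⟨fun _ => C * (1 + C') * A, fun j x => C * A * η * ‖w j x‖ ^ s, integrable_const _,
      fun j => (integrable_norm_rpow_ofReal hs0 (hw j)).const_mul _,
      fun j => Eventually.of_forall fun x => by positivity,
      Eventually.of_forall fun j => ?_, fun j => ?_⟩
    · rw [integral_const_mul]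
      have h1 : C * A * η * ∫ x, ‖w j x‖ ^ s ∂μ ≤ (C + 1) * (A + 1) * η * (M + 1) := by
        have := hM j
        gcongr <;> linarith
      refine h1.trans (le_of_eq ?_)
      rw [hη]
      field_simp
    · filter_upwards [hb, hzA j] with x h1 h2
      refine (norm_inner_le_norm (𝕜 := ℝ) _ _).trans
        ((mul_le_mul (h1 _) h2 (norm_nonneg _) (by positivity)).trans ?_)
      have h3 := mul_le_mul_of_nonneg_left (hle ‖w j x‖ (norm_nonneg _)) (mul_nonneg hC hA)
      linarith

/-- k_j G → 0 strongly in L^{s'} by domination, and W_j is bounded in L^s. -/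
theorem tendsto_integral_mul_inner {s s' : ℝ} (hss : s.HolderConjugate s') {G : α → V}
    (hG : MemLp G (ENNReal.ofReal s') μ) {W : ℕ → α → V}
    (hW : ∀ j, MemLp (W j) (ENNReal.ofReal s) μ) {M : ℝ} (hM : ∀ j, ∫ x, ‖W j x‖ ^ s ∂μ ≤ M)
    {k : ℕ → α → ℝ} (hk : ∀ j, AEStronglyMeasurable (k j) μ) (hk1 : ∀ j x, |k j x| ≤ 1)
    (hk0 : ∀ᵐ x ∂μ, Tendsto (fun j => k j x) atTop (𝓝 0)) :
    Tendsto (fun j => ∫ x, k j x * inner ℝ (G x) (W j x) ∂μ) atTop (𝓝 0) := by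
  have hs' : 0 < s' := hss.symm.pos
  have hM0 : 0 ≤ M := (integral_nonneg fun x => by positivity).trans (hM 0)
  have hle : ∀ j x, ‖k j x • G x‖ ≤ ‖G x‖ := fun j x => by
    rw [norm_smul]
    exact mul_le_of_le_one_left (norm_nonneg _) (hk1 j x)
  have hkG : ∀ j, MemLp (fun x => k j x • G x) (ENNReal.ofReal s') μ := fun j =>
    hG.of_le ((hk j).smul hG.1) (Eventually.of_forall fun x => hle j x)
  have h1 : Tendsto (fun j => ∫ x, ‖k j x • G x‖ ^ s' ∂μ) atTop (𝓝 0) := by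
    have := tendsto_integral_of_dominated_convergence (μ := μ)
      (F := fun j x => ‖k j x • G x‖ ^ s') (f := fun _ => 0) (fun x => ‖G x‖ ^ s')
      (fun j => (integrable_norm_rpow_ofReal hs' (hkG j)).1) (integrable_norm_rpow_ofReal hs' hG)
      (fun j => Eventually.of_forall fun x => ?_) ?_
    · simpa using this
    · rw [Real.norm_eq_abs, abs_of_nonneg (by positivity)]
      exact Real.rpow_le_rpow (norm_nonneg _) (hle j x) hs'.le
    · filter_upwards [hk0] with x hx
      have := ((hx.smul_const (G x)).norm).rpow_const (p := s') (Or.inr hs'.le)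
      simpa [Real.zero_rpow hs'.ne'] using this
  have h2 : Tendsto (fun j => M ^ (1 / s) * (∫ x, ‖k j x • G x‖ ^ s' ∂μ) ^ (1 / s')) atTop
      (𝓝 0) := by
    have := (h1.rpow_const (p := 1 / s') (Or.inr (by positivity))).const_mul (M ^ (1 / s))
    rwa [Real.zero_rpow (by positivity), mul_zero] at this
  refine squeeze_zero_norm (fun j => ?_) h2
  refine (norm_integral_le_integral_norm _).trans (le_trans ?_
    ((integral_norm_mul_norm_le hss (hW j) (hkG j)).trans ?_))
  · have := hss.ennrealOfReal
    refine integral_mono_of_nonneg (Eventually.of_forall fun x => norm_nonneg _)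
      ((hW j).norm.integrable_mul (hkG j).norm) (Eventually.of_forall fun x => ?_)
    simp only
    rw [← real_inner_smul_left, mul_comm]
    exact norm_inner_le_norm (𝕜 := ℝ) _ _
  · refine mul_le_mul_of_nonneg_right (Real.rpow_le_rpow (integral_nonneg fun x => by positivity)
      (hM j) (by have := hss.pos; positivity)) ?_
    exact Real.rpow_nonneg (integral_nonneg fun x => by positivity) _

theorem exists_subseq_ae_of_tendsto_integral {e : ℕ → α → ℝ} (he : ∀ j, Integrable (e j) μ)
    (h0 : ∀ j, ∀ᵐ x ∂μ, 0 ≤ e j x) (h : Tendsto (fun j => ∫ x, e j x ∂μ) atTop (𝓝 0)) :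
    ∃ ns : ℕ → ℕ, StrictMono ns ∧ ∀ᵐ x ∂μ, Tendsto (fun n => e (ns n) x) atTop (𝓝 0) := by
  have h1 : Tendsto (fun j => eLpNorm (e j - fun _ => 0) 1 μ) atTop (𝓝 0) := by
    have := ENNReal.tendsto_ofReal h
    rw [ENNReal.ofReal_zero] at this
    refine this.congr fun j => ?_
    have e1 : (e j - fun _ => 0) = e j := by ext; simp
    rw [e1, eLpNorm_one_eq_lintegral_enorm, ← ofReal_integral_norm_eq_lintegral_enorm (he j)]
    refine congrArg _ (integral_congr_ae ?_)
    filter_upwards [h0 j] with x hx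
    rw [Real.norm_eq_abs, abs_of_nonneg hx]
  exact (tendstoInMeasure_of_tendsto_eLpNorm one_ne_zero (fun j => (he j).1)
    aestronglyMeasurable_const h1).exists_seq_tendsto_ae

end Limits

/-! ### Almost everywhere convergence of the gradients -/

section GradientConvergence

variable {N : ℕ} {Ω : Set (EuclideanSpace ℝ (Fin N))} {p q ν : ℝ}
  {f : EuclideanSpace ℝ (Fin N) → ℝ → ℝ}

/-- The q-part is monotone and ν ≥ 0, so it may be dropped and the p-part alone controls
convergence. -/
theorem inner_plap_le_inner_fieldPQ (hq : 1 < q) (hν : 0 ≤ ν) (ξ η : EuclideanSpace ℝ (Fin N)) :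
    inner ℝ (plap p ξ - plap p η) (ξ - η) ≤
      inner ℝ (fieldPQ p q ν ξ - fieldPQ p q ν η) (ξ - η) := by
  have e : fieldPQ p q ν ξ - fieldPQ p q ν η =
      (plap p ξ - plap p η) + ν • (plap q ξ - plap q η) := by
    simp only [fieldPQ, smul_sub]
    abel
  rw [e, inner_add_left, real_inner_smul_left]
  exact le_add_of_nonneg_right (mul_nonneg hν (inner_plap_sub_nonneg hq _ _))

theorem tendsto_apply_zero {X : Type*} [NormedAddCommGroup X] [NormedSpace ℝ X]
    {L : ℕ → X →L[ℝ] ℝ} (hL : Tendsto L atTop (𝓝 0)) {z : ℕ → X} {B : ℝ} (hz : ∀ j, ‖z j‖ ≤ B) :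
    Tendsto (fun j => L j (z j)) atTop (𝓝 0) := by
  have h := hL.norm.mul_const B
  rw [norm_zero, zero_mul] at h
  exact squeeze_zero_norm (fun j => (L j).le_opNorm_of_le (hz j)) h

variable [Fact (1 ≤ ENNReal.ofReal p)]

theorem exists_fnInt_le (hp : 1 < p) (hpN : p < N) (B : ℝ) :
    ∃ M : ℝ, ∀ u : W0 Ω p, ‖u‖ ≤ B → fnInt (pStar N p) u ≤ M := by
  have hps := lt_pStar hp hpN
  have : Fact (1 ≤ ENNReal.ofReal (pStar N p)) := ⟨one_le_ofReal (by linarith)⟩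
  obtain ⟨J, hJ⟩ := exists_sobolev_embedding (Ω := Ω) hp hpN
  refine ⟨(‖J‖ * B) ^ pStar N p, fun u hu => ?_⟩
  have e : fnInt (pStar N p) u = ‖J u‖ ^ pStar N p := by
    rw [← integral_norm_rpow_eq (by linarith), fnInt]
    refine integral_congr_ae ?_
    filter_upwards [hJ u] with x hx
    rw [hx]
  rw [e]
  exact Real.rpow_le_rpow (norm_nonneg _) (J.le_opNorm_of_le hu) (by linarith)

theorem exists_gradient_functional {s' : ℝ} (hss : p.HolderConjugate s')
    {G : EuclideanSpace ℝ (Fin N) → EuclideanSpace ℝ (Fin N)}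
    (hG : MemLp G (ENNReal.ofReal s') (volume.restrict Ω)) :
    ∃ Λ : StrongDual ℝ (W0 Ω p), ∀ w, Λ w = ∫ x in Ω, inner ℝ (G x) (w.grad x) := by
  have : Fact (1 ≤ ENNReal.ofReal s') := ⟨one_le_ofReal hss.symm.lt.le⟩
  refine ⟨(pairing hss (hG.toLp G)).comp gradL, fun w => ?_⟩
  have e : ((pairing hss (hG.toLp G)).comp gradL) w = pairing hss (hG.toLp G) (gradL w) := rfl
  rw [e, pairing_apply]
  refine integral_congr_ae ?_
  filter_upwards [hG.coeFn_toLp] with x hx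
  rw [hx, gradL_coe]

/-- The derivative of the energy along a Palais–Smale sequence, tested with a truncation of the
deviation from the weak limit. -/
theorem tendsto_integral_truncation (hΩ : Bornology.IsBounded Ω) (hq : 1 < q) (hqp : q < p)
    (hpN : p < N) (hf : IsCaratheodory Ω f) (hg : SubcriticalGrowth Ω p f)
    {u z : ℕ → W0 Ω p} {v : W0 Ω p} {B : ℝ} (hB : ∀ j, ‖u j‖ ≤ B) (hzB : ∀ j, ‖z j‖ ≤ B)
    (hd : Tendsto (fun j => fderiv ℝ (energy q ν f) (u j)) atTop (𝓝 0))
    (hae : ∀ᵐ x ∂(volume.restrict Ω), Tendsto (fun j => (u j).fn x) atTop (𝓝 (v.fn x)))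
    {A : ℝ} (hA : 0 ≤ A) (hzA : ∀ j, ∀ᵐ x ∂(volume.restrict Ω), ‖(z j).fn x‖ ≤ A)
    (hz0 : ∀ᵐ x ∂(volume.restrict Ω), Tendsto (fun j => (z j).fn x) atTop (𝓝 0)) :
    Tendsto (fun j => ∫ x in Ω, inner ℝ (fieldPQ p q ν ((u j).grad x)) ((z j).grad x)) atTop
      (𝓝 0) := by
  have := isFiniteMeasure_restrict hΩ
  have hp : 1 < p := hq.trans hqp
  have hps := lt_pStar hp hpN
  obtain ⟨M, hM⟩ := exists_fnInt_le (Ω := Ω) hp hpN B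
  have h1 := (isPotential_reaction hp hpN hf hg).tendsto_integral_inner_of_bounded
    (hp.trans hps) (continuous_reaction hp hpN hf) (fun j => (u j).memLp_fn_pStar hp hpN)
    (fun j => hM (u j) (hB j)) hae (fun j => (z j).memLp_fn.1) hA hzA hz0
  have h2 : Tendsto (fun j => fderiv ℝ (energy q ν f) (u j) (z j)) atTop (𝓝 0) :=
    tendsto_apply_zero hd hzB
  have h3 := h2.add h1
  rw [add_zero] at h3
  refine h3.congr fun j => ?_
  rw [fderiv_energy_apply hΩ hq hqp hpN hf hg]
  ring

/-- Since |arctan t| ≤ |t| and 0 ≤ arctan' ≤ 1, truncation does not increase the norm, so truncated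
bounded sequences are admissible tests for E'(u_j) → 0. -/
theorem exists_truncation (hp : 1 < p) (w : W0 Ω p) : ∃ z : W0 Ω p, ‖z‖ ≤ ‖w‖ ∧
    z.fn =ᵐ[volume.restrict Ω] (fun x => Real.arctan (w.fn x)) ∧
    z.grad =ᵐ[volume.restrict Ω] (fun x => (1 / (1 + w.fn x ^ 2)) • w.grad x) := by
  obtain ⟨z, hz, hz'⟩ := exists_arctan hp w
  have h1 : ‖fnL z‖ ≤ ‖fnL w‖ := by
    refine Lp.norm_le_norm_of_ae_le ?_
    filter_upwards [hz] with x hx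
    rw [fnL_coe, fnL_coe, hx]
    exact abs_arctan_le _
  have h2 : ‖gradL z‖ ≤ ‖gradL w‖ := by
    refine Lp.norm_le_norm_of_ae_le ?_
    filter_upwards [hz'] with x hx
    rw [gradL_coe, gradL_coe, hx, norm_smul, Real.norm_eq_abs, abs_of_nonneg (by positivity)]
    exact mul_le_of_le_one_left (norm_nonneg _) (one_div_one_add_sq_le _)
  exact ⟨z, max_le_max h1 h2, hz, hz'⟩

theorem continuous_one_sub_one_div : Continuous fun t : ℝ => 1 - 1 / (1 + t ^ 2) :=
  continuous_const.sub (continuous_const.div (continuous_const.add (continuous_pow 2))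
    fun t => by positivity)

/-- The gradients of the truncations of a weakly null sequence, tested with a fixed field. -/
theorem tendsto_integral_inner_truncation {s' : ℝ} (hss : p.HolderConjugate s')
    {G : EuclideanSpace ℝ (Fin N) → EuclideanSpace ℝ (Fin N)}
    (hG : MemLp G (ENNReal.ofReal s') (volume.restrict Ω))
    {w z : ℕ → W0 Ω p} {B : ℝ} (hB : ∀ j, ‖w j‖ ≤ B)
    (hweak : ∀ Λ : StrongDual ℝ (W0 Ω p), Tendsto (fun j => Λ (w j)) atTop (𝓝 0))
    (hw0 : ∀ᵐ x ∂(volume.restrict Ω), Tendsto (fun j => (w j).fn x) atTop (𝓝 0))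
    (hz : ∀ j, (z j).grad =ᵐ[volume.restrict Ω]
      (fun x => (1 / (1 + (w j).fn x ^ 2)) • (w j).grad x)) :
    Tendsto (fun j => ∫ x in Ω, inner ℝ (G x) ((z j).grad x)) atTop (𝓝 0) := by
  obtain ⟨Λ, hΛ⟩ := exists_gradient_functional hss hG
  have t2 := hweak Λ
  simp_rw [hΛ] at t2
  -- The truncated gradient differs from ∇w_j by the factor 1 - 1/(1+w_j²), bounded by 1 and tending
  -- to 0 a.e.
  have t3 := tendsto_integral_mul_inner hss hG (W := fun j => (w j).grad)
    (fun j => (w j).memLp_grad) (fun j => gradInt_le_of_norm_le hss.pos (hB j))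
    (k := fun j x => 1 - 1 / (1 + (w j).fn x ^ 2))
    (fun j => continuous_one_sub_one_div.comp_aestronglyMeasurable (w j).memLp_fn.1)
    (fun j x => by
      have h1 := one_div_one_add_sq_le ((w j).fn x)
      have h2 : 0 ≤ 1 / (1 + (w j).fn x ^ 2) := by positivity
      rw [abs_le]
      constructor <;> linarith)
    (by
      filter_upwards [hw0] with x h1
      simpa [Function.comp_def] using (continuous_one_sub_one_div.tendsto 0).comp h1)
  have h := t2.sub t3
  rw [sub_self] at h
  refine h.congr fun j => ?_
  rw [sub_eq_iff_eq_add', ← sub_eq_iff_eq_add,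
    ← integral_sub (integrable_inner_holder hss hG (w j).memLp_grad)
      (integrable_inner_holder hss hG (z j).memLp_grad)]
  refine integral_congr_ae ?_
  filter_upwards [hz j] with x hx
  rw [hx, real_inner_smul_right]
  ring

/-- Monotonicity upgrades the convergence of the truncated integrals to almost everywhere
convergence of the gradients. -/
theorem exists_subseq_grad_tendsto_of_truncation (hΩ : Bornology.IsBounded Ω) (hq : 1 < q)
    (hqp : q < p) (hν : 0 ≤ ν) {u z : ℕ → W0 Ω p} {v : W0 Ω p}
    (hw0 : ∀ᵐ x ∂(volume.restrict Ω), Tendsto (fun j => (u j - v).fn x) atTop (𝓝 0))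
    (hz : ∀ j, (z j).grad =ᵐ[volume.restrict Ω]
      (fun x => (1 / (1 + (u j - v).fn x ^ 2)) • (u j - v).grad x))
    (t1 : Tendsto (fun j => ∫ x in Ω, inner ℝ (fieldPQ p q ν ((u j).grad x)) ((z j).grad x))
      atTop (𝓝 0))
    (t4 : Tendsto (fun j => ∫ x in Ω, inner ℝ (fieldPQ p q ν (v.grad x)) ((z j).grad x))
      atTop (𝓝 0)) :
    ∃ ns : ℕ → ℕ, StrictMono ns ∧ ∀ᵐ x ∂(volume.restrict Ω),
      Tendsto (fun n => (u (ns n)).grad x) atTop (𝓝 (v.grad x)) := by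
  have := isFiniteMeasure_restrict hΩ
  have hp : 1 < p := hq.trans hqp
  have hss := Real.HolderConjugate.conjExponent hp
  have hpot := isPotential_fieldPQ (Ω := Ω) (ν := ν) hq hqp
  have i1 := fun j =>
    integrable_inner_holder hss (hpot.memLp_grad hss (u j).memLp_grad) (z j).memLp_grad
  have i2 := fun j =>
    integrable_inner_holder hss (hpot.memLp_grad hss v.memLp_grad) (z j).memLp_grad
  have t5 := t1.sub t4
  rw [sub_self] at t5
  set e : ℕ → EuclideanSpace ℝ (Fin N) → ℝ := fun j x =>
    inner ℝ (fieldPQ p q ν ((u j).grad x)) ((z j).grad x) -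
      inner ℝ (fieldPQ p q ν (v.grad x)) ((z j).grad x) with he
  -- The integrand is the monotonicity expression times a positive weight, hence nonnegative:
  -- vanishing integrals give a.e. convergence along a subsequence.
  have hez : ∀ j, ∀ᵐ x ∂(volume.restrict Ω), e j x = 1 / (1 + (u j - v).fn x ^ 2) *
      inner ℝ (fieldPQ p q ν ((u j).grad x) - fieldPQ p q ν (v.grad x))
        ((u j).grad x - v.grad x) := fun j => by
    filter_upwards [hz j, W0.sub_grad (u j) v] with x h1 h2
    rw [he]
    simp only
    rw [← inner_sub_left, h1, h2, real_inner_smul_right]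
  have hmono : ∀ ξ η : EuclideanSpace ℝ (Fin N),
      0 ≤ inner ℝ (fieldPQ p q ν ξ - fieldPQ p q ν η) (ξ - η) := fun ξ η =>
    (inner_plap_sub_nonneg hp ξ η).trans (inner_plap_le_inner_fieldPQ hq hν ξ η)
  obtain ⟨ns, hns, hlim⟩ := exists_subseq_ae_of_tendsto_integral (e := e)
    (fun j => (i1 j).sub (i2 j)) (fun j => (hez j).mono fun x hx => by
      rw [hx]
      exact mul_nonneg (by positivity) (hmono _ _))
    (t5.congr fun j => (integral_sub (i1 j) (i2 j)).symm)
  refine ⟨ns, hns, ?_⟩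
  filter_upwards [hlim, hw0, ae_all_iff.2 hez] with x h1 h2 h3
  -- The weight is undone: 1 + (u_j - v)² tends to 1 a.e.
  have h4 : Tendsto (fun n => (1 + (u (ns n) - v).fn x ^ 2) * e (ns n) x) atTop (𝓝 0) := by
    have := (((h2.comp hns.tendsto_atTop).pow 2).const_add 1).mul h1
    simpa using this
  refine tendsto_of_inner_plap_sub hp (squeeze_zero (fun n => inner_plap_sub_nonneg hp _ _)
    (fun n => (inner_plap_le_inner_fieldPQ (q := q) (ν := ν) hq hν _ _).trans (le_of_eq ?_)) h4)
  rw [h3, ← mul_assoc, mul_one_div, div_self (by positivity), one_mul]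

/-- Along a Palais–Smale sequence the gradients converge almost everywhere, up to a
subsequence. -/
theorem exists_subseq_grad_tendsto (hΩ : Bornology.IsBounded Ω) (hq : 1 < q) (hqp : q < p)
    (hpN : p < N) (hν : 0 ≤ ν) (hf : IsCaratheodory Ω f) (hg : SubcriticalGrowth Ω p f)
    {u : ℕ → W0 Ω p} {v : W0 Ω p} {B : ℝ} (hB : ∀ j, ‖u j‖ ≤ B)
    (hd : Tendsto (fun j => fderiv ℝ (energy q ν f) (u j)) atTop (𝓝 0))
    (hweak : ∀ Λ : StrongDual ℝ (W0 Ω p), Tendsto (fun j => Λ (u j - v)) atTop (𝓝 0))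
    (hw0 : ∀ᵐ x ∂(volume.restrict Ω), Tendsto (fun j => (u j - v).fn x) atTop (𝓝 0))
    (hae : ∀ᵐ x ∂(volume.restrict Ω), Tendsto (fun j => (u j).fn x) atTop (𝓝 (v.fn x))) :
    ∃ ns : ℕ → ℕ, StrictMono ns ∧ ∀ᵐ x ∂(volume.restrict Ω),
      Tendsto (fun n => (u (ns n)).grad x) atTop (𝓝 (v.grad x)) := by
  have := isFiniteMeasure_restrict hΩ
  have hp : 1 < p := hq.trans hqp
  have hss := Real.HolderConjugate.conjExponent hp
  have hGv := (isPotential_fieldPQ (Ω := Ω) (ν := ν) hq hqp).memLp_grad hss v.memLp_grad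
  choose z hzw hz hz' using fun j => exists_truncation hp (u j - v)
  have hwB : ∀ j, ‖u j - v‖ ≤ B + ‖v‖ := fun j =>
    (norm_sub_le _ _).trans (add_le_add_left (hB j) _)
  have hzA : ∀ j, ∀ᵐ x ∂(volume.restrict Ω), ‖(z j).fn x‖ ≤ Real.pi / 2 := fun j => by
    filter_upwards [hz j] with x hx
    rw [hx, Real.norm_eq_abs, abs_le]
    exact ⟨(Real.neg_pi_div_two_lt_arctan _).le, (Real.arctan_lt_pi_div_two _).le⟩
  have hz0 : ∀ᵐ x ∂(volume.restrict Ω), Tendsto (fun j => (z j).fn x) atTop (𝓝 0) := by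
    filter_upwards [hw0, ae_all_iff.2 hz] with x h1 h2
    simp_rw [h2]
    simpa [Function.comp_def] using (Real.continuous_arctan.tendsto 0).comp h1
  exact exists_subseq_grad_tendsto_of_truncation hΩ hq hqp hν hw0 hz'
    (tendsto_integral_truncation hΩ hq hqp hpN hf hg
      (fun j => (hB j).trans (le_add_of_nonneg_right (norm_nonneg v)))
      (fun j => (hzw j).trans (hwB j)) hd hae (by positivity) hzA hz0)
    (tendsto_integral_inner_truncation hss hGv hwB hweak hw0 hz')

end GradientConvergence

/-! ### The compactness threshold and criticality of the limit -/

section Compactness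

variable {N : ℕ} {Ω : Set (EuclideanSpace ℝ (Fin N))} {p q ν : ℝ}
  {f : EuclideanSpace ℝ (Fin N) → ℝ → ℝ}

/-- From S T^{p/s} ≤ T and p/s = 1 - p/n one gets T ≥ S^{n/p}; inserting this in S T^{p/s} ≤ l gives
the bound for l itself. -/
theorem rpow_le_of_sobolev {S T l n s : ℝ} (hp : 0 < p) (hn : 0 < n) (hs0 : 0 < s)
    (hs : 1 / s = 1 / p - 1 / n) (hS : 0 ≤ S) (hT : 0 < T) (hl : l ≤ T)
    (h : S * T ^ (p / s) ≤ l) : S ^ (n / p) ≤ l := by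
  have hl0 : 0 ≤ l := le_trans (by positivity) h
  rcases hS.eq_or_lt with hS | hS
  · rw [← hS, Real.zero_rpow (by positivity)]
    exact hl0
  have e1 : p / s = 1 - p / n := by
    rw [div_eq_mul_one_div, hs, mul_sub, mul_one_div_cancel hp.ne', mul_one_div]
  have h1 : S ≤ T ^ (p / n) := by
    have h2 : S * T ^ (p / s) ≤ T ^ (p / n) * T ^ (p / s) := by
      rw [← Real.rpow_add hT, show p / n + p / s = 1 by rw [e1]; ring, Real.rpow_one]
      exact h.trans hl
    exact le_of_mul_le_mul_right h2 (by positivity)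
  have h2 : S ^ (n / p) ≤ T := by
    have := Real.rpow_le_rpow hS.le h1 (by positivity : 0 ≤ n / p)
    rwa [← Real.rpow_mul hT.le, div_mul_div_cancel₀ hn.ne', div_self hp.ne', Real.rpow_one] at this
  have h3 := Real.rpow_le_rpow (by positivity) h2 (by positivity : 0 ≤ p / s)
  rw [← Real.rpow_mul hS.le] at h3
  have e2 : n / p = 1 + n / p * (p / s) := by
    rw [e1, mul_sub, div_mul_div_cancel₀ hp.ne', div_self hn.ne']
    ring
  rw [e2, Real.rpow_add hS, Real.rpow_one]
  exact (mul_le_mul_of_nonneg_left h3 hS.le).trans h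

/-- The compactness threshold, in terms of the integrals along a sequence. -/
theorem threshold_le_of_tendsto {P Q R F G : ℕ → ℝ} {M S c n s : ℝ} (hq : 0 < q) (hqp : q < p)
    (hν : 0 ≤ ν) (hn : 0 < n) (hps : p < s) (hs : 1 / s = 1 / p - 1 / n) (hS : 0 ≤ S) (hc : 0 < c)
    (hP : ∀ j, 0 ≤ P j) (hPM : ∀ j, P j ≤ M) (hQ : ∀ j, 0 ≤ Q j)
    (hF : Tendsto F atTop (𝓝 0)) (hG : Tendsto G atTop (𝓝 0))
    (hE : Tendsto (fun j => 1 / p * P j + ν * (1 / q * Q j) - F j - 1 / s * R j) atTop (𝓝 c))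
    (hE' : Tendsto (fun j => P j + ν * Q j - G j - R j) atTop (𝓝 0))
    (hSob : ∀ j, S * R j ^ (p / s) ≤ P j) : 1 / n * S ^ (n / p) ≤ c := by
  have hp : 0 < p := hq.trans hqp
  obtain ⟨l, -, φ, hφ, hl⟩ := isCompact_Icc.tendsto_subseq (fun j => ⟨hP j, hPM j⟩ : ∀ j, P j ∈ Icc 0 M)
  have hφ' := hφ.tendsto_atTop
  have hl0 : 0 ≤ l := ge_of_tendsto' hl fun j => hP _
  set κ : ℝ := 1 / q - 1 / s with hκ
  have hκ0 : 0 < κ := sub_pos.2 (one_div_lt_one_div_of_lt hq (hqp.trans hps))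
  have hQlim : Tendsto (fun j => ν * Q (φ j)) atTop (𝓝 ((c - 1 / n * l) / κ)) := by
    -- Energy minus 1/s times the derivative removes `R` and leaves P/n + κ ν Q, so convergence of
    -- `P` alone determines the limit of ν Q.
    have h1 := (((((hE.comp hφ').add (hF.comp hφ')).sub
      (((hE'.comp hφ').add (hG.comp hφ')).const_mul (1 / s))).sub
        (hl.const_mul (1 / n)))).div_const κ
    have e : (c + 0 - 1 / s * (0 + 0) - 1 / n * l) / κ = (c - 1 / n * l) / κ := by ring
    rw [e] at h1
    refine h1.congr fun j => ?_
    rw [div_eq_iff hκ0.ne', hκ]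
    simp only [Function.comp]
    rw [hs]
    ring
  set m : ℝ := (c - 1 / n * l) / κ with hm
  have hm0 : 0 ≤ m := ge_of_tendsto' hQlim fun j => mul_nonneg hν (hQ _)
  have hRlim : Tendsto (fun j => R (φ j)) atTop (𝓝 (l + m)) := by
    have h1 := (hl.add hQlim).sub ((hE'.comp hφ').add (hG.comp hφ'))
    rw [add_zero, sub_zero] at h1
    refine h1.congr fun j => ?_
    simp only [Function.comp]
    ring
  have hcl : c = 1 / n * l + κ * m := by
    rw [hm]
    field_simp
    ring
  -- l = m = 0 would give c = 0.
  have hT : 0 < l + m := by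
    rcases hl0.eq_or_lt with h | h
    · rcases hm0.eq_or_lt with h' | h'
      · rw [← h, ← h'] at hcl
        linarith
      · linarith
    · linarith
  have hSl : S * (l + m) ^ (p / s) ≤ l :=
    le_of_tendsto_of_tendsto' ((hRlim.rpow_const (Or.inl hT.ne')).const_mul S) hl fun j => hSob _
  have h1 := rpow_le_of_sobolev hp hn (hp.trans hps) hs hS hT (le_add_of_nonneg_right hm0) hSl
  have h2 : 1 / n * S ^ (n / p) ≤ 1 / n * l := mul_le_mul_of_nonneg_left h1 (by positivity)
  have h3 : 0 ≤ κ * m := by positivity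
  linarith

variable [Fact (1 ≤ ENNReal.ofReal p)]

/-- An arbitrarily small multiple of the bounded critical integral, plus a constant on a set of
finite measure, is the domination required by `tendsto_integral_norm_zero`. -/
theorem tendsto_integral_of_subcritical (hΩ : Bornology.IsBounded Ω) (hp : 1 < p) (hpN : p < N)
    {u : ℕ → W0 Ω p} {M : ℝ} (hM : ∀ j, fnInt (pStar N p) (u j) ≤ M)
    {g : ℕ → EuclideanSpace ℝ (Fin N) → ℝ}
    (hg : ∀ j, AEStronglyMeasurable (g j) (volume.restrict Ω))
    (hg0 : ∀ᵐ x ∂(volume.restrict Ω), Tendsto (fun j => g j x) atTop (𝓝 0))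
    (hle : ∀ ε : ℝ, 0 < ε → ∃ C : ℝ, ∀ j, ∀ᵐ x ∂(volume.restrict Ω),
      |g j x| ≤ C + ε * ‖(u j).fn x‖ ^ pStar N p) :
    Tendsto (fun j => ∫ x in Ω, g j x) atTop (𝓝 0) := by
  have := isFiniteMeasure_restrict hΩ
  have hM0 : 0 ≤ M := (fnInt_nonneg _ _).trans (hM 0)
  refine tendsto_integral_zero_of_norm (tendsto_integral_norm_zero hg hg0 fun ε hε => ?_)
  obtain ⟨C, hC⟩ := hle (ε / (M + 1)) (by positivity)
  refine ⟨fun _ => C, fun j x => ε / (M + 1) * ‖(u j).fn x‖ ^ pStar N p, integrable_const C,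
    fun j => ((u j).integrable_fn_rpow hp hpN).const_mul _,
    fun j => Eventually.of_forall fun x => by positivity, Eventually.of_forall fun j => ?_, hC⟩
  rw [integral_const_mul]
  have h1 : ε / (M + 1) * ∫ x in Ω, ‖(u j).fn x‖ ^ pStar N p ≤ ε / (M + 1) * (M + 1) :=
    mul_le_mul_of_nonneg_left ((hM j).trans (by linarith)) (by positivity)
  refine h1.trans (le_of_eq ?_)
  field_simp

theorem sobolevConst_nonneg : 0 ≤ sobolevConst Ω p :=
  Real.iInf_nonneg fun u => by positivity

/-- A Palais–Smale sequence at a positive level that vanishes almost everywhere lives at least at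
the compactness threshold. -/
theorem cStar_le_of_tendsto_zero (hΩ : Bornology.IsBounded Ω) (hq : 1 < q) (hqp : q < p)
    (hpN : p < N) (hν : 0 ≤ ν) (hf : IsCaratheodory Ω f) (hg : SubcriticalGrowth Ω p f) {c : ℝ}
    (hc : 0 < c) {u : ℕ → W0 Ω p} (hu : IsPalaisSmale (energy q ν f) c u) {B : ℝ}
    (hB : ∀ j, ‖u j‖ ≤ B)
    (hae : ∀ᵐ x ∂(volume.restrict Ω), Tendsto (fun j => (u j).fn x) atTop (𝓝 0)) :
    cStar Ω p ≤ c := by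
  have hp : 1 < p := hq.trans hqp
  obtain ⟨M, hM⟩ := exists_fnInt_le (Ω := Ω) hp hpN B
  have hsub : ∀ ε : ℝ, 0 < ε → ∃ C : ℝ, 0 ≤ C ∧ ∀ᵐ x ∂(volume.restrict Ω), ∀ t : ℝ,
      |∫ τ in (0 : ℝ)..t, f x τ| ≤ C + ε * ‖t‖ ^ pStar N p ∧
      |f x t * t| ≤ C + ε * ‖t‖ ^ pStar N p := fun ε hε => exists_subcritical_le hp hg hε
  have hF : Tendsto (fun j => ∫ x in Ω, ∫ τ in (0 : ℝ)..((u j).fn x), f x τ) atTop (𝓝 0) := by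
    refine tendsto_integral_of_subcritical hΩ hp hpN (fun j => hM (u j) (hB j))
      (fun j => aestronglyMeasurable_F_comp hf (u j)) ?_ fun ε hε => ?_
    · filter_upwards [hae, hf.continuous] with x h1 h2
      have h3 := ((intervalIntegral.continuous_primitive (μ := volume)
        (fun a b => h2.intervalIntegrable a b) 0).tendsto 0).comp h1
      simpa [Function.comp_def] using h3
    · obtain ⟨C, -, hC⟩ := hsub ε hε
      exact ⟨C, fun j => hC.mono fun x hx => (hx _).1⟩
  have hG : Tendsto (fun j => ∫ x in Ω, f x ((u j).fn x) * (u j).fn x) atTop (𝓝 0) := by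
    refine tendsto_integral_of_subcritical hΩ hp hpN (fun j => hM (u j) (hB j))
      (fun j => (aestronglyMeasurable_f_comp hf (u j)).mul (u j).memLp_fn.1) ?_ fun ε hε => ?_
    · filter_upwards [hae, hf.continuous] with x h1 h2
      have h3 := ((h2.tendsto 0).comp h1).mul h1
      simpa [Function.comp_def] using h3
    · obtain ⟨C, -, hC⟩ := hsub ε hε
      exact ⟨C, fun j => hC.mono fun x hx => (hx _).2⟩
  have hE := hu.level
  simp_rw [energy_expand hΩ hq hqp hpN hf hg] at hE
  have hE' := tendsto_apply_zero hu.deriv hB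
  simp_rw [fderiv_energy_self hΩ hq hqp hpN hf hg] at hE'
  exact threshold_le_of_tendsto (by linarith) hqp hν (by linarith) (lt_pStar hp hpN)
    (by simpa only [one_div] using pStar_inv hp hpN) sobolevConst_nonneg hc
    (fun j => gradInt_nonneg p (u j)) (fun j => gradInt_le_of_norm_le (by linarith) (hB j))
    (fun j => gradInt_nonneg q (u j)) hF hG hE hE' fun j => sobolevConst_mul_le hp hpN (u j)

/-- Almost everywhere limits of bounded sequences with vanishing derivatives are critical points. -/
theorem isCriticalPoint_of_tendsto (hΩ : Bornology.IsBounded Ω) (hq : 1 < q) (hqp : q < p)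
    (hpN : p < N) (hf : IsCaratheodory Ω f) (hg : SubcriticalGrowth Ω p f)
    {u : ℕ → W0 Ω p} {v : W0 Ω p} {B : ℝ} (hB : ∀ j, ‖u j‖ ≤ B)
    (hd : Tendsto (fun j => fderiv ℝ (energy q ν f) (u j)) atTop (𝓝 0))
    (hae : ∀ᵐ x ∂(volume.restrict Ω), Tendsto (fun j => (u j).fn x) atTop (𝓝 (v.fn x)))
    (hae' : ∀ᵐ x ∂(volume.restrict Ω), Tendsto (fun j => (u j).grad x) atTop (𝓝 (v.grad x))) :
    IsCriticalPoint (energy (p := p) q ν f) v := by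
  have := isFiniteMeasure_restrict hΩ
  have hp : 1 < p := hq.trans hqp
  obtain ⟨M, hM⟩ := exists_fnInt_le (Ω := Ω) hp hpN B
  obtain ⟨L, hL, hLφ⟩ := hasFDerivAt_energy (ν := ν) hΩ hq hqp hpN hf hg v
  have key : ∀ φ, L φ = 0 := fun φ => by
    have h1 := (isPotential_fieldPQ (Ω := Ω) (ν := ν) hq hqp).tendsto_integral_inner hp
      (Eventually.of_forall fun _ => continuous_fieldPQ hq hqp) (fun j => (u j).memLp_grad)
      v.memLp_grad φ.memLp_grad (fun j => gradInt_le_of_norm_le (by linarith) (hB j)) hae'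
    have h2 := (isPotential_reaction hp hpN hf hg).tendsto_integral_inner
      (hp.trans (lt_pStar hp hpN)) (continuous_reaction hp hpN hf)
      (fun j => (u j).memLp_fn_pStar hp hpN) (v.memLp_fn_pStar hp hpN)
      (φ.memLp_fn_pStar hp hpN) (fun j => hM (u j) (hB j)) hae
    have h3 := h1.sub h2
    rw [← hLφ] at h3
    have h4 : Tendsto (fun j => fderiv ℝ (energy q ν f) (u j) φ) atTop (𝓝 0) :=
      tendsto_apply_zero (z := fun _ => φ) hd fun _ => le_rfl
    simp_rw [fderiv_energy_apply hΩ hq hqp hpN hf hg] at h4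
    exact tendsto_nhds_unique h3 h4
  have e : L = 0 := ContinuousLinearMap.ext key
  rw [e] at hL
  exact hL

end Compactness

end CriticalPQ

end

/-! ### Assembly: nested subsequences and nontriviality of the limit -/

theorem proposition3p1 {N : ℕ} (Ω : Set (EuclideanSpace ℝ (Fin N)))
    (hΩ_open : IsOpen Ω) (hΩ_conn : IsConnected Ω) (hΩ_bdd : Bornology.IsBounded Ω)
    (p q ν : ℝ) [Fact (1 ≤ ENNReal.ofReal p)]
    (hq : 1 < q) (hqp : q < p) (hpN : p < N) (hν : 0 ≤ ν)
    (f : EuclideanSpace ℝ (Fin N) → ℝ → ℝ)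
    (hf : CriticalPQ.IsCaratheodory Ω f) (hf_growth : CriticalPQ.SubcriticalGrowth Ω p f)
    (c : ℝ) (hc_pos : 0 < c) (hc_lt : c < CriticalPQ.cStar Ω p)
    (u : ℕ → CriticalPQ.W0 Ω p)
    (hu : CriticalPQ.IsPalaisSmale (CriticalPQ.energy q ν f) c u) :
    ∃ φ : ℕ → ℕ, StrictMono φ ∧ ∃ v : CriticalPQ.W0 Ω p,
      CriticalPQ.WeaklyConverges (fun k => u (φ k)) v ∧ v ≠ 0 ∧
        CriticalPQ.IsCriticalPoint (CriticalPQ.energy (p := p) q ν f) v := by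
  have hp : 1 < p := hq.trans hqp
  obtain ⟨B, hB⟩ :=
    CriticalPQ.exists_norm_le_of_palaisSmale hΩ_bdd hq hqp hpN hν hf hf_growth hu
  obtain ⟨φ₁, hφ₁, v, hv⟩ := CriticalPQ.exists_subseq_weakly_converges hΩ_bdd hp hpN hB
  have hv0 : ∀ Λ : StrongDual ℝ (CriticalPQ.W0 Ω p),
      Tendsto (fun n => Λ (u (φ₁ n) - v)) atTop (𝓝 0) := fun Λ => by
    have h := (hv Λ).sub_const (Λ v)
    rw [sub_self] at h
    exact h.congr fun n => (map_sub Λ _ _).symm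
  obtain ⟨φ₂, hφ₂, hae₀⟩ := CriticalPQ.exists_subseq_ae_tendsto_zero hΩ_bdd hp
    (w := fun n => u (φ₁ n) - v) (B := B + ‖v‖)
    (fun n => (norm_sub_le _ _).trans (add_le_add_left (hB _) _)) hv0
  have hae : ∀ᵐ x ∂(volume.restrict Ω),
      Tendsto (fun n => (u (φ₁ (φ₂ n))).fn x) atTop (𝓝 (v.fn x)) := by
    filter_upwards [hae₀, ae_all_iff.2 fun n => CriticalPQ.W0.sub_fn (u (φ₁ n)) v] with x h1 h2
    simp_rw [h2] at h1
    simpa using h1.add_const (v.fn x)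
  have hφ₁₂ : StrictMono fun n => φ₁ (φ₂ n) := hφ₁.comp hφ₂
  obtain ⟨φ₃, hφ₃, hgrad⟩ := CriticalPQ.exists_subseq_grad_tendsto hΩ_bdd hq hqp hpN hν hf
    hf_growth (fun n => hB (φ₁ (φ₂ n))) (hu.deriv.comp hφ₁₂.tendsto_atTop)
    (fun Λ => (hv0 Λ).comp hφ₂.tendsto_atTop) hae₀ hae
  have hφ : StrictMono fun n => φ₁ (φ₂ (φ₃ n)) := hφ₁₂.comp hφ₃
  have hd := hu.deriv.comp hφ.tendsto_atTop
  have hae' : ∀ᵐ x ∂(volume.restrict Ω),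
      Tendsto (fun n => (u (φ₁ (φ₂ (φ₃ n)))).fn x) atTop (𝓝 (v.fn x)) := by
    filter_upwards [hae] with x hx using hx.comp hφ₃.tendsto_atTop
  refine ⟨_, hφ, v, CriticalPQ.weaklyConverges_of_forall_dual fun Λ =>
    (hv Λ).comp (hφ₂.comp hφ₃).tendsto_atTop, ?_,
    CriticalPQ.isCriticalPoint_of_tendsto hΩ_bdd hq hqp hpN hf hf_growth
      (fun n => hB (φ₁ (φ₂ (φ₃ n)))) hd hae' hgrad⟩
  -- With zero limit the sequence tends to 0 a.e., which puts its level at or above the threshold.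
  rintro rfl
  refine hc_lt.not_ge (CriticalPQ.cStar_le_of_tendsto_zero hΩ_bdd hq hqp hpN hν hf hf_growth hc_pos
    (u := fun n => u (φ₁ (φ₂ (φ₃ n)))) ⟨hu.level.comp hφ.tendsto_atTop, hd⟩
    (fun n => hB (φ₁ (φ₂ (φ₃ n)))) ?_)
  have h0 : (0 : CriticalPQ.W0 Ω p).fn =ᵐ[volume.restrict Ω] 0 := Lp.coeFn_zero _ _ _
  filter_upwards [hae', h0] with x h1 h2
  rwa [h2] at h1
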